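/- **Model.** Let $n=2^{L_{max}+1}$, $x_i=i/n$, and $Y_i=f_0(x_i)+\varepsilon_i$ with $\varepsilon_i$ i.i.d. $N(0,1)$, $1\le i\le n$. Let $\psi_{-1,0}=1_{[0,1]}$ and $\psi_{lk}(x)=2^{l/2}\psi(2^lx-k)$ with $\psi=1_{(0,1/2]}-1_{(1/2,1]}$ be the Haar basis. For $L\le L_{max}$ let $\mathbb T_L$ be the set of dyadic trees $T$ of depth at most $L$: $T_{int}$ consists of $(-1,0)$ and of a set of nodes $(l,k)$, $0\le l<L$, $0\le k<2^l$, containing with a node all its ancestors; $T_{ext}$ is the set of nodes that are not internal but whose parent is (and $T_{ext}=\{(0,0)\}$ for the null tree $T_{int}=\{(-1,0)\}$). Order trees by inclusion of the internal nodes. The prior is $\Pi(T)\propto\prod_{T_{int}}n^{-c}\prod_{T_{ext}}(1-n^{-c})$ on $\mathbb T_L$, and given $T$ the coefficients $(\beta_{lk})_{(l,k)\in T_{int}}$ are i.i.d. $N(0,1)$ and the others are $0$. Let $\Pi(T\mid Y)$ be the posterior. **Signal.** $f_0=\sum_{(l,k)\in\mathcal B}\beta^*_{lk}\psi_{lk}$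 with $\mathcal B\subseteq\{(l,k):-1\le l<L\}$ and $A\log n/\sqrt n<|\beta^*_{lk}|<C$ on $\mathcal B$; $T^*$ is the smallest tree in $\mathbb T_L$ with $\mathcal B\subseteq T^*_{int}$. The signal is *connected* if $T^*_{int}=\mathcal B\cup\{(-1,0)\}$. **Samplers.** Both are Metropolis–Hastings chains on $\mathbb T_L$ with target $\Pi(\cdot\mid Y)$, whose proposal is a GROW move with probability $1/2$ and else a PRUNE move (always GROW at the null tree, always PRUNE at the full tree). *Bayesian CART*: GROW makes a uniformly chosen external node internal (a proposal outside $\mathbb T_L$ is rejected); PRUNE makes external a uniformly chosen pre-terminal node, i.e. an internal node both of whose children are external. *Twiggy Bayesian CART* with parameter $1<D\le e$: GROW chooses a level $l<L$ among those with a non-internal node with probability proportional to $D^{-l}$, then uniformly a non-internal node $(l,k)$ of this level, and makes internal all nodes on the path to $(l,k)$ from the external node above it (or equal to it); PRUNE chooses uniformly an internal node $(l,k)\ne(-1,0)$ whose internal descendants, itself included, form a downward path, and removes this path from $T_{int}$. Let $P$ be the transition matrix, $P_{lazy}=(P+I)/2$, and let $$\tau_\epsilon=\max_{T\in\mathbb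 T_L}\min\{t\in\mathbb N:\ \|P_{lazy}^{t'}(T,\cdot)-\Pi(\cdot\mid Y)\|_{TV}\le\epsilon\ \text{ for all } t'\ge t\}.$$ Put $\delta_1=M=1$ for Bayesian CART and $\delta_1=\frac{2(D-1)}{D^L-1}$, $M=2L$ for Twiggy Bayesian CART. Let $F=(f_0(x_i))_{i\le n}$, let $X_T$ be the matrix with columns $(\psi_{lk}(x_i))_{i\le n}$, $(l,k)\in T_{int}$, and $$V_1(T)=\exp\Big\{\tfrac{1}{2^LC^2n}F'\big(I-\tfrac1nX_TX_T'\big)F\Big\},\quad V_2(T)=\exp\Big\{\tfrac1{2^L}\big(|T_{int}\setminus T^*_{int}|+(|T^*_{int}\setminus T_{int}|\wedge1)(2^L-|T_{int}\cup T^*_{int}|)\big)\Big\}.$$ **Theorem.** (1) There is an absolute constant $K>0$ such that for every $c>3$ there is $A_0=A_0(c)>0$ such that the following holds for all $A\ge A_0$, $C>0$ and either of the two samplers (with $1<D\le e$ for the Twiggy one). There is $L_0$, depending on $c$, $A$, $C$ and the sampler, such that for all $L_0\le L\le L_{max}$ and every signal as above, which has to be connected in the case of Bayesian CART, we have with probability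 at least $1-4/n$ simultaneously: (i) for every $T\in\mathbb T_L$ with $T\not\supseteq T^*$, $$\frac{(PV_1)(T)}{V_1(T)}\le1-\frac{\delta_1A^2\log^2n}{2^{2L+2}C^2n}+\frac{e-1}{2\,n^{(A^2/8)\log n-1}};$$ (ii) for every $T\in\mathbb T_L$ with $T\supsetneq T^*$, $$\frac{(PV_2)(T)}{V_2(T)}\le1-\frac1{2^{2L+2}}+\frac M{n^{c-3/2}}+n^{1-(A^2\log n)/8};$$ (iii) if $c\ge4$, then for all $\epsilon\in(0,1)$ $$\tau_\epsilon\le K\,\log(6/\epsilon)\,\max\Big(\frac{C^2}{\delta_1A^2}\,\frac{2^{2L}n}{\log^2n},\ 2^{2L+1}\Big).$$ (2) The rate in (iii) improves on the canonical-path bound $$\kappa\,2^{2L+3}\Big\{n\big[(c+\tfrac12)\log(1+n)+|T^*_{int}|C^2+1\big]+4|T^*_{int}|\log n+\log(2/\epsilon)\Big\},$$ where $\kappa=1$ for Bayesian CART and $\kappa=\frac{D^L-1}{D-1}$ for Twiggy Bayesian CART, by at least a logarithmic factor: for fixed $c\ge4$, $A$, $C>0$, sampler and $\epsilon\in(0,1)$,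 there is $K'>0$ such that for all $1\le L\le L_{max}$ and every value of $|T^*_{int}|$, $\log(6/\epsilon)\max\big(\frac{C^2}{\delta_1A^2}\frac{2^{2L}n}{\log^2n},2^{2L+1}\big)$ is at most $\frac{K'}{\log n}$ times this bound. -/

import Mathlib

open MeasureTheory ProbabilityTheory
open scoped ENNReal Matrix

namespace BCART

/-! ### Dyadic trees -/

/-- A node `(l, k)` of the dyadic tree, `l` the level and `k < 2 ^ l` the position in the level. -/
abbrev Node := ℕ × ℕ

/-- A wavelet index: `none` stands for `(-1, 0)`, `some (l, k)` for `(l, k)` with `0 ≤ l`. -/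
abbrev Index := Option Node

/-- All nodes of level less than `L` (without `(-1, 0)`). -/
def fullNodes (L : ℕ) : Finset Node :=
  (Finset.range L ×ˢ Finset.range (2 ^ L)).filter fun v => v.2 < 2 ^ v.1

/-- All indices of level less than `L`, including `(-1, 0)`. -/
def fullIndices (L : ℕ) : Finset Index := Finset.insertNone (fullNodes L)

/-- `u` is an ancestor of `v`, or `u = v`. -/
def IsAnc (u v : Node) : Prop := u.1 ≤ v.1 ∧ u.2 = v.2 / 2 ^ (v.1 - u.1)

instance (u v : Node) : Decidable (IsAnc u v) := inferInstanceAs (Decidable (_ ∧ _))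

/-- The twig `[u ↔ v]`: the nodes on the path from `u` down to its descendant `v`. -/
def twig (u v : Node) : Finset Node :=
  (Finset.Icc u.1 v.1).image fun j => (j, v.2 / 2 ^ (v.1 - j))

/-- The possible sets of internal nodes, without `(-1, 0)`, of trees of depth at most `L`: the sets
of nodes of level less than `L` that contain with a node all its ancestors. -/
def treeSets (L : ℕ) : Finset (Finset Node) :=
  (fullNodes L).powerset.filter fun S =>
    ∀ v ∈ S, ∀ j < v.1, (j, v.2 / 2 ^ (v.1 - j)) ∈ S

/-- The set of trees of depth at most `L`. A tree is determined by its internal nodes, and `(-1, 0)`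
is an internal node of every tree; so a tree `T` is given by `T.1`, the set of its internal
nodes other than `(-1, 0)`. -/
abbrev CartTree (L : ℕ) := {S : Finset Node // S ∈ treeSets L}

variable {L : ℕ}

/-- The internal nodes, including `(-1, 0)`. -/
def CartTree.int (T : CartTree L) : Finset Index := Finset.insertNone T.1

/-- The external nodes: those that are not internal but whose parent is. The root `(0, 0)` is
external in the null tree. External nodes may have level `L`. -/
def CartTree.ext (T : CartTree L) : Finset Node :=
  (fullNodes (L + 1)).filter fun v => v ∉ T.1 ∧ (v.1 = 0 ∨ (v.1 - 1, v.2 / 2) ∈ T.1)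

/-- The pre-terminal nodes: the internal nodes both of whose children are external. -/
def CartTree.preterminal (T : CartTree L) : Finset Node :=
  T.1.filter fun v => (v.1 + 1, 2 * v.2) ∈ T.ext ∧ (v.1 + 1, 2 * v.2 + 1) ∈ T.ext

/-- The descendants of `v` (including `v`) among the internal nodes. -/
def CartTree.desc (T : CartTree L) (v : Node) : Finset Node := T.1.filter fun w => IsAnc v w

/-! ### The proposal distributions -/

/-- The probability of a GROW move: 1 at the null tree, 0 at the full tree, else 1/2. -/
noncomputable def growProb (T : CartTree L) : ℝ :=
  if T.1 = ∅ then 1 else if T.1 = fullNodes L then 0 else 1 / 2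

/-- GROW of Bayesian CART: a uniformly chosen external node becomes internal. A node of level `L`
that is chosen leads out of the state space; such a proposal is rejected. -/
noncomputable def cartGrow (T T' : CartTree L) : ℝ :=
  ∑ v ∈ T.ext, if T'.1 = insert v T.1 then 1 / (T.ext.card : ℝ) else 0

/-- PRUNE of Bayesian CART: a uniformly chosen pre-terminal node becomes external. -/
noncomputable def cartPrune (T T' : CartTree L) : ℝ :=
  ∑ v ∈ T.preterminal, if T'.1 = T.1.erase v then 1 / (T.preterminal.card : ℝ) else 0

/-- The positions of level `l` that are not occupied by internal nodes. -/
def CartTree.free (T : CartTree L) (l : ℕ) : Finset ℕ :=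
  (Finset.range (2 ^ l)).filter fun k => (l, k) ∉ T.1

/-- The levels that have a node that is not internal. -/
def CartTree.eligible (T : CartTree L) : Finset ℕ :=
  (Finset.range L).filter fun l => (T.free l).Nonempty

/-- Twiggy GROW: choose an eligible level `l` with probability proportional to `D ^ (-l)`, then
uniformly a node `(l, k)` of that level that is not internal, and attach the twig to `(l, k)` from
the closest external node, that is, from the external node above `(l, k)`. -/
noncomputable def twiggyGrow (D : ℝ) (T T' : CartTree L) : ℝ :=
  ∑ l ∈ T.eligible, ∑ k ∈ T.free l,
    if ∃ e ∈ T.ext, IsAnc e (l, k) ∧ T'.1 = T.1 ∪ twig e (l, k) then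
      ((D ^ l)⁻¹ / ∑ l' ∈ T.eligible, (D ^ l')⁻¹) / ((T.free l).card : ℝ)
    else 0

/-- The internal nodes whose entire branch below them is a twig. -/
def CartTree.twigTops (T : CartTree L) : Finset Node :=
  T.1.filter fun v => ∃ w ∈ T.1, IsAnc v w ∧ T.desc v = twig v w

/-- Twiggy PRUNE: remove the branch below a node chosen uniformly among those whose branch is a
twig. -/
noncomputable def twiggyPrune (T T' : CartTree L) : ℝ :=
  ∑ v ∈ T.twigTops, if T'.1 = T.1 \ T.desc v then 1 / (T.twigTops.card : ℝ) else 0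

/-- The two (non-informed) samplers; `D` is the depth penalty of the Twiggy proposal. -/
inductive Sampler
  | bayesianCART
  | twiggy (D : ℝ)

/-- The range of the parameter of the sampler: `1 < D ≤ e`. -/
def Sampler.Valid : Sampler → Prop
  | .bayesianCART => True
  | .twiggy D => 1 < D ∧ D ≤ Real.exp 1

/-- The proposal probability `S(T → T')`. -/
noncomputable def Sampler.proposal : Sampler → CartTree L → CartTree L → ℝ
  | .bayesianCART, T, T' => growProb T * cartGrow T T' + (1 - growProb T) * cartPrune T T'
  | .twiggy D, T, T' => growProb T * twiggyGrow D T T' + (1 - growProb T) * twiggyPrune T T'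

/-- The constant `δ₁`. -/
noncomputable def Sampler.delta : Sampler → ℕ → ℝ
  | .bayesianCART, _ => 1
  | .twiggy D, L => 2 * (D - 1) / (D ^ L - 1)

/-- The constant `M`. -/
def Sampler.bigM : Sampler → ℕ → ℝ
  | .bayesianCART, _ => 1
  | .twiggy _, L => 2 * L

/-! ### Markov chains on a finite state space -/

section Chains

variable {α : Type*} [Fintype α] [DecidableEq α]

/-- The Metropolis-Hastings transition matrix for the proposal `S` and the target `π`. -/
noncomputable def metropolisHastings (S : α → α → ℝ) (π : α → ℝ) : Matrix α α ℝ :=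
  let move : α → α → ℝ := fun x y => S x y * min 1 (π y * S y x / (π x * S x y))
  fun x y => if y = x then 1 - ∑ z ∈ Finset.univ.erase x, move x z else move x y

/-- The lazy version of a transition matrix. -/
noncomputable def lazyChain (P : Matrix α α ℝ) : Matrix α α ℝ :=
  (1 / 2 : ℝ) • P + (1 / 2 : ℝ) • (1 : Matrix α α ℝ)

/-- The total variation distance between `P ^ t (x, ·)` and `π`. -/
noncomputable def tvDist (P : Matrix α α ℝ) (π : α → ℝ) (x : α) (t : ℕ) : ℝ :=
  ⨆ S : Finset α, |∑ y ∈ S, (P ^ t) x y - ∑ y ∈ S, π y|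

/-- The `ε`-mixing time; it is `⊤` if from some state the distance does not stay below `ε`
eventually. -/
noncomputable def mixingTime (P : Matrix α α ℝ) (π : α → ℝ) (ε : ℝ) : ℕ∞ :=
  ⨆ x : α, ⨅ t ∈ {t : ℕ | ∀ t' ≥ t, tvDist P π x t' ≤ ε}, (t : ℕ∞)

end Chains

/-! ### The regression model and the posterior -/

/-- The Haar mother wavelet `1_{(0,1/2]} - 1_{(1/2,1]}`. -/
noncomputable def haarMother (x : ℝ) : ℝ :=
  Set.indicator (Set.Ioc 0 (1 / 2)) 1 x - Set.indicator (Set.Ioc (1 / 2) 1) 1 x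

/-- The Haar basis. -/
noncomputable def haar : Index → ℝ → ℝ
  | none, x => Set.indicator (Set.Icc 0 1) 1 x
  | some (l, k), x => (2 : ℝ) ^ ((l : ℝ) / 2) * haarMother (2 ^ l * x - k)

/-- The sample size `n = 2 ^ (Lmax + 1)`. -/
def sampleSize (Lmax : ℕ) : ℕ := 2 ^ (Lmax + 1)

/-- The design points `1/n, 2/n, …, 1`. -/
noncomputable def designPoint (n : ℕ) (i : Fin n) : ℝ := ((i : ℕ) + 1 : ℝ) / n

/-- The columns of the design matrix that are active in the tree `T`. -/
noncomputable def design (n : ℕ) (T : CartTree L) : Matrix (Fin n) T.int ℝ :=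
  fun i v => haar v.1 (designPoint n i)

/-- The regression function with coefficients `β` on the set `B`. -/
noncomputable def regFun (B : Finset Index) (β : Index → ℝ) (x : ℝ) : ℝ :=
  ∑ v ∈ B, haar v x * β v

/-- The vector of the values of the regression function at the design points. -/
noncomputable def signalVec (n : ℕ) (B : Finset Index) (β : Index → ℝ) : Fin n → ℝ :=
  fun i => regFun B β (designPoint n i)

/-- The law `N(0, Iₙ)` of the noise. -/
noncomputable def noiseLaw (n : ℕ) : Measure (Fin n → ℝ) := Measure.pi fun _ => gaussianReal 0 1

/-- The tree prior, up to normalization, for the split probability `n ^ (-c)`. -/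
noncomputable def treePrior (n : ℕ) (c : ℝ) (T : CartTree L) : ℝ :=
  (∏ _v ∈ T.int, (n : ℝ) ^ (-c)) * ∏ _v ∈ T.ext, (1 - (n : ℝ) ^ (-c))

/-- The marginal likelihood of the data `Y` given the tree: the density of `N(X_T b, Iₙ)` at `Y`,
integrated over the standard Gaussian prior of the coefficients `b` inside the tree. -/
noncomputable def marginalLikelihood (n : ℕ) (Y : Fin n → ℝ) (T : CartTree L) : ℝ :=
  ∫ b : T.int → ℝ, ∏ i, gaussianPDFReal ((design n T *ᵥ b) i) 1 (Y i)
    ∂(Measure.pi fun _ => gaussianReal 0 1)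

/-- The posterior probability of the tree `T`. -/
noncomputable def posterior (n : ℕ) (c : ℝ) (Y : Fin n → ℝ) (T : CartTree L) : ℝ :=
  treePrior n c T * marginalLikelihood n Y T /
    ∑ T' : CartTree L, treePrior n c T' * marginalLikelihood n Y T'

/-- The transition matrix of the sampler. -/
noncomputable def transition (s : Sampler) (n : ℕ) (c : ℝ) (Y : Fin n → ℝ) :
    Matrix (CartTree L) (CartTree L) ℝ :=
  metropolisHastings s.proposal (posterior n c Y)

/-- The signal assumption: `B` is a set of indices of level less than `L`, and the coefficients on
`B` lie between `A log n / √n` and `C` in absolute value. -/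
def SignalAssumption (n L : ℕ) (A C : ℝ) (B : Finset Index) (β : Index → ℝ) : Prop :=
  B ⊆ fullIndices L ∧ ∀ v ∈ B, A * Real.log n / √n < |β v| ∧ |β v| < C

/-! ### Drift functions and rates -/

/-- The first drift function; `F` is the vector of values of the true regression function. -/
noncomputable def drift₁ (n : ℕ) (C : ℝ) (F : Fin n → ℝ) (T : CartTree L) : ℝ :=
  Real.exp (1 / (2 ^ L * C ^ 2 * n) *
    (F ⬝ᵥ ((1 - (1 / (n : ℝ)) • (design n T * (design n T)ᵀ)) *ᵥ F)))

/-- The second drift function; `Ts` is the smallest tree that contains the signal. -/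
noncomputable def drift₂ (Ts T : CartTree L) : ℝ :=
  Real.exp (1 / 2 ^ L * (((T.int \ Ts.int).card : ℝ) +
    (min (Ts.int \ T.int).card 1 : ℕ) * (2 ^ L - ((T.int ∪ Ts.int).card : ℝ))))

/-- The mixing rate `log(6/ε) · max(C² / (δ₁ A²) · 2^{2L} n / log² n, 2^{2L+1})`. -/
noncomputable def twoDriftRate (s : Sampler) (n L : ℕ) (A C ε : ℝ) : ℝ :=
  Real.log (6 / ε) * max (C ^ 2 / (s.delta L * A ^ 2) * (2 ^ (2 * L) * n / Real.log n ^ 2))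
    (2 ^ (2 * L + 1))

/-- The upper bounds on the mixing times given by canonical paths; `m` is the number of internal
nodes of the smallest tree that contains the signal. -/
noncomputable def canonicalPathRate (s : Sampler) (n L m : ℕ) (c C ε : ℝ) : ℝ :=
  (match s with
    | .bayesianCART => 1
    | .twiggy D => (D ^ L - 1) / (D - 1)) *
  2 ^ (2 * L + 3) * (n * ((c + 1 / 2) * Real.log (1 + n) + m * C ^ 2 + 1)
    + 4 * m * Real.log n + Real.log (2 / ε))

end BCART

namespace BCART

variable {L : ℕ}

/-! ### Combinatorics of dyadic trees -/

/-! The Haar columns are exactly orthogonal on the design, so the marginal likelihood is a product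
over internal nodes (`marginalLikelihood_eq`). A tree has as many external as internal nodes,
counting (-1,0), so the prior is such a product too. Hence making a node v internal multiplies the
posterior weight by a number `nodeWeight` that does not depend on the rest of the tree
(`posterior_eq_mul_prod`).

All randomness is confined to one event of probability at least 1 - 4/n on which every noise
coefficient is small. There, nodes outside the signal have weight at most n^(-(c-3/2))/4, while a
set of at most L nodes that meets the signal has a product of weights of order n^((A²/8) log n),
because L ≤ 2 log n makes the cost of its other nodes negligible. These facts are collected in
`Concentrated`, and everything after that is deterministic.

Drift. If T misses a part of the signal, some GROW move picks up a signal node and is accepted with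
its full proposal probability; for Bayesian CART this needs connectedness, since only one node is
added at a time. Moves that lose signal have superpolynomially small probability. As V₁ is the
exponential of the normalized energy of the missing coefficients, this gives (i) in
`mulVec_missingEnergy_le`. If T strictly contains T*, a deepest superfluous node can be pruned on
its own, and growing is rarely accepted; this gives (ii) in `mulVec_drift₂_le`.

Mixing. Integrating the V₁ drift against the posterior shows that the trees containing T* carry at
least 3/4 of the mass, and the product form shows that T* carries at least half of that; so T* has
mass at least 1/4. A lazy reversible chain is at its starting state with probability at least half
the stationary one at every time. The two drift functions are glued to a single W that vanishes at
T*, lies in [1, 8] elsewhere and contracts off T*. Drift and returns together give a uniform lower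
bound for the probability of being in T* after a time of the order of the inverse drift rate
(`le_pow_apply_of_drift`). This is a Doeblin condition, and contraction of oscillations turns it
into the mixing bound (`mixingTime_lazyChain_le`).

Part (2) is a comparison of formulas: the bracket in the canonical-path bound is at least n log n.
-/

lemma mem_fullNodes {v : Node} : v ∈ fullNodes L ↔ v.1 < L ∧ v.2 < 2 ^ v.1 := by
  simp only [fullNodes, Finset.mem_filter, Finset.mem_product, Finset.mem_range]
  constructor
  · rintro ⟨⟨h₁, -⟩, h₂⟩
    exact ⟨h₁, h₂⟩
  · rintro ⟨h₁, h₂⟩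
    exact ⟨⟨h₁, h₂.trans (Nat.pow_lt_pow_right (by norm_num) h₁)⟩, h₂⟩

lemma card_fullNodes (L : ℕ) : (fullNodes L).card + 1 = 2 ^ L := by
  induction L with
  | zero => simp [fullNodes]
  | succ L ih =>
    have h : fullNodes (L + 1) =
        fullNodes L ∪ (Finset.range (2 ^ L)).image fun k => (L, k) := by
      ext ⟨l, k⟩
      simp only [mem_fullNodes, Finset.mem_union, Finset.mem_image, Finset.mem_range,
        Prod.mk.injEq]
      constructor
      · rintro ⟨h₁, h₂⟩
        rcases Nat.lt_succ_iff_lt_or_eq.1 h₁ with h | rfl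
        · exact Or.inl ⟨h, h₂⟩
        · exact Or.inr ⟨k, h₂, rfl, rfl⟩
      · rintro (⟨h₁, h₂⟩ | ⟨k', h₁, rfl, rfl⟩)
        · exact ⟨by omega, h₂⟩
        · exact ⟨by omega, h₁⟩
    have hdisj : Disjoint (fullNodes L) ((Finset.range (2 ^ L)).image fun k => (L, k)) := by
      rw [Finset.disjoint_left]
      intro v hv hv'
      obtain ⟨k, -, rfl⟩ := Finset.mem_image.1 hv'
      exact lt_irrefl _ (mem_fullNodes.1 hv).1
    rw [h, Finset.card_union_of_disjoint hdisj,
      Finset.card_image_of_injective _ fun _ _ h => (Prod.ext_iff.1 h).2, Finset.card_range,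
      pow_succ]
    omega

lemma CartTree.subset_full (T : CartTree L) : T.1 ⊆ fullNodes L :=
  Finset.mem_powerset.1 (Finset.mem_filter.1 T.2).1

lemma CartTree.closed (T : CartTree L) {v : Node} (hv : v ∈ T.1) {u : Node} (h : IsAnc u v) :
    u ∈ T.1 := by
  obtain ⟨h₁, h₂⟩ := h
  rcases h₁.lt_or_eq with h₁ | h₁
  · have := (Finset.mem_filter.1 T.2).2 v hv u.1 h₁
    rwa [← h₂] at this
  · rw [h₁, Nat.sub_self, pow_zero, Nat.div_one] at h₂
    rwa [show u = v from Prod.ext h₁ h₂]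

lemma mem_treeSets_of_closed {S : Finset Node} (hS : S ⊆ fullNodes L)
    (h : ∀ v ∈ S, ∀ u, IsAnc u v → u ∈ S) : S ∈ treeSets L :=
  Finset.mem_filter.2 ⟨Finset.mem_powerset.2 hS, fun v hv _ hj => h v hv _ ⟨hj.le, rfl⟩⟩

lemma CartTree.card_lt (T : CartTree L) : T.1.card + 1 ≤ 2 ^ L :=
  card_fullNodes L ▸ Nat.succ_le_succ (Finset.card_le_card T.subset_full)

lemma IsAnc.refl (v : Node) : IsAnc v v := by simp [IsAnc]

lemma IsAnc.trans {u v w : Node} (h : IsAnc u v) (h' : IsAnc v w) : IsAnc u w := by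
  obtain ⟨h₁, h₂⟩ := h
  obtain ⟨h₃, h₄⟩ := h'
  refine ⟨h₁.trans h₃, ?_⟩
  rw [h₂, h₄, Nat.div_div_eq_div_mul, ← pow_add]
  congr 2
  omega

lemma IsAnc.of_level_le {u v w : Node} (h : IsAnc u w) (h' : IsAnc v w) (hle : u.1 ≤ v.1) :
    IsAnc u v := by
  obtain ⟨h₁, h₂⟩ := h
  obtain ⟨h₃, h₄⟩ := h'
  refine ⟨hle, ?_⟩
  rw [h₂, h₄, Nat.div_div_eq_div_mul, ← pow_add]
  congr 2
  omega

lemma IsAnc.eq_of_level {u v : Node} (h : IsAnc u v) (hl : u.1 = v.1) : u = v := by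
  obtain ⟨h₁, h₂⟩ := h
  rw [hl, Nat.sub_self, pow_zero, Nat.div_one] at h₂
  exact Prod.ext hl h₂

lemma isAnc_parent (v : Node) : IsAnc (v.1 - 1, v.2 / 2) v ∨ v.1 = 0 := by
  rcases Nat.eq_zero_or_pos v.1 with h | h
  · exact Or.inr h
  · left
    refine ⟨Nat.sub_le _ _, ?_⟩
    have : v.1 - (v.1 - 1) = 1 := by omega
    simp [this]

lemma IsAnc.parent {u v : Node} (h : IsAnc u v) (hne : u ≠ v) : IsAnc u (v.1 - 1, v.2 / 2) := by
  have hl : u.1 < v.1 := lt_of_le_of_ne h.1 fun hl => hne (h.eq_of_level hl)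
  rcases isAnc_parent v with h' | h'
  · exact h.of_level_le h' (by simp only; omega)
  · omega

lemma IsAnc.mem_fullNodes {u v : Node} (h : IsAnc u v) (hv : v ∈ fullNodes L) :
    u ∈ fullNodes L := by
  obtain ⟨h₁, h₂⟩ := h
  obtain ⟨h₃, h₄⟩ := BCART.mem_fullNodes.1 hv
  refine BCART.mem_fullNodes.2 ⟨h₁.trans_lt h₃, ?_⟩
  rw [h₂, Nat.div_lt_iff_lt_mul (by positivity), ← pow_add]
  rwa [Nat.add_sub_cancel' h₁]

lemma mem_twig {u v w : Node} : w ∈ twig u v ↔ IsAnc w v ∧ u.1 ≤ w.1 := by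
  simp only [twig, Finset.mem_image, Finset.mem_Icc, IsAnc]
  constructor
  · rintro ⟨j, ⟨h₁, h₂⟩, rfl⟩
    exact ⟨⟨h₂, rfl⟩, h₁⟩
  · rintro ⟨⟨h₁, h₂⟩, h₃⟩
    exact ⟨w.1, ⟨h₃, h₁⟩, Prod.ext rfl h₂.symm⟩

lemma mem_twig_of_isAnc {u v w : Node} (h : IsAnc u v) :
    w ∈ twig u v ↔ IsAnc u w ∧ IsAnc w v := by
  rw [mem_twig]
  exact ⟨fun h' => ⟨h.of_level_le h'.1 h'.2, h'.1⟩, fun h' => ⟨h'.2, h'.1.1⟩⟩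

lemma twig_self (v : Node) : twig v v = {v} := by
  ext w
  rw [mem_twig, Finset.mem_singleton]
  constructor
  · rintro ⟨h₁, h₂⟩
    exact h₁.eq_of_level (le_antisymm h₁.1 h₂)
  · rintro rfl
    exact ⟨IsAnc.refl _, le_rfl⟩

lemma card_twig_le {u v : Node} (hv : v ∈ fullNodes L) : (twig u v).card ≤ L := by
  refine Finset.card_image_le.trans ?_
  have := (mem_fullNodes.1 hv).1
  rw [Nat.card_Icc]
  omega

lemma CartTree.mem_ext {T : CartTree L} {v : Node} :
    v ∈ T.ext ↔ v ∈ fullNodes (L + 1) ∧ v ∉ T.1 ∧ (v.1 = 0 ∨ (v.1 - 1, v.2 / 2) ∈ T.1) := by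
  simp [CartTree.ext]

/-- The left and the right child of a node. -/
def childNode (p : Node × Bool) : Node := (p.1.1 + 1, 2 * p.1.2 + p.2.toNat)

lemma childNode_injective : Function.Injective childNode := by
  rintro ⟨⟨a, b⟩, x⟩ ⟨⟨a', b'⟩, x'⟩ h
  simp only [childNode, Prod.mk.injEq] at h ⊢
  have h₁ := Bool.toNat_lt x
  have h₂ := Bool.toNat_lt x'
  refine ⟨⟨by omega, by omega⟩, ?_⟩
  have : x.toNat = x'.toNat := by omega
  revert this
  cases x <;> cases x' <;> simp

/-- A binary tree has one external node more than internal nodes. -/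
lemma CartTree.card_ext (T : CartTree L) : T.ext.card = T.1.card + 1 := by
  have hchild : ∀ p, (childNode p).1 = p.1.1 + 1 ∧ (childNode p).2 / 2 = p.1.2 := by
    rintro ⟨⟨a, b⟩, x⟩
    have h₁ := Bool.toNat_lt x
    simp only [childNode]
    exact ⟨trivial, by omega⟩
  have hroot : (0, 0) ∉ (T.1 ×ˢ Finset.univ).image childNode := by
    simp only [Finset.mem_image, not_exists, not_and]
    intro p _ h
    have := (hchild p).1
    rw [h] at this
    simp at this
  have hdisj : Disjoint T.1 T.ext := by
    rw [Finset.disjoint_left]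
    exact fun v hv hv' => (mem_ext.1 hv').2.1 hv
  -- Apart from the root, the nodes of `T.1 ∪ T.ext` are exactly the children of internal nodes, so
  -- the cardinalities satisfy |T| + |ext| = 1 + 2|T|.
  have h : T.1 ∪ T.ext = insert (0, 0) ((T.1 ×ˢ Finset.univ).image childNode) := by
    ext v
    simp only [Finset.mem_union, Finset.mem_insert, Finset.mem_image, Finset.mem_product,
      Finset.mem_univ, and_true]
    constructor
    · intro hv
      have hfull : v ∈ fullNodes (L + 1) := by
        rcases hv with hv | hv
        · have := mem_fullNodes.1 (T.subset_full hv)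
          exact mem_fullNodes.2 ⟨by omega, this.2⟩
        · exact (mem_ext.1 hv).1
      rcases Nat.eq_zero_or_pos v.1 with h0 | h0
      · left
        have := (mem_fullNodes.1 hfull).2
        rw [h0] at this
        exact Prod.ext h0 (by simpa using this)
      · right
        have hpar : (v.1 - 1, v.2 / 2) ∈ T.1 := by
          rcases hv with hv | hv
          · rcases isAnc_parent v with h | h
            · exact T.closed hv h
            · omega
          · rcases (mem_ext.1 hv).2.2 with h | h
            · omega
            · exact h
        refine ⟨((v.1 - 1, v.2 / 2), decide (v.2 % 2 = 1)), hpar, ?_⟩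
        have : (decide (v.2 % 2 = 1)).toNat = v.2 % 2 := by
          rcases Nat.mod_two_eq_zero_or_one v.2 with h | h <;> simp [h]
        simp only [childNode, this]
        exact Prod.ext (by simp only; omega) (by simp only; omega)
    · rintro (rfl | ⟨p, hp, rfl⟩)
      · by_cases h : ((0, 0) : Node) ∈ T.1
        · exact Or.inl h
        · exact Or.inr (mem_ext.2 ⟨mem_fullNodes.2 ⟨by simp, by simp⟩, h, Or.inl rfl⟩)
      · by_cases h : childNode p ∈ T.1
        · exact Or.inl h
        · refine Or.inr (mem_ext.2 ⟨mem_fullNodes.2 ?_, h, Or.inr ?_⟩)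
          · have h₁ := mem_fullNodes.1 (T.subset_full hp)
            have h₂ := hchild p
            rw [h₂.1, pow_succ]
            exact ⟨by omega, by omega⟩
          · have h₂ := hchild p
            rw [h₂.1, h₂.2]
            exact hp
  have hc := congrArg Finset.card h
  rw [Finset.card_union_of_disjoint hdisj, Finset.card_insert_of_notMem hroot,
    Finset.card_image_of_injective _ childNode_injective, Finset.card_product] at hc
  simp only [Finset.card_univ, Fintype.card_bool] at hc
  omega

lemma CartTree.card_ext_le (T : CartTree L) : T.ext.card ≤ 2 ^ L := T.card_ext ▸ T.card_lt

/-- `T'` arises from `T` by attaching the twig from the external node `e` to `v`. -/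
structure IsGrowth (T T' : CartTree L) (e v : Node) : Prop where
  ext : e ∈ T.ext
  full : v ∈ fullNodes L
  anc : IsAnc e v
  eq : T'.1 = T.1 ∪ twig e v

namespace IsGrowth

variable {T T' : CartTree L} {e v : Node}

lemma not_mem (h : IsGrowth T T' e v) {w : Node} (hw : IsAnc e w) : w ∉ T.1 :=
  fun hw' => (CartTree.mem_ext.1 h.ext).2.1 (T.closed hw' hw)

lemma disjoint (h : IsGrowth T T' e v) : Disjoint T.1 (twig e v) := by
  rw [Finset.disjoint_right]
  exact fun w hw => h.not_mem ((mem_twig_of_isAnc h.anc).1 hw).1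

lemma le (h : IsGrowth T T' e v) : T ≤ T' := by
  change T.1 ⊆ T'.1
  rw [h.eq]
  exact Finset.subset_union_left

lemma sdiff_eq (h : IsGrowth T T' e v) : T'.1 \ T.1 = twig e v := by
  rw [h.eq, Finset.union_sdiff_left, Finset.sdiff_eq_self_of_disjoint h.disjoint.symm]

lemma card_sdiff_le (h : IsGrowth T T' e v) : (T'.1 \ T.1).card ≤ L :=
  h.sdiff_eq ▸ card_twig_le h.full

lemma mem_top (h : IsGrowth T T' e v) : v ∈ T'.1 := by
  rw [h.eq]
  exact Finset.mem_union_right _ (mem_twig.2 ⟨IsAnc.refl _, h.anc.1⟩)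

lemma mem_bot (h : IsGrowth T T' e v) : e ∈ T'.1 := T'.closed h.mem_top h.anc

lemma lt (h : IsGrowth T T' e v) : T < T' :=
  lt_of_le_of_ne h.le fun heq => h.not_mem h.anc (heq ▸ h.mem_top)

lemma desc_eq (h : IsGrowth T T' e v) : T'.desc e = twig e v := by
  ext w
  rw [CartTree.desc, Finset.mem_filter, h.eq, Finset.mem_union]
  constructor
  · rintro ⟨hw | hw, ha⟩
    · exact absurd hw (h.not_mem ha)
    · exact hw
  · exact fun hw => ⟨Or.inr hw, ((mem_twig_of_isAnc h.anc).1 hw).1⟩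

lemma eq_sdiff_desc (h : IsGrowth T T' e v) : T.1 = T'.1 \ T'.desc e := by
  rw [h.desc_eq, h.eq, Finset.union_sdiff_right, Finset.sdiff_eq_self_of_disjoint h.disjoint]

/-- The path above `e` is already in `T`. So the grown tree depends on `v` alone, which is what
allows the upward steps to be counted. -/
lemma eq_union_path (h : IsGrowth T T' e v) : T'.1 = T.1 ∪ twig (0, 0) v := by
  rw [h.eq]
  ext w
  simp only [Finset.mem_union]
  constructor
  · rintro (hw | hw)
    · exact Or.inl hw
    · exact Or.inr (mem_twig.2 ⟨(mem_twig.1 hw).1, Nat.zero_le _⟩)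
  · rintro (hw | hw)
    · exact Or.inl hw
    · by_cases hl : e.1 ≤ w.1
      · exact Or.inr (mem_twig.2 ⟨(mem_twig.1 hw).1, hl⟩)
      · left
        have hwe : IsAnc w e := (mem_twig.1 hw).1.of_level_le h.anc (by omega)
        rcases (CartTree.mem_ext.1 h.ext).2.2 with h0 | hp
        · omega
        · exact T.closed hp (hwe.parent (by rintro rfl; exact hl le_rfl))

end IsGrowth

/-- The tree that arises by attaching a twig to an external node. -/
lemma exists_isGrowth (T : CartTree L) {e v : Node} (he : e ∈ T.ext) (hv : v ∈ fullNodes L)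
    (h : IsAnc e v) : ∃ T' : CartTree L, IsGrowth T T' e v := by
  refine ⟨⟨T.1 ∪ twig e v, mem_treeSets_of_closed ?_ ?_⟩, he, hv, h, rfl⟩
  · exact Finset.union_subset T.subset_full fun w hw => (mem_twig.1 hw).1.mem_fullNodes hv
  · intro w hw u hu
    rw [Finset.mem_union] at hw ⊢
    rcases hw with hw | hw
    · exact Or.inl (T.closed hw hu)
    · by_cases hl : e.1 ≤ u.1
      · exact Or.inr (mem_twig.2 ⟨hu.trans (mem_twig.1 hw).1, hl⟩)
      · left
        have hue : IsAnc u e := (hu.trans (mem_twig.1 hw).1).of_level_le h (by omega)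
        rcases (CartTree.mem_ext.1 he).2.2 with h0 | hp
        · omega
        · exact T.closed hp (hue.parent (by rintro rfl; exact hl le_rfl))

lemma CartTree.exists_ext (T : CartTree L) {v : Node} (hv : v ∈ fullNodes L) (hT : v ∉ T.1) :
    ∃ e ∈ T.ext, IsAnc e v := by
  -- The external node above `v` is the topmost node outside `T` on the path from the root to `v`.
  have hex : ∃ j, j ≤ v.1 ∧ (j, v.2 / 2 ^ (v.1 - j)) ∉ T.1 := ⟨v.1, le_rfl, by simpa using hT⟩
  classical
  obtain ⟨h₁, h₂⟩ := Nat.find_spec hex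
  set j := Nat.find hex with hj
  have ha : IsAnc (j, v.2 / 2 ^ (v.1 - j)) v := ⟨h₁, rfl⟩
  refine ⟨_, mem_ext.2 ⟨?_, h₂, ?_⟩, ha⟩
  · have := mem_fullNodes.1 (ha.mem_fullNodes hv)
    exact mem_fullNodes.2 ⟨by omega, this.2⟩
  · rcases Nat.eq_zero_or_pos j with h0 | h0
    · exact Or.inl h0
    · right
      have := Nat.find_min hex (m := j - 1) (by omega)
      push Not at this
      have h3 := this (by omega)
      convert h3 using 2
      simp only
      rw [Nat.div_div_eq_div_mul, ← pow_succ]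
      congr 2
      omega

lemma CartTree.ext_unique (T : CartTree L) {e e' v : Node} (he : e ∈ T.ext) (he' : e' ∈ T.ext)
    (h : IsAnc e v) (h' : IsAnc e' v) : e = e' := by
  wlog hle : e.1 ≤ e'.1 generalizing e e'
  · exact (this he' he h' h (by omega)).symm
  by_contra hne
  have ha : IsAnc e e' := h.of_level_le h' hle
  rcases (mem_ext.1 he').2.2 with h0 | hp
  · exact hne (ha.eq_of_level (by omega))
  · exact (mem_ext.1 he).2.1 (T.closed hp (ha.parent hne))

/-- The steps of the samplers: attaching a twig, of length one for Bayesian CART. -/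
def Sampler.Step (s : Sampler) (T T' : CartTree L) : Prop :=
  ∃ e v, IsGrowth T T' e v ∧ (s = .bayesianCART → e = v)

/-- An upward step is determined by the lower end of the attached twig, a downward step (next lemma)
by the top of the removed one. Both counts are therefore at most the number of nodes, although there
are far more trees. -/
lemma card_step_up_le (s : Sampler) (T : CartTree L) [DecidablePred (s.Step T)] :
    (Finset.univ.filter (s.Step T)).card ≤ 2 ^ L := by
  have h : ((Finset.univ.filter (s.Step T)).map ⟨Subtype.val, Subtype.val_injective⟩) ⊆
      (fullNodes L).image fun v => T.1 ∪ twig (0, 0) v := by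
    intro S hS
    simp only [Finset.mem_map, Finset.mem_filter, Finset.mem_univ, true_and,
      Function.Embedding.coeFn_mk] at hS
    obtain ⟨T', ⟨e, v, h, -⟩, rfl⟩ := hS
    exact Finset.mem_image.2 ⟨v, h.full, h.eq_union_path.symm⟩
  have := (Finset.card_le_card h).trans Finset.card_image_le
  rw [Finset.card_map] at this
  have := card_fullNodes L
  omega

lemma card_step_down_le (s : Sampler) (T : CartTree L) [DecidablePred fun T' => s.Step T' T] :
    (Finset.univ.filter fun T' => s.Step T' T).card ≤ 2 ^ L := by
  have h : ((Finset.univ.filter fun T' => s.Step T' T).map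
      ⟨Subtype.val, Subtype.val_injective⟩) ⊆ T.1.image fun e => T.1 \ T.desc e := by
    intro S hS
    simp only [Finset.mem_map, Finset.mem_filter, Finset.mem_univ, true_and,
      Function.Embedding.coeFn_mk] at hS
    obtain ⟨T', ⟨e, v, h, -⟩, rfl⟩ := hS
    exact Finset.mem_image.2 ⟨e, h.mem_bot, h.eq_sdiff_desc.symm⟩
  have := (Finset.card_le_card h).trans Finset.card_image_le
  rw [Finset.card_map] at this
  have := T.card_lt
  omega

/-- Above a tree `Ts` there is always a node outside `Ts` that can be pruned on its own. -/
lemma exists_isGrowth_of_lt {Ts T : CartTree L} (h : Ts < T) :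
    ∃ (T' : CartTree L) (v : Node), Ts ≤ T' ∧ v ∉ Ts.1 ∧ IsGrowth T' T v v := by
  have hne : (T.1 \ Ts.1).Nonempty := by
    rw [Finset.sdiff_nonempty]
    exact fun hsub => h.not_ge hsub
  -- A superfluous node of maximal level has no proper descendant in `T`: by closedness of `Ts` such
  -- a descendant would be superfluous as well, and deeper.
  obtain ⟨v, hv, hmax⟩ := Finset.exists_max_image _ (fun v : Node => v.1) hne
  rw [Finset.mem_sdiff] at hv
  have hmax' : ∀ w ∈ T.1, IsAnc v w → w = v := by
    intro w hw ha
    have hw' : w ∉ Ts.1 := fun hw' => hv.2 (Ts.closed hw' ha)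
    exact (ha.eq_of_level (le_antisymm ha.1 (hmax w (Finset.mem_sdiff.2 ⟨hw, hw'⟩)))).symm
  let T' : CartTree L := ⟨T.1.erase v, mem_treeSets_of_closed
    ((Finset.erase_subset _ _).trans T.subset_full) (by
      intro w hw u hu
      rw [Finset.mem_erase] at hw ⊢
      refine ⟨?_, T.closed hw.2 hu⟩
      rintro rfl
      exact hw.1 (hmax' w hw.2 hu))⟩
  have hfull := T.subset_full hv.1
  refine ⟨T', v, fun w hw => ?_, hv.2, ?_, hfull, IsAnc.refl _, ?_⟩
  · exact Finset.mem_erase.2 ⟨by rintro rfl; exact hv.2 hw, h.le hw⟩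
  · refine CartTree.mem_ext.2 ⟨?_, Finset.notMem_erase _ _, ?_⟩
    · have := mem_fullNodes.1 hfull
      exact mem_fullNodes.2 ⟨by omega, this.2⟩
    · rcases isAnc_parent v with hp | hp
      · rcases Nat.eq_zero_or_pos v.1 with h0 | h0
        · exact Or.inl h0
        · refine Or.inr (Finset.mem_erase.2 ⟨fun heq => ?_, T.closed hv.1 hp⟩)
          have := congrArg Prod.fst heq
          simp only at this
          omega
      · exact Or.inl hp
  · rw [twig_self, Finset.union_comm, ← Finset.insert_eq, Finset.insert_erase hv.1]

/-! ### The proposal distributions -/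

lemma growProb_nonneg (T : CartTree L) : 0 ≤ growProb T := by
  unfold growProb
  split_ifs <;> norm_num

lemma growProb_le_one (T : CartTree L) : growProb T ≤ 1 := by
  unfold growProb
  split_ifs <;> norm_num

lemma half_le_growProb {T T' : CartTree L} (h : T < T') : 1 / 2 ≤ growProb T := by
  have : T.1 ≠ fullNodes L := fun heq => h.not_ge (by
    change T'.1 ⊆ T.1
    exact heq ▸ T'.subset_full)
  unfold growProb
  rw [if_neg this]
  split_ifs <;> norm_num

lemma growProb_le_half {T T' : CartTree L} (h : T < T') : growProb T' ≤ 1 / 2 := by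
  have : T'.1 ≠ ∅ := fun heq => h.not_ge (by
    change T'.1 ⊆ T.1
    exact heq ▸ Finset.empty_subset _)
  unfold growProb
  rw [if_neg this]
  split_ifs <;> norm_num

lemma sum_card_inv_le_one {ι : Type*} (s : Finset ι) : ∑ _i ∈ s, 1 / (s.card : ℝ) ≤ 1 := by
  rw [Finset.sum_const, nsmul_eq_mul, mul_one_div]
  exact div_self_le_one _

/-- If each proposed move determines its result, the proposal has total mass at most that of the
moves. -/
lemma sum_proposals_le {α ι : Type*} [Fintype α] (s : Finset ι) (p : ι → α → Prop)
    [∀ i, DecidablePred (p i)] (w : ι → ℝ) (hw : ∀ i ∈ s, 0 ≤ w i)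
    (hp : ∀ i ∈ s, ∀ x y, p i x → p i y → x = y) :
    ∑ x, ∑ i ∈ s, (if p i x then w i else 0) ≤ ∑ i ∈ s, w i := by
  rw [Finset.sum_comm]
  refine Finset.sum_le_sum fun i hi => ?_
  by_cases h : ∃ x, p i x
  · obtain ⟨x, hx⟩ := h
    rw [Finset.sum_eq_single x]
    · rw [if_pos hx]
    · exact fun y _ hy => if_neg fun hy' => hy (hp i hi _ _ hy' hx)
    · simp
  · push Not at h
    simp [h, hw i hi]

lemma cartGrow_nonneg (T T' : CartTree L) : 0 ≤ cartGrow T T' :=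
  Finset.sum_nonneg fun v _ => by split_ifs <;> positivity

lemma cartPrune_nonneg (T T' : CartTree L) : 0 ≤ cartPrune T T' :=
  Finset.sum_nonneg fun v _ => by split_ifs <;> positivity

lemma twiggyPrune_nonneg (T T' : CartTree L) : 0 ≤ twiggyPrune T T' :=
  Finset.sum_nonneg fun v _ => by split_ifs <;> positivity

lemma twiggyGrow_nonneg {D : ℝ} (hD : 1 < D) (T T' : CartTree L) : 0 ≤ twiggyGrow D T T' := by
  have : 0 < D := by linarith
  exact Finset.sum_nonneg fun l _ => Finset.sum_nonneg fun k _ => by split_ifs <;> positivity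

lemma sum_cartGrow_le (T : CartTree L) : ∑ T', cartGrow T T' ≤ 1 :=
  (sum_proposals_le T.ext (fun v (T' : CartTree L) => T'.1 = insert v T.1) _
    (fun _ _ => by positivity) fun _ _ _ _ h h' => Subtype.ext (h.trans h'.symm)).trans
    (sum_card_inv_le_one _)

lemma sum_cartPrune_le (T : CartTree L) : ∑ T', cartPrune T T' ≤ 1 :=
  (sum_proposals_le T.preterminal (fun v (T' : CartTree L) => T'.1 = T.1.erase v) _
    (fun _ _ => by positivity) fun _ _ _ _ h h' => Subtype.ext (h.trans h'.symm)).trans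
    (sum_card_inv_le_one _)

lemma sum_twiggyPrune_le (T : CartTree L) : ∑ T', twiggyPrune T T' ≤ 1 :=
  (sum_proposals_le T.twigTops (fun v (T' : CartTree L) => T'.1 = T.1 \ T.desc v) _
    (fun _ _ => by positivity) fun _ _ _ _ h h' => Subtype.ext (h.trans h'.symm)).trans
    (sum_card_inv_le_one _)

lemma sum_twiggyGrow_le {D : ℝ} (hD : 1 < D) (T : CartTree L) :
    ∑ T', twiggyGrow D T T' ≤ 1 := by
  have hD0 : 0 < D := by linarith
  unfold twiggyGrow
  rw [Finset.sum_comm]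
  calc _ ≤ ∑ l ∈ T.eligible, (D ^ l)⁻¹ / ∑ l' ∈ T.eligible, (D ^ l')⁻¹ := by
        refine Finset.sum_le_sum fun l _ => ?_
        refine (sum_proposals_le (T.free l) (fun k (T' : CartTree L) =>
          ∃ e ∈ T.ext, IsAnc e (l, k) ∧ T'.1 = T.1 ∪ twig e (l, k)) _
          (fun _ _ => by positivity) ?_).trans ?_
        · rintro k - T₁ T₂ ⟨e, he, ha, h⟩ ⟨e', he', ha', h'⟩
          obtain rfl := T.ext_unique he he' ha ha'
          exact Subtype.ext (h.trans h'.symm)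
        · rw [Finset.sum_const, nsmul_eq_mul, mul_div_left_comm]
          exact mul_le_of_le_one_right (by positivity) (div_self_le_one _)
    _ ≤ 1 := by
        rw [← Finset.sum_div]
        exact div_self_le_one _

lemma Sampler.proposal_nonneg {s : Sampler} (hs : s.Valid) (T T' : CartTree L) :
    0 ≤ s.proposal T T' := by
  have h₁ := growProb_nonneg T
  have h₂ := sub_nonneg.2 (growProb_le_one T)
  cases s with
  | bayesianCART =>
    exact add_nonneg (mul_nonneg h₁ (cartGrow_nonneg _ _)) (mul_nonneg h₂ (cartPrune_nonneg _ _))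
  | twiggy D =>
    exact add_nonneg (mul_nonneg h₁ (twiggyGrow_nonneg hs.1 _ _))
      (mul_nonneg h₂ (twiggyPrune_nonneg _ _))

lemma sum_mixture_le {α : Type*} [Fintype α] {g p : α → ℝ} {w : ℝ} (h₀ : 0 ≤ w) (h₁ : w ≤ 1)
    (hg : ∑ x, g x ≤ 1) (hp : ∑ x, p x ≤ 1) : ∑ x, (w * g x + (1 - w) * p x) ≤ 1 := by
  rw [Finset.sum_add_distrib, ← Finset.mul_sum, ← Finset.mul_sum]
  nlinarith

lemma Sampler.sum_proposal_le {s : Sampler} (hs : s.Valid) (T : CartTree L) :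
    ∑ T', s.proposal T T' ≤ 1 := by
  cases s with
  | bayesianCART =>
    exact sum_mixture_le (growProb_nonneg T) (growProb_le_one T) (sum_cartGrow_le T)
      (sum_cartPrune_le T)
  | twiggy D =>
    exact sum_mixture_le (growProb_nonneg T) (growProb_le_one T) (sum_twiggyGrow_le hs.1 T)
      (sum_twiggyPrune_le T)

lemma Sampler.proposal_le_one {s : Sampler} (hs : s.Valid) (T T' : CartTree L) :
    s.proposal T T' ≤ 1 :=
  (Finset.single_le_sum (fun T' _ => s.proposal_nonneg hs T T') (Finset.mem_univ T')).trans
    (s.sum_proposal_le hs T)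

lemma CartTree.mem_ext_of_sdiff {T T' : CartTree L} {v : Node} (hv : v ∈ T.1)
    (hT' : T'.1 = T.1 \ T.desc v) : v ∈ T'.ext := by
  have hfull := mem_fullNodes.1 (T.subset_full hv)
  refine mem_ext.2 ⟨mem_fullNodes.2 ⟨by omega, hfull.2⟩, ?_, ?_⟩
  · rw [hT', Finset.mem_sdiff, not_and, not_not]
    exact fun _ => Finset.mem_filter.2 ⟨hv, IsAnc.refl v⟩
  · rcases Nat.eq_zero_or_pos v.1 with h0 | h0
    · exact Or.inl h0
    · right
      rcases isAnc_parent v with hp | hp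
      · rw [hT', Finset.mem_sdiff]
        refine ⟨T.closed hv hp, fun hd => ?_⟩
        have := (Finset.mem_filter.1 hd).2.1
        simp only at this
        omega
      · omega

/-- A proper internal descendant would force the child of `v` above it to be internal, but both
children are external. So pruning of Bayesian CART is the removal of a twig of length one. -/
lemma CartTree.desc_of_preterminal {T : CartTree L} {v : Node} (hv : v ∈ T.preterminal) :
    T.desc v = {v} := by
  obtain ⟨hv, hl, hr⟩ := Finset.mem_filter.1 hv
  ext w
  rw [desc, Finset.mem_filter, Finset.mem_singleton]
  constructor
  · rintro ⟨hw, ha⟩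
    by_contra hne
    have hlt : v.1 < w.1 := lt_of_le_of_ne ha.1 fun h => hne (ha.eq_of_level h).symm
    set u : Node := (v.1 + 1, w.2 / 2 ^ (w.1 - (v.1 + 1))) with hu
    have hua : IsAnc u w := ⟨hlt, rfl⟩
    have hvu : IsAnc v u := ha.of_level_le hua (Nat.le_succ _)
    have h2 : v.2 = u.2 / 2 := by
      have := hvu.2
      simpa [hu] using this
    have huT := T.closed hw hua
    have hcase : u = (v.1 + 1, 2 * v.2) ∨ u = (v.1 + 1, 2 * v.2 + 1) := by
      rcases Nat.mod_two_eq_zero_or_one u.2 with h | h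
      · exact Or.inl (Prod.ext rfl (by simp only; omega))
      · exact Or.inr (Prod.ext rfl (by simp only; omega))
    rcases hcase with h | h
    · exact (mem_ext.1 hl).2.1 (h ▸ huT)
    · exact (mem_ext.1 hr).2.1 (h ▸ huT)
  · rintro rfl
    exact ⟨hv, IsAnc.refl _⟩

lemma isGrowth_of_sdiff_desc {T T' : CartTree L} {v w : Node} (hv : v ∈ T.1) (hw : w ∈ T.1)
    (ha : IsAnc v w) (hd : T.desc v = twig v w) (hT' : T'.1 = T.1 \ T.desc v) :
    IsGrowth T' T v w := by
  refine ⟨CartTree.mem_ext_of_sdiff hv hT', T.subset_full hw, ha, ?_⟩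
  rw [hT', ← hd, Finset.sdiff_union_of_subset (show T.desc v ⊆ T.1 from Finset.filter_subset _ _)]

lemma step_of_cartGrow {T T' : CartTree L} (h : cartGrow T T' ≠ 0) :
    Sampler.bayesianCART.Step T T' := by
  obtain ⟨v, hv, hne⟩ := Finset.exists_ne_zero_of_sum_ne_zero h
  have h' : T'.1 = insert v T.1 := by
    by_contra hc
    exact hne (if_neg hc)
  refine ⟨v, v, ⟨hv, T'.subset_full (h' ▸ Finset.mem_insert_self _ _), IsAnc.refl v, ?_⟩,
    fun _ => rfl⟩
  rw [twig_self, h', Finset.insert_eq, Finset.union_comm]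

lemma step_of_cartPrune {T T' : CartTree L} (h : cartPrune T T' ≠ 0) :
    Sampler.bayesianCART.Step T' T := by
  obtain ⟨v, hv, hne⟩ := Finset.exists_ne_zero_of_sum_ne_zero h
  have h' : T'.1 = T.1.erase v := by
    by_contra hc
    exact hne (if_neg hc)
  have hd := CartTree.desc_of_preterminal hv
  have hvT := (Finset.mem_filter.1 hv).1
  refine ⟨v, v, isGrowth_of_sdiff_desc hvT hvT (IsAnc.refl v) (hd.trans (twig_self v).symm) ?_,
    fun _ => rfl⟩
  rw [h', hd, Finset.sdiff_singleton_eq_erase]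

lemma step_of_twiggyGrow {D : ℝ} {T T' : CartTree L} (h : twiggyGrow D T T' ≠ 0) :
    (Sampler.twiggy D).Step T T' := by
  obtain ⟨l, hl, hne⟩ := Finset.exists_ne_zero_of_sum_ne_zero h
  obtain ⟨k, hk, hne⟩ := Finset.exists_ne_zero_of_sum_ne_zero hne
  obtain ⟨e, he, ha, h'⟩ : ∃ e ∈ T.ext, IsAnc e (l, k) ∧ T'.1 = T.1 ∪ twig e (l, k) := by
    by_contra hc
    exact hne (if_neg hc)
  refine ⟨e, (l, k), ⟨he, mem_fullNodes.2 ⟨?_, ?_⟩, ha, h'⟩, fun h => by simp at h⟩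
  · exact Finset.mem_range.1 (Finset.mem_filter.1 hl).1
  · exact Finset.mem_range.1 (Finset.mem_filter.1 hk).1

lemma step_of_twiggyPrune {D : ℝ} {T T' : CartTree L} (h : twiggyPrune T T' ≠ 0) :
    (Sampler.twiggy D).Step T' T := by
  obtain ⟨v, hv, hne⟩ := Finset.exists_ne_zero_of_sum_ne_zero h
  have h' : T'.1 = T.1 \ T.desc v := by
    by_contra hc
    exact hne (if_neg hc)
  obtain ⟨hvT, w, hw, ha, hd⟩ := Finset.mem_filter.1 hv
  exact ⟨v, w, isGrowth_of_sdiff_desc hvT hw ha hd h', fun h => by simp at h⟩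

lemma Sampler.step_of_proposal_ne_zero {s : Sampler} {T T' : CartTree L}
    (h : s.proposal T T' ≠ 0) : s.Step T T' ∨ s.Step T' T := by
  cases s with
  | bayesianCART =>
    by_cases h' : cartGrow T T' = 0
    · exact Or.inr (step_of_cartPrune fun h'' => h (by simp [proposal, h', h'']))
    · exact Or.inl (step_of_cartGrow h')
  | twiggy D =>
    by_cases h' : twiggyGrow D T T' = 0
    · exact Or.inr (step_of_twiggyPrune fun h'' => h (by simp [proposal, h', h'']))
    · exact Or.inl (step_of_twiggyGrow h')

lemma inv_le_cartGrow {T T' : CartTree L} {v : Node} (h : IsGrowth T T' v v) :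
    1 / 2 ^ L ≤ cartGrow T T' := by
  have hpos : 0 < T.ext.card := Finset.card_pos.2 ⟨v, h.ext⟩
  have hcard : (T.ext.card : ℝ) ≤ 2 ^ L := by exact_mod_cast T.card_ext_le
  have hterm := Finset.single_le_sum
    (f := fun v => if T'.1 = insert v T.1 then 1 / (T.ext.card : ℝ) else 0)
    (fun v _ => by split_ifs <;> positivity) h.ext
  rw [if_pos (by rw [h.eq, twig_self, Finset.union_comm, Finset.insert_eq])] at hterm
  exact (one_div_le_one_div_of_le (by exact_mod_cast hpos) hcard).trans hterm

lemma IsGrowth.preterminal {T T' : CartTree L} {v : Node} (h : IsGrowth T T' v v) :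
    v ∈ T'.preterminal := by
  have hfull := mem_fullNodes.1 h.full
  have key : ∀ k, k / 2 = v.2 → (v.1 + 1, k) ∈ T'.ext := by
    intro k hk
    refine CartTree.mem_ext.2 ⟨mem_fullNodes.2 ⟨by simp only; omega, ?_⟩, fun hc => ?_, Or.inr ?_⟩
    · simp only [pow_succ]
      omega
    · have ha : IsAnc v (v.1 + 1, k) := ⟨Nat.le_succ _, by simp [hk]⟩
      rw [h.eq, twig_self, Finset.mem_union, Finset.mem_singleton] at hc
      rcases hc with hc | hc
      · exact h.not_mem ha hc
      · have := congrArg Prod.fst hc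
        simp at this
    · simp only [Nat.add_sub_cancel, hk]
      exact h.mem_top
  exact Finset.mem_filter.2 ⟨h.mem_top, key _ (by omega), key _ (by omega)⟩

lemma card_real_le {T : CartTree L} {S : Finset Node} (h : S ⊆ T.1) : (S.card : ℝ) ≤ 2 ^ L := by
  have h₁ := Finset.card_le_card h
  have h₂ := T.card_lt
  exact_mod_cast (by omega : S.card ≤ 2 ^ L)

lemma inv_le_cartPrune {T T' : CartTree L} {v : Node} (h : IsGrowth T T' v v) :
    1 / 2 ^ L ≤ cartPrune T' T := by
  have hpos : 0 < T'.preterminal.card := Finset.card_pos.2 ⟨v, h.preterminal⟩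
  have hcard : (T'.preterminal.card : ℝ) ≤ 2 ^ L := card_real_le (Finset.filter_subset _ _)
  have hterm := Finset.single_le_sum
    (f := fun v => if T.1 = T'.1.erase v then 1 / (T'.preterminal.card : ℝ) else 0)
    (fun v _ => by split_ifs <;> positivity) h.preterminal
  rw [if_pos (by rw [h.eq_sdiff_desc, h.desc_eq, twig_self, Finset.sdiff_singleton_eq_erase])]
    at hterm
  exact (one_div_le_one_div_of_le (by exact_mod_cast hpos) hcard).trans hterm

lemma inv_le_twiggyPrune {T T' : CartTree L} {e v : Node} (h : IsGrowth T T' e v) :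
    1 / 2 ^ L ≤ twiggyPrune T' T := by
  have hmem : e ∈ T'.twigTops := Finset.mem_filter.2 ⟨h.mem_bot, v, h.mem_top, h.anc, h.desc_eq⟩
  have hpos : 0 < T'.twigTops.card := Finset.card_pos.2 ⟨e, hmem⟩
  have hcard : (T'.twigTops.card : ℝ) ≤ 2 ^ L := card_real_le (Finset.filter_subset _ _)
  have hterm := Finset.single_le_sum
    (f := fun v => if T.1 = T'.1 \ T'.desc v then 1 / (T'.twigTops.card : ℝ) else 0)
    (fun v _ => by split_ifs <;> positivity) hmem
  rw [if_pos h.eq_sdiff_desc] at hterm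
  exact (one_div_le_one_div_of_le (by exact_mod_cast hpos) hcard).trans hterm

lemma geom_sum_inv_identity {D : ℝ} (hD : 1 < D) (L : ℕ) :
    D ^ L * ∑ l ∈ Finset.range (L + 1), (D ^ l)⁻¹ = (D ^ (L + 1) - 1) / (D - 1) := by
  have hD0 : D ≠ 0 := by linarith
  rw [← geom_sum_eq hD.ne', Finset.mul_sum, ← Finset.sum_range_reflect]
  refine Finset.sum_congr rfl fun l hl => ?_
  have hl := Finset.mem_range.1 hl
  rw [← div_eq_mul_inv, div_eq_iff (pow_ne_zero _ hD0), ← pow_add]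
  congr 1
  omega

/-- The deepest level L - 1 is the worst case: at most 2^(L-1) free nodes share the level weight
D^(-(L-1))/G, and D^(L-1) G is at most the geometric sum (D^L - 1)/(D - 1). The exponent L - 1 of 2
explains the factor 2 in `delta`. -/
lemma delta_le_twiggyGrow {D : ℝ} (hD : 1 < D) {T T' : CartTree L} {e v : Node}
    (h : IsGrowth T T' e v) : (Sampler.twiggy D).delta L / 2 ^ L ≤ twiggyGrow D T T' := by
  have hD0 : 0 < D := by linarith
  obtain ⟨l, k⟩ := v
  obtain ⟨hl, hk⟩ := mem_fullNodes.1 h.full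
  simp only at hl hk
  have hkf : k ∈ T.free l :=
    Finset.mem_filter.2 ⟨Finset.mem_range.2 hk, h.not_mem h.anc⟩
  have hle : l ∈ T.eligible := Finset.mem_filter.2 ⟨Finset.mem_range.2 hl, ⟨k, hkf⟩⟩
  set G := ∑ l' ∈ T.eligible, (D ^ l')⁻¹ with hG
  have hGpos : 0 < G := Finset.sum_pos (fun _ _ => by positivity) ⟨l, hle⟩
  have hterm : ((D ^ l)⁻¹ / G) / ((T.free l).card : ℝ) ≤ twiggyGrow D T T' := by
    refine le_trans ?_ (Finset.single_le_sum (f := fun l => ∑ k ∈ T.free l,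
      if ∃ e ∈ T.ext, IsAnc e (l, k) ∧ T'.1 = T.1 ∪ twig e (l, k) then
        ((D ^ l)⁻¹ / G) / ((T.free l).card : ℝ) else 0)
      (fun _ _ => Finset.sum_nonneg fun _ _ => by split_ifs <;> positivity) hle)
    refine le_trans ?_ (Finset.single_le_sum (f := fun k =>
      if ∃ e ∈ T.ext, IsAnc e (l, k) ∧ T'.1 = T.1 ∪ twig e (l, k) then
        ((D ^ l)⁻¹ / G) / ((T.free l).card : ℝ) else 0)
      (fun _ _ => by split_ifs <;> positivity) hkf)
    rw [if_pos ⟨e, h.ext, h.anc, h.eq⟩]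
  refine le_trans ?_ hterm
  have hcard : ((T.free l).card : ℝ) ≤ 2 ^ l := by
    have : (T.free l).card ≤ 2 ^ l := (Finset.card_filter_le _ _).trans (Finset.card_range _).le
    exact_mod_cast this
  have hcpos : (0 : ℝ) < (T.free l).card := by exact_mod_cast Finset.card_pos.2 ⟨k, hkf⟩
  obtain ⟨N, rfl⟩ : ∃ N, L = N + 1 := ⟨L - 1, by omega⟩
  have hGle : D ^ N * G ≤ (D ^ (N + 1) - 1) / (D - 1) := by
    rw [← geom_sum_inv_identity hD N]
    refine mul_le_mul_of_nonneg_left ?_ (by positivity)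
    exact Finset.sum_le_sum_of_subset_of_nonneg (Finset.filter_subset _ _)
      fun _ _ _ => by positivity
  have hdel : (Sampler.twiggy D).delta (N + 1) = 2 / ((D ^ (N + 1) - 1) / (D - 1)) := by
    simp only [Sampler.delta]
    rw [div_div_eq_mul_div]
  rw [hdel]
  calc 2 / ((D ^ (N + 1) - 1) / (D - 1)) / 2 ^ (N + 1) ≤ 2 / (D ^ N * G) / 2 ^ (N + 1) := by
        gcongr
    _ = 1 / ((D ^ N * 2 ^ N) * G) := by
        rw [pow_succ]; field_simp
    _ ≤ 1 / ((D ^ l * 2 ^ l) * G) := by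
        gcongr
        · exact hD.le
        · omega
        · norm_num
        · omega
    _ ≤ 1 / ((D ^ l * (T.free l).card) * G) := by gcongr
    _ = _ := by field_simp

/-- The exponent L + 1 instead of L pays for the choice between GROW and PRUNE; the same holds for
`inv_le_proposal`. -/
lemma Sampler.delta_le_proposal {s : Sampler} (hs : s.Valid) {T T' : CartTree L}
    (h : s.Step T T') : s.delta L / 2 ^ (L + 1) ≤ s.proposal T T' := by
  obtain ⟨e, v, h, he⟩ := h
  have h₁ := half_le_growProb h.lt
  have h₂ := sub_nonneg.2 (growProb_le_one T)
  have hrw : s.delta L / 2 ^ (L + 1) = 1 / 2 * (s.delta L / 2 ^ L) := by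
    rw [pow_succ]; field_simp
  rw [hrw]
  cases s with
  | bayesianCART =>
    obtain rfl := he rfl
    exact le_add_of_le_of_nonneg
      (mul_le_mul h₁ (inv_le_cartGrow h) (by simp [delta]) (by linarith))
      (mul_nonneg h₂ (cartPrune_nonneg _ _))
  | twiggy D =>
    have hpos : 0 ≤ (Sampler.twiggy D).delta L / 2 ^ L := by
      have h1 : 0 ≤ D - 1 := by linarith [hs.1]
      have h2 : 0 ≤ D ^ L - 1 := sub_nonneg.2 (one_le_pow₀ hs.1.le)
      simp only [delta]
      positivity
    exact le_add_of_le_of_nonneg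
      (mul_le_mul h₁ (delta_le_twiggyGrow hs.1 h) hpos (by linarith))
      (mul_nonneg h₂ (twiggyPrune_nonneg _ _))

lemma Sampler.inv_le_proposal {s : Sampler} (hs : s.Valid) {T T' : CartTree L}
    (h : s.Step T T') : 1 / 2 ^ (L + 1) ≤ s.proposal T' T := by
  obtain ⟨e, v, h, he⟩ := h
  have h₁ : 1 / 2 ≤ 1 - growProb T' := by linarith [growProb_le_half h.lt]
  have h₂ := growProb_nonneg T'
  have hrw : (1 : ℝ) / 2 ^ (L + 1) = 1 / 2 * (1 / 2 ^ L) := by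
    rw [pow_succ]; field_simp
  rw [hrw]
  cases s with
  | bayesianCART =>
    obtain rfl := he rfl
    exact le_add_of_nonneg_of_le (mul_nonneg h₂ (cartGrow_nonneg _ _))
      (mul_le_mul h₁ (inv_le_cartPrune h) (by positivity) (by linarith))
  | twiggy D =>
    exact le_add_of_nonneg_of_le (mul_nonneg h₂ (twiggyGrow_nonneg hs.1 _ _))
      (mul_le_mul h₁ (inv_le_twiggyPrune h) (by positivity) (by linarith))

/-! ### Reversible Markov chains on a finite state space -/

section Chains

lemma lazyChain_reversible {α : Type*} [DecidableEq α] {P : Matrix α α ℝ} {π : α → ℝ}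
    (h : ∀ x y, π x * P x y = π y * P y x) (x y : α) :
    π x * lazyChain P x y = π y * lazyChain P y x := by
  simp only [lazyChain, Matrix.add_apply, Matrix.smul_apply, smul_eq_mul, mul_add]
  have h₁ := h x y
  by_cases hxy : x = y
  · rw [hxy]
  · rw [Matrix.one_apply_ne hxy, Matrix.one_apply_ne (Ne.symm hxy)]
    linarith

variable {α : Type*} [Fintype α] [DecidableEq α]

/-! ### The Metropolis–Hastings kernel. -/

section MetropolisHastings

variable {S : α → α → ℝ} {π : α → ℝ}

/-- In this form no proposal probability is in a denominator. If `S x y = 0`, the division by zero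
in the definition is harmless, since it is multiplied by `S x y` and the minimum is 0 too. -/
lemma metropolisHastings_of_ne (hS : ∀ x y, 0 ≤ S x y) (hπ : ∀ x, 0 < π x) {x y : α}
    (h : y ≠ x) : metropolisHastings S π x y = min (S x y) (π y / π x * S y x) := by
  simp only [metropolisHastings, if_neg h]
  have hx := hπ x
  have hy := hπ y
  rcases (hS x y).eq_or_lt with h0 | h0
  · rw [← h0, zero_mul, min_eq_left]
    have := hS y x
    positivity
  · rw [mul_min_of_nonneg _ _ h0.le, mul_one]
    congr 1
    field_simp

lemma sum_metropolisHastings (x : α) : ∑ y, metropolisHastings S π x y = 1 := by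
  rw [← Finset.add_sum_erase _ _ (Finset.mem_univ x)]
  have : ∑ y ∈ Finset.univ.erase x, metropolisHastings S π x y =
      ∑ y ∈ Finset.univ.erase x, S x y * min 1 (π y * S y x / (π x * S x y)) :=
    Finset.sum_congr rfl fun y hy => by
      simp only [metropolisHastings, if_neg (Finset.ne_of_mem_erase hy)]
  rw [this]
  simp [metropolisHastings]

/-- A substochastic proposal suffices, which matters because GROW of Bayesian CART may leave the
state space: off-diagonal entries are dominated by `S`, and the missing mass goes to the diagonal.
-/
lemma metropolisHastings_mem_rowStochastic (hS : ∀ x y, 0 ≤ S x y) (hS' : ∀ x, ∑ y, S x y ≤ 1)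
    (hπ : ∀ x, 0 < π x) : metropolisHastings S π ∈ Matrix.rowStochastic ℝ α := by
  have hne : ∀ x y, y ≠ x →
      0 ≤ metropolisHastings S π x y ∧ metropolisHastings S π x y ≤ S x y := by
    intro x y h
    rw [metropolisHastings_of_ne hS hπ h]
    have hx := hπ x
    have hy := hπ y
    have := hS y x
    exact ⟨le_min (hS x y) (by positivity), min_le_left _ _⟩
  rw [Matrix.mem_rowStochastic]
  constructor
  · intro x y
    by_cases h : y = x
    · subst h
      have h₁ := sum_metropolisHastings (S := S) (π := π) y
      rw [← Finset.add_sum_erase _ _ (Finset.mem_univ y)] at h₁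
      have h₂ : ∑ z ∈ Finset.univ.erase y, metropolisHastings S π y z ≤ ∑ z, S y z :=
        (Finset.sum_le_sum fun z hz => (hne y z (Finset.ne_of_mem_erase hz)).2).trans
          (Finset.sum_le_sum_of_subset_of_nonneg (Finset.erase_subset _ _) fun z _ _ => hS y z)
      linarith [hS' y]
    · exact (hne x y h).1
  · ext x
    simpa [Matrix.mulVec, dotProduct] using sum_metropolisHastings (S := S) (π := π) x

lemma metropolisHastings_reversible (hS : ∀ x y, 0 ≤ S x y) (hπ : ∀ x, 0 < π x) (x y : α) :
    π x * metropolisHastings S π x y = π y * metropolisHastings S π y x := by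
  by_cases h : y = x
  · rw [h]
  · rw [metropolisHastings_of_ne hS hπ h, metropolisHastings_of_ne hS hπ (Ne.symm h),
      mul_min_of_nonneg _ _ (hπ x).le, mul_min_of_nonneg _ _ (hπ y).le, min_comm]
    have hx := (hπ x).ne'
    have hy := (hπ y).ne'
    congr 1 <;> field_simp

end MetropolisHastings

/-! ### Return probabilities, drift and Doeblin contraction. -/

lemma sum_row_eq_one {P : Matrix α α ℝ} (hP : P ∈ Matrix.rowStochastic ℝ α) (x : α) :
    ∑ y, P x y = 1 := by
  simpa [Matrix.mulVec, dotProduct] using congrFun (Matrix.mem_rowStochastic.1 hP).2 x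

lemma mulVec_sub_eq {P : Matrix α α ℝ} (hP : P ∈ Matrix.rowStochastic ℝ α) (V : α → ℝ) (x : α) :
    (P *ᵥ V) x - V x = ∑ y, P x y * (V y - V x) := by
  simp only [Matrix.mulVec, dotProduct, mul_sub, Finset.sum_sub_distrib, ← Finset.sum_mul,
    sum_row_eq_one hP, one_mul]

lemma lazyChain_mem_rowStochastic {P : Matrix α α ℝ} (hP : P ∈ Matrix.rowStochastic ℝ α) :
    lazyChain P ∈ Matrix.rowStochastic ℝ α :=
  Matrix.convex_rowStochastic hP (one_mem _) (by norm_num) (by norm_num) (by norm_num)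

lemma half_le_lazyChain {P : Matrix α α ℝ} (hP : P ∈ Matrix.rowStochastic ℝ α) (x : α) :
    1 / 2 ≤ lazyChain P x x := by
  have := (Matrix.mem_rowStochastic.1 hP).1 x x
  simp only [lazyChain, Matrix.add_apply, Matrix.smul_apply, smul_eq_mul, Matrix.one_apply_eq]
  linarith

lemma lazyChain_mulVec (P : Matrix α α ℝ) (V : α → ℝ) (x : α) :
    (lazyChain P *ᵥ V) x = (1 / 2) * (P *ᵥ V) x + (1 / 2) * V x := by
  simp [lazyChain, Matrix.add_mulVec, Matrix.smul_mulVec]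

lemma pow_reversible {P : Matrix α α ℝ} {π : α → ℝ} (h : ∀ x y, π x * P x y = π y * P y x)
    (t : ℕ) (x y : α) : π x * (P ^ t) x y = π y * (P ^ t) y x := by
  induction t generalizing x y with
  | zero =>
    by_cases hxy : x = y
    · rw [hxy]
    · simp [Matrix.one_apply_ne hxy, Matrix.one_apply_ne (Ne.symm hxy)]
  | succ t ih =>
    rw [pow_succ, Matrix.mul_apply, ← pow_succ, pow_succ', Matrix.mul_apply, Finset.mul_sum,
      Finset.mul_sum]
    refine Finset.sum_congr rfl fun z _ => ?_
    rw [← mul_assoc, ih x z, ← mul_assoc, ← h z y]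
    ring

/-- A reversible chain returns at even times with at least the stationary probability. -/
lemma stationary_le_return_even {P : Matrix α α ℝ} (hP : P ∈ Matrix.rowStochastic ℝ α)
    {π : α → ℝ} (hπ : ∀ x, 0 < π x) (hsum : ∑ x, π x = 1)
    (h : ∀ x y, π x * P x y = π y * P y x) (t : ℕ) (x : α) : π x ≤ (P ^ (t + t)) x x := by
  -- By reversibility, P^(2t)(x,x) = π(x) ∑ P^t(x,y)²/π(y), and by Cauchy–Schwarz this sum is at
  -- least (∑ P^t(x,y))² / ∑ π(y) = 1.
  have hcs := Finset.sq_sum_div_le_sum_sq_div Finset.univ (fun y => (P ^ t) x y)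
    (g := π) fun y _ => hπ y
  rw [hsum, sum_row_eq_one (pow_mem hP t)] at hcs
  rw [pow_add, Matrix.mul_apply]
  calc π x ≤ π x * ∑ y, (P ^ t) x y ^ 2 / π y := by
        have := hπ x
        norm_num at hcs
        nlinarith
    _ = _ := by
        rw [Finset.mul_sum]
        refine Finset.sum_congr rfl fun y _ => ?_
        have h₁ := pow_reversible h t x y
        have h₂ := (hπ y).ne'
        field_simp
        linear_combination (P ^ t) x y * h₁

/-- At odd times the lazy chain can return one step earlier and then hold, which costs the factor
1/2. No spectral decomposition is needed. -/
lemma half_stationary_le_return {P : Matrix α α ℝ} (hP : P ∈ Matrix.rowStochastic ℝ α)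
    {π : α → ℝ} (hπ : ∀ x, 0 < π x) (hsum : ∑ x, π x = 1)
    (h : ∀ x y, π x * P x y = π y * P y x) (t : ℕ) (x : α) :
    π x / 2 ≤ (lazyChain P ^ t) x x := by
  have hQ := lazyChain_mem_rowStochastic hP
  have heven := fun t => stationary_le_return_even hQ hπ hsum (lazyChain_reversible h) t x
  have hx := hπ x
  rcases Nat.even_or_odd' t with ⟨k, rfl | rfl⟩
  · have := heven k
    rw [← two_mul] at this
    linarith
  · have h₁ := heven k
    rw [← two_mul] at h₁
    rw [pow_succ, Matrix.mul_apply]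
    have h₂ : (lazyChain P ^ (2 * k)) x x * lazyChain P x x ≤
        ∑ z, (lazyChain P ^ (2 * k)) x z * lazyChain P z x :=
      Finset.single_le_sum (f := fun z => (lazyChain P ^ (2 * k)) x z * lazyChain P z x)
        (fun z _ => mul_nonneg ((Matrix.mem_rowStochastic.1 (pow_mem hQ _)).1 _ _)
          ((Matrix.mem_rowStochastic.1 hQ).1 _ _)) (Finset.mem_univ x)
    have h₃ := half_le_lazyChain hP x
    nlinarith

/-- A drift condition towards a state `z` to which the chain returns with probability at least `m`
at all times bounds from below the probability of being in `z`. -/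
lemma le_pow_apply_of_drift {Q : Matrix α α ℝ} (hQ : Q ∈ Matrix.rowStochastic ℝ α) {z : α}
    {m γ : ℝ} (hm : 0 ≤ m) (hγ : γ ≤ 1) (hret : ∀ t, m ≤ (Q ^ t) z z) {W : α → ℝ} (hz : W z = 0)
    (hW : ∀ x, x ≠ z → 1 ≤ W x) (hdrift : ∀ x, x ≠ z → (Q *ᵥ W) x ≤ (1 - γ) * W x)
    (t : ℕ) (x : α) : m * (1 - (1 - γ) ^ t * W x) ≤ (Q ^ t) x z := by
  by_cases hx : x = z
  · subst hx
    simpa [hz] using hret t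
  -- Induction by the first step. At time 0 the left side is nonpositive because W ≥ 1 off `z`.
  -- Whenever the chain sits at `z`, where W vanishes, the claim is the return bound itself, so no
  -- drift is required at `z`.
  induction t generalizing x with
  | zero =>
    have h₁ := hW x hx
    simp only [pow_zero, one_mul, Matrix.one_apply_ne hx]
    nlinarith
  | succ t ih =>
    have ih' : ∀ y, m * (1 - (1 - γ) ^ t * W y) ≤ (Q ^ t) y z := by
      intro y
      by_cases hy : y = z
      · subst hy
        simpa [hz] using hret t
      · exact ih y hy
    rw [pow_succ' Q, Matrix.mul_apply]
    have h₁ : ∑ y, Q x y * (m * (1 - (1 - γ) ^ t * W y)) ≤ ∑ y, Q x y * (Q ^ t) y z :=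
      Finset.sum_le_sum fun y _ => mul_le_mul_of_nonneg_left (ih' y)
        ((Matrix.mem_rowStochastic.1 hQ).1 x y)
    have h₂ : ∑ y, Q x y * (m * (1 - (1 - γ) ^ t * W y)) =
        m * (1 - (1 - γ) ^ t * (Q *ᵥ W) x) := by
      calc _ = m * ∑ y, Q x y - m * (1 - γ) ^ t * ∑ y, Q x y * W y := by
            rw [Finset.mul_sum, Finset.mul_sum, ← Finset.sum_sub_distrib]
            exact Finset.sum_congr rfl fun y _ => by ring
        _ = _ := by
            rw [sum_row_eq_one hQ x]
            simp only [Matrix.mulVec, dotProduct]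
            ring
    have h₃ : (1 - γ) ^ t * (Q *ᵥ W) x ≤ (1 - γ) ^ (t + 1) * W x := by
      rw [pow_succ, mul_assoc]
      exact mul_le_mul_of_nonneg_left (hdrift x hx) (pow_nonneg (by linarith) _)
    rw [h₂] at h₁
    refine le_trans (mul_le_mul_of_nonneg_left ?_ hm) h₁
    linarith

lemma mulVec_mem_Icc {Q : Matrix α α ℝ} (hQ : Q ∈ Matrix.rowStochastic ℝ α) {f : α → ℝ}
    {a b : ℝ} (hf : ∀ x, f x ∈ Set.Icc a b) (x : α) : (Q *ᵥ f) x ∈ Set.Icc a b := by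
  have h0 := (Matrix.mem_rowStochastic.1 hQ).1 x
  have h1 := sum_row_eq_one hQ x
  simp only [Matrix.mulVec, dotProduct]
  constructor
  · calc a = ∑ y, Q x y * a := by rw [← Finset.sum_mul, h1, one_mul]
      _ ≤ _ := Finset.sum_le_sum fun y _ => mul_le_mul_of_nonneg_left (hf y).1 (h0 y)
  · calc _ ≤ ∑ y, Q x y * b :=
          Finset.sum_le_sum fun y _ => mul_le_mul_of_nonneg_left (hf y).2 (h0 y)
      _ = b := by rw [← Finset.sum_mul, h1, one_mul]

/-- The contraction of oscillations under a Doeblin condition. -/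
lemma mulVec_contract {R : Matrix α α ℝ} (hR : R ∈ Matrix.rowStochastic ℝ α) {z : α} {θ : ℝ}
    (hθ : ∀ x, θ ≤ R x z) {f : α → ℝ} {a r : ℝ} (hf : ∀ x, f x ∈ Set.Icc a (a + r)) :
    ∃ a', ∀ x, (R *ᵥ f) x ∈ Set.Icc a' (a' + (1 - θ) * r) := by
  -- Every row puts mass θ on `z`, which contributes the same θ f(z) for all x; only the remaining
  -- mass 1 - θ sees the oscillation of f.
  refine ⟨θ * f z + (1 - θ) * a, fun x => ?_⟩
  have h0 := (Matrix.mem_rowStochastic.1 hR).1 x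
  have h1 := sum_row_eq_one hR x
  have hexp : (R *ᵥ f) x = R x z * f z + ∑ y ∈ Finset.univ.erase z, R x y * f y := by
    simp only [Matrix.mulVec, dotProduct]
    rw [Finset.add_sum_erase _ (fun y => R x y * f y) (Finset.mem_univ z)]
  have hrest : R x z + ∑ y ∈ Finset.univ.erase z, R x y = 1 := by
    rw [Finset.add_sum_erase _ _ (Finset.mem_univ z), h1]
  have hlo : (∑ y ∈ Finset.univ.erase z, R x y) * a ≤
      ∑ y ∈ Finset.univ.erase z, R x y * f y := by
    rw [Finset.sum_mul]
    exact Finset.sum_le_sum fun y _ => mul_le_mul_of_nonneg_left (hf y).1 (h0 y)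
  have hhi : ∑ y ∈ Finset.univ.erase z, R x y * f y ≤
      (∑ y ∈ Finset.univ.erase z, R x y) * (a + r) := by
    rw [Finset.sum_mul]
    exact Finset.sum_le_sum fun y _ => mul_le_mul_of_nonneg_left (hf y).2 (h0 y)
  have hs : ∑ y ∈ Finset.univ.erase z, R x y = 1 - R x z := by linarith
  rw [hs] at hlo hhi
  have hz := hf z
  have ht := hθ x
  rw [hexp]
  constructor
  · nlinarith [hz.1]
  · nlinarith [hz.2]

lemma stationary_dotProduct {P : Matrix α α ℝ} (hP : P ∈ Matrix.rowStochastic ℝ α)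
    {π : α → ℝ} (h : ∀ x y, π x * P x y = π y * P y x) (f : α → ℝ) :
    ∑ x, π x * (P *ᵥ f) x = ∑ x, π x * f x := by
  simp only [Matrix.mulVec, dotProduct, Finset.mul_sum]
  rw [Finset.sum_comm]
  refine Finset.sum_congr rfl fun y _ => ?_
  calc ∑ x, π x * (P x y * f y) = ∑ x, P y x * (π y * f y) :=
        Finset.sum_congr rfl fun x _ => by rw [← mul_assoc, h x y]; ring
    _ = π y * f y := by rw [← Finset.sum_mul, sum_row_eq_one hP, one_mul]

/-- For the indicator f of a set, Q^t f takes values in an interval of length (1-θ)^k, and by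
stationarity the mass of the set under π is an average of these values. Further averaging never
widens the interval, so all later times are covered. -/
lemma tvDist_le_of_doeblin {Q : Matrix α α ℝ} (hQ : Q ∈ Matrix.rowStochastic ℝ α) {π : α → ℝ}
    (hπ : ∀ x, 0 < π x) (hsum : ∑ x, π x = 1) (hrev : ∀ x y, π x * Q x y = π y * Q y x)
    {z : α} {θ : ℝ} {t₀ : ℕ} (hθ : ∀ x, θ ≤ (Q ^ t₀) x z) (k t : ℕ) (ht : t₀ * k ≤ t) (x : α) :
    tvDist Q π x t ≤ (1 - θ) ^ k := by
  refine ciSup_le fun S => ?_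
  set f : α → ℝ := fun y => if y ∈ S then 1 else 0 with hf
  have hosc : ∃ a, ∀ x, ((Q ^ t₀) ^ k *ᵥ f) x ∈ Set.Icc a (a + (1 - θ) ^ k) := by
    clear ht
    induction k with
    | zero =>
      refine ⟨0, fun x => ?_⟩
      simp only [pow_zero, Matrix.one_mulVec, hf]
      split_ifs <;> norm_num
    | succ k ih =>
      obtain ⟨a, ha⟩ := ih
      obtain ⟨a', ha'⟩ := mulVec_contract (pow_mem hQ t₀) hθ ha
      refine ⟨a', fun x => ?_⟩
      rw [pow_succ' (Q ^ t₀), ← Matrix.mulVec_mulVec, pow_succ' (1 - θ)]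
      exact ha' x
  obtain ⟨a, ha⟩ := hosc
  have hb : ∀ x, (Q ^ t *ᵥ f) x ∈ Set.Icc a (a + (1 - θ) ^ k) := by
    intro x
    have : Q ^ t = Q ^ (t - t₀ * k) * (Q ^ t₀) ^ k := by
      rw [← pow_mul, ← pow_add, Nat.sub_add_cancel ht]
    rw [this, ← Matrix.mulVec_mulVec]
    exact mulVec_mem_Icc (pow_mem hQ _) ha x
  have h₁ : ∑ y ∈ S, (Q ^ t) x y = (Q ^ t *ᵥ f) x := by
    simp [Matrix.mulVec, dotProduct, hf]
  have h₂ : ∑ y ∈ S, π y = ∑ y, π y * (Q ^ t *ᵥ f) y := by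
    rw [stationary_dotProduct (pow_mem hQ t) (pow_reversible hrev t)]
    simp [hf]
  have h₃ : a ≤ ∑ y ∈ S, π y ∧ ∑ y ∈ S, π y ≤ a + (1 - θ) ^ k := by
    rw [h₂]
    constructor
    · calc a = ∑ y, π y * a := by rw [← Finset.sum_mul, hsum, one_mul]
        _ ≤ _ := Finset.sum_le_sum fun y _ => mul_le_mul_of_nonneg_left (hb y).1 (hπ y).le
    · calc _ ≤ ∑ y, π y * (a + (1 - θ) ^ k) :=
            Finset.sum_le_sum fun y _ => mul_le_mul_of_nonneg_left (hb y).2 (hπ y).le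
        _ = _ := by rw [← Finset.sum_mul, hsum, one_mul]
  rw [h₁, abs_le]
  have := hb x
  constructor <;> linarith [this.1, this.2, h₃.1, h₃.2]

lemma one_le_log_six : 1 ≤ Real.log 6 := by
  rw [Real.le_log_iff_exp_le (by norm_num)]
  linarith [Real.exp_one_lt_d9]

/-- The mixing time of a lazy reversible chain with a drift towards a state of stationary
probability at least `1/4`. -/
theorem mixingTime_lazyChain_le {P : Matrix α α ℝ} (hP : P ∈ Matrix.rowStochastic ℝ α)
    {π : α → ℝ} (hπ : ∀ x, 0 < π x) (hsum : ∑ x, π x = 1)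
    (hrev : ∀ x y, π x * P x y = π y * P y x) {z : α} (hz : 1 / 4 ≤ π z) {W : α → ℝ}
    (hWz : W z = 0) (hW : ∀ x, x ≠ z → 1 ≤ W x) (hW' : ∀ x, W x ≤ 8) {γ : ℝ} (hγ : 0 < γ)
    (hγ' : γ ≤ 1) (hdrift : ∀ x, x ≠ z → (P *ᵥ W) x ≤ (1 - γ) * W x) {ε : ℝ} (hε : 0 < ε)
    (hε' : ε < 1) :
    (mixingTime (lazyChain P) π ε : ℝ≥0∞) ≤ ENNReal.ofReal (119 / γ * Real.log (6 / ε)) := by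
  have hQ := lazyChain_mem_rowStochastic hP
  -- The lazy drift rate is γ/2, so after t₀ steps (1-γ/2)^t₀ ≤ e^(-3) ≤ 1/16. With W ≤ 8 and return
  -- probability at least 1/8 this yields the Doeblin constant (1/8)(1 - 1/2) = 1/16, and then
  -- (15/16)^k ≤ ε for the chosen k.
  set t₀ := ⌈6 / γ⌉₊ with ht₀
  set k := ⌈16 * Real.log (1 / ε)⌉₊ with hk
  have hlog : 0 < Real.log (1 / ε) := Real.log_pos (by rw [lt_div_iff₀ hε]; linarith)
  have hθ : ∀ x, 1 / 16 ≤ (lazyChain P ^ t₀) x z := by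
    intro x
    have h := le_pow_apply_of_drift hQ (m := 1 / 8) (γ := γ / 2) (by norm_num) (by linarith)
      (fun t => by linarith [half_stationary_le_return hP hπ hsum hrev t z]) hWz hW
      (fun x hx => by rw [lazyChain_mulVec]; linarith [hdrift x hx]) t₀ x
    have hpow : (1 - γ / 2) ^ t₀ ≤ 1 / 16 := by
      calc (1 - γ / 2) ^ t₀ ≤ Real.exp (-(γ / 2)) ^ t₀ :=
            pow_le_pow_left₀ (by linarith) (Real.one_sub_le_exp_neg _) _
        _ = Real.exp (-(t₀ * (γ / 2))) := by rw [← Real.exp_nat_mul]; congr 1; ring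
        _ ≤ Real.exp (-3) := by
            have := Nat.le_ceil (6 / γ)
            rw [← ht₀, div_le_iff₀ hγ] at this
            exact Real.exp_le_exp.2 (by linarith)
        _ ≤ 1 / 16 := by
            rw [Real.exp_neg, one_div]
            refine inv_anti₀ (by norm_num) ?_
            have h₁ : Real.exp 3 = Real.exp 1 ^ 3 := by rw [← Real.exp_nat_mul]; norm_num
            have h₂ := Real.exp_one_gt_d9
            rw [h₁]
            calc (16 : ℝ) ≤ 2.7182818283 ^ 3 := by norm_num
              _ ≤ _ := pow_le_pow_left₀ (by norm_num) h₂.le _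
    have hmul : (1 - γ / 2) ^ t₀ * W x ≤ 1 / 2 := by
      have h0 : 0 ≤ (1 - γ / 2) ^ t₀ := pow_nonneg (by linarith) _
      have := mul_le_mul_of_nonneg_left (hW' x) h0
      linarith
    linarith
  have hmem : ∀ x, ∀ t' ≥ t₀ * k, tvDist (lazyChain P) π x t' ≤ ε := by
    intro x t' ht'
    refine (tvDist_le_of_doeblin hQ hπ hsum (lazyChain_reversible hrev) hθ k t' ht' x).trans ?_
    calc (1 - 1 / 16 : ℝ) ^ k ≤ Real.exp (-(1 / 16)) ^ k :=
          pow_le_pow_left₀ (by norm_num) (Real.one_sub_le_exp_neg _) _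
      _ = Real.exp (-(k * (1 / 16))) := by rw [← Real.exp_nat_mul]; congr 1; ring
      _ ≤ Real.exp (Real.log ε) := by
          have := Nat.le_ceil (16 * Real.log (1 / ε))
          rw [← hk, one_div, Real.log_inv] at this
          exact Real.exp_le_exp.2 (by linarith)
      _ = ε := Real.exp_log hε
  have hmix : mixingTime (lazyChain P) π ε ≤ ((t₀ * k : ℕ) : ℕ∞) :=
    iSup_le fun x => iInf₂_le (t₀ * k) (hmem x)
  -- The ceilings are absorbed by γ ≤ 1 and log 6 ≥ 1, which give t₀ ≤ 7/γ and k ≤ 17 log(6/ε); 7 ·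
  -- 17 = 119.
  have hreal : ((t₀ * k : ℕ) : ℝ) ≤ 119 / γ * Real.log (6 / ε) := by
    have h₁ : (t₀ : ℝ) ≤ 7 / γ := by
      have h := (Nat.ceil_lt_add_one (a := 6 / γ) (by positivity)).le
      have h' : 1 ≤ 1 / γ := by rwa [le_div_iff₀ hγ, one_mul]
      calc (t₀ : ℝ) ≤ 6 / γ + 1 := h
        _ ≤ 6 / γ + 1 / γ := by linarith
        _ = 7 / γ := by ring
    have h₂ : (k : ℝ) ≤ 17 * Real.log (6 / ε) := by
      have h := (Nat.ceil_lt_add_one (a := 16 * Real.log (1 / ε)) (by positivity)).le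
      have h' : Real.log (6 / ε) = Real.log 6 + Real.log (1 / ε) := by
        rw [← Real.log_mul (by norm_num) (by positivity)]
        congr 1
        ring
      rw [← hk] at h
      linarith [one_le_log_six]
    push_cast
    calc (t₀ : ℝ) * k ≤ 7 / γ * (17 * Real.log (6 / ε)) := by gcongr
      _ = _ := by ring
  calc (mixingTime (lazyChain P) π ε : ℝ≥0∞) ≤ (((t₀ * k : ℕ) : ℕ∞) : ℝ≥0∞) := by
        exact_mod_cast hmix
    _ = ENNReal.ofReal ((t₀ * k : ℕ) : ℝ) := by
        rw [ENNReal.ofReal_natCast]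
        rfl
    _ ≤ _ := ENNReal.ofReal_le_ofReal hreal

end Chains

/-! ### The Haar design -/

lemma card_filter_div_eq {N q n : ℕ} (hN : 0 < N) (h : (q + 1) * N ≤ n) :
    ((Finset.range n).filter fun i => i / N = q).card = N := by
  have : (Finset.range n).filter (fun i => i / N = q) = Finset.Ico (q * N) ((q + 1) * N) := by
    ext i
    simp only [Finset.mem_filter, Finset.mem_range, Finset.mem_Ico, Nat.div_eq_iff hN]
    rw [Nat.add_mul, one_mul] at h ⊢
    omega
  rw [this, Nat.card_Ico, Nat.add_mul, one_mul, Nat.add_sub_cancel_left]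

/-- The discretized mother wavelet on blocks of length `2 * N`. -/
def haarStep (N k i : ℕ) : ℝ := (if i / N = 2 * k then 1 else 0) - if i / N = 2 * k + 1 then 1 else 0

/-- A function that is constant on blocks of length 2N is orthogonal to a mean-zero function living
on one such block. This covers both the constant function and all coarser wavelets. -/
lemma sum_mul_haarStep {N k n : ℕ} (hN : 0 < N) (h : (2 * k + 2) * N ≤ n) (g : ℕ → ℝ) :
    ∑ i ∈ Finset.range n, g (i / (2 * N)) * haarStep N k i = 0 := by
  have hterm : ∀ i, g (i / (2 * N)) * haarStep N k i =
      (if i / N = 2 * k then g k else 0) - if i / N = 2 * k + 1 then g k else 0 := by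
    intro i
    have hi : i / (2 * N) = i / N / 2 := by rw [mul_comm, Nat.div_div_eq_div_mul]
    by_cases h₁ : i / N = 2 * k
    · have h₂ : i / (2 * N) = k := by omega
      simp [haarStep, h₁, h₂]
    · by_cases h₂ : i / N = 2 * k + 1
      · have h₃ : i / (2 * N) = k := by omega
        simp [haarStep, h₂, h₃]
      · simp [haarStep, h₁, h₂]
  rw [Finset.sum_congr rfl fun i _ => hterm i, Finset.sum_sub_distrib, ← Finset.sum_filter,
    ← Finset.sum_filter, Finset.sum_const, Finset.sum_const, card_filter_div_eq hN,
    card_filter_div_eq hN, sub_self]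
  · exact h
  · exact (Nat.mul_le_mul_right _ (by omega)).trans h

lemma sum_haarStep_sq {N k n : ℕ} (hN : 0 < N) (h : (2 * k + 2) * N ≤ n) :
    ∑ i ∈ Finset.range n, haarStep N k i * haarStep N k i = 2 * N := by
  have hterm : ∀ i, haarStep N k i * haarStep N k i =
      (if i / N = 2 * k then 1 else 0) + if i / N = 2 * k + 1 then 1 else 0 := by
    intro i
    by_cases h₁ : i / N = 2 * k
    · simp [haarStep, h₁]
    · by_cases h₂ : i / N = 2 * k + 1 <;> simp [haarStep, h₁, h₂]
  rw [Finset.sum_congr rfl fun i _ => hterm i, Finset.sum_add_distrib, ← Finset.sum_filter,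
    ← Finset.sum_filter, Finset.sum_const, Finset.sum_const, card_filter_div_eq hN,
    card_filter_div_eq hN, nsmul_eq_mul, mul_one, two_mul]
  · exact h
  · exact (Nat.mul_le_mul_right _ (by omega)).trans h

/-- The design points are (i+1)/n and the dyadic intervals are open on the left and closed on the
right, so membership in an interval is an exact condition on the quotient i / N, without boundary
effects. -/
lemma haar_some_designPoint {Lmax l k : ℕ} (hl : l ≤ Lmax) (i : Fin (sampleSize Lmax)) :
    haar (some (l, k)) (designPoint (sampleSize Lmax) i) =
      (2 : ℝ) ^ ((l : ℝ) / 2) * haarStep (2 ^ (Lmax - l)) k i := by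
  have hN : 0 < 2 ^ (Lmax - l) := by positivity
  have hn : (sampleSize Lmax : ℝ) = 2 ^ l * (2 * (2 ^ (Lmax - l) : ℕ)) := by
    rw [sampleSize]
    push_cast
    rw [← pow_succ', ← pow_add]
    congr 1
    omega
  set N := 2 ^ (Lmax - l) with hNdef
  have hN' : (0 : ℝ) < N := by exact_mod_cast hN
  have hx : (2 : ℝ) ^ l * designPoint (sampleSize Lmax) i - k =
      (((i : ℕ) + 1 : ℝ) - 2 * k * N) / (2 * N) := by
    rw [designPoint, hn]
    field_simp
  have h₁ : ((((i : ℕ) + 1 : ℝ) - 2 * k * N) / (2 * N) ∈ Set.Ioc (0 : ℝ) (1 / 2)) ↔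
      (i : ℕ) / N = 2 * k := by
    rw [Nat.div_eq_iff hN, Set.mem_Ioc, lt_div_iff₀ (by positivity), div_le_iff₀ (by positivity)]
    have e₁ : (0 * (2 * (N : ℝ)) < ((i : ℕ) + 1 : ℝ) - 2 * k * N) ↔ 2 * k * N < (i : ℕ) + 1 := by
      rw [zero_mul, sub_pos]; norm_cast
    have e₂ : (((i : ℕ) + 1 : ℝ) - 2 * k * N ≤ 1 / 2 * (2 * N)) ↔
        (i : ℕ) + 1 ≤ 2 * k * N + N := by
      rw [sub_le_iff_le_add, show (1 / 2 * (2 * (N : ℝ)) + 2 * k * N) = 2 * k * N + N by ring]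
      norm_cast
    rw [e₁, e₂]
    omega
  have h₂ : ((((i : ℕ) + 1 : ℝ) - 2 * k * N) / (2 * N) ∈ Set.Ioc (1 / 2 : ℝ) 1) ↔
      (i : ℕ) / N = 2 * k + 1 := by
    rw [Nat.div_eq_iff hN, Set.mem_Ioc, lt_div_iff₀ (by positivity), div_le_iff₀ (by positivity)]
    have e₁ : (1 / 2 * (2 * (N : ℝ)) < ((i : ℕ) + 1 : ℝ) - 2 * k * N) ↔
        2 * k * N + N < (i : ℕ) + 1 := by
      rw [lt_sub_iff_add_lt, show (1 / 2 * (2 * (N : ℝ)) + 2 * k * N) = 2 * k * N + N by ring]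
      norm_cast
    have e₂ : (((i : ℕ) + 1 : ℝ) - 2 * k * N ≤ 1 * (2 * N)) ↔
        (i : ℕ) + 1 ≤ 2 * k * N + 2 * N := by
      rw [sub_le_iff_le_add, show (1 * (2 * (N : ℝ)) + 2 * k * N) = 2 * k * N + 2 * N by ring]
      norm_cast
    rw [e₁, e₂, Nat.add_mul, one_mul]
    omega
  simp only [haar, haarMother, haarStep, hx, Set.indicator_apply, h₁, h₂, Pi.one_apply]

lemma haar_none_designPoint {n : ℕ} (i : Fin n) : haar none (designPoint n i) = 1 := by
  have hn : (0 : ℝ) < n := by exact_mod_cast i.pos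
  have hi : ((i : ℕ) + 1 : ℝ) ≤ n := by exact_mod_cast i.2
  have hmem : designPoint n i ∈ Set.Icc (0 : ℝ) 1 := by
    refine ⟨?_, ?_⟩
    · rw [designPoint]; positivity
    · rw [designPoint, div_le_one hn]; exact hi
  simp [haar, Set.indicator_of_mem hmem]

/-- Brings the coarser wavelet into the form `g (i / (2 * N))` required by `sum_mul_haarStep` for
the finer one. -/
lemma haarStep_eq_of_lt {Lmax l l' : ℕ} (hl : l < l') (hl' : l' ≤ Lmax) (k i : ℕ) :
    haarStep (2 ^ (Lmax - l)) k i =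
      (fun q : ℕ => (if q / 2 ^ (l' - l - 1) = 2 * k then (1 : ℝ) else 0) -
        if q / 2 ^ (l' - l - 1) = 2 * k + 1 then 1 else 0) (i / (2 * 2 ^ (Lmax - l'))) := by
  have : i / (2 * 2 ^ (Lmax - l')) / 2 ^ (l' - l - 1) = i / 2 ^ (Lmax - l) := by
    rw [Nat.div_div_eq_div_mul, ← pow_succ', ← pow_add]
    congr 2
    omega
  simp only [haarStep, this]

/-- Since l < L ≤ Lmax, each half of the support of a wavelet contains exactly 2^(Lmax - l) design
points, so the orthogonality on [0,1] survives discretization exactly. -/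
lemma sum_haar_mul_haar {Lmax : ℕ} (hL : L ≤ Lmax) {v w : Index} (hv : v ∈ fullIndices L)
    (hw : w ∈ fullIndices L) :
    ∑ i, haar v (designPoint (sampleSize Lmax) i) * haar w (designPoint (sampleSize Lmax) i) =
      if v = w then (sampleSize Lmax : ℝ) else 0 := by
  have hblock : ∀ {l k : ℕ}, (l, k) ∈ fullNodes L →
      l ≤ Lmax ∧ (2 * k + 2) * 2 ^ (Lmax - l) ≤ sampleSize Lmax := by
    intro l k h
    obtain ⟨h₁, h₂⟩ := mem_fullNodes.1 h
    simp only at h₁ h₂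
    refine ⟨by omega, ?_⟩
    calc (2 * k + 2) * 2 ^ (Lmax - l) ≤ 2 ^ (l + 1) * 2 ^ (Lmax - l) := by
          refine Nat.mul_le_mul_right _ ?_
          rw [pow_succ]
          omega
      _ = sampleSize Lmax := by
          rw [sampleSize, ← pow_add]
          congr 1
          omega
  have hnone : ∀ u ∈ fullNodes L, ∑ i : Fin (sampleSize Lmax),
      haar (some u) (designPoint (sampleSize Lmax) i) = 0 := by
    rintro ⟨l, k⟩ hu
    obtain ⟨h₁, h₂⟩ := hblock hu
    simp_rw [haar_some_designPoint h₁]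
    rw [← Finset.mul_sum, Fin.sum_univ_eq_sum_range (fun i => haarStep (2 ^ (Lmax - l)) k i)]
    have := sum_mul_haarStep (by positivity) h₂ fun _ => 1
    simp only [one_mul] at this
    rw [this, mul_zero]
  have hlt : ∀ {l k l' k' : ℕ}, (l, k) ∈ fullNodes L → (l', k') ∈ fullNodes L → l < l' →
      ∑ i, haar (some (l, k)) (designPoint (sampleSize Lmax) i) *
        haar (some (l', k')) (designPoint (sampleSize Lmax) i) = 0 := by
    intro l k l' k' h h' hll
    obtain ⟨h₁, h₂⟩ := hblock h
    obtain ⟨h₁', h₂'⟩ := hblock h'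
    simp_rw [haar_some_designPoint h₁, haar_some_designPoint h₁', haarStep_eq_of_lt hll h₁']
    have := sum_mul_haarStep (by positivity) h₂'
      (fun q : ℕ => (if q / 2 ^ (l' - l - 1) = 2 * k then (1 : ℝ) else 0) -
        if q / 2 ^ (l' - l - 1) = 2 * k + 1 then 1 else 0)
    rw [← Fin.sum_univ_eq_sum_range (fun i => (fun q : ℕ =>
      (if q / 2 ^ (l' - l - 1) = 2 * k then (1 : ℝ) else 0) -
        if q / 2 ^ (l' - l - 1) = 2 * k + 1 then 1 else 0) (i / (2 * 2 ^ (Lmax - l'))) *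
        haarStep (2 ^ (Lmax - l')) k' i)] at this
    refine Eq.trans ?_ (mul_eq_zero_of_right
      ((2 : ℝ) ^ ((l : ℝ) / 2) * (2 : ℝ) ^ ((l' : ℝ) / 2)) this)
    rw [Finset.mul_sum]
    exact Finset.sum_congr rfl fun i _ => by ring
  rcases v with _ | ⟨l, k⟩ <;> rcases w with _ | ⟨l', k'⟩
  · simp [haar_none_designPoint]
  · simp only [haar_none_designPoint, one_mul, reduceCtorEq, if_false]
    exact hnone _ (Finset.some_mem_insertNone.1 hw)
  · simp only [haar_none_designPoint, mul_one, reduceCtorEq, if_false]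
    exact hnone _ (Finset.some_mem_insertNone.1 hv)
  · replace hv := Finset.some_mem_insertNone.1 hv
    replace hw := Finset.some_mem_insertNone.1 hw
    rcases lt_trichotomy l l' with hll | rfl | hll
    · rw [hlt hv hw hll, if_neg]
      simp only [Option.some.injEq, Prod.mk.injEq]
      omega
    · obtain ⟨h₁, h₂⟩ := hblock hv
      simp_rw [haar_some_designPoint h₁]
      by_cases hk : k = k'
      · subst hk
        rw [if_pos rfl]
        have := sum_haarStep_sq (by positivity) h₂
        rw [← Fin.sum_univ_eq_sum_range (fun i => haarStep (2 ^ (Lmax - l)) k i *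
          haarStep (2 ^ (Lmax - l)) k i)] at this
        calc _ = ((2 : ℝ) ^ ((l : ℝ) / 2) * (2 : ℝ) ^ ((l : ℝ) / 2)) *
              ∑ i : Fin (sampleSize Lmax), haarStep (2 ^ (Lmax - l)) k i *
                haarStep (2 ^ (Lmax - l)) k i := by
              rw [Finset.mul_sum]
              exact Finset.sum_congr rfl fun i _ => by ring
          _ = 2 ^ l * (2 * (2 ^ (Lmax - l) : ℕ)) := by
              rw [this, ← Real.rpow_add (by norm_num), add_halves, Real.rpow_natCast]
          _ = (sampleSize Lmax : ℝ) := by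
              rw [sampleSize]
              push_cast
              rw [← pow_succ', ← pow_add]
              congr 1
              omega
      · rw [if_neg (by simpa using hk)]
        refine Finset.sum_eq_zero fun i _ => ?_
        have : haarStep (2 ^ (Lmax - l)) k i * haarStep (2 ^ (Lmax - l)) k' i = 0 := by
          simp only [haarStep]
          split_ifs <;> first | omega | norm_num
        calc _ = ((2 : ℝ) ^ ((l : ℝ) / 2) * (2 : ℝ) ^ ((l : ℝ) / 2)) *
            (haarStep (2 ^ (Lmax - l)) k i * haarStep (2 ^ (Lmax - l)) k' i) := by ring
          _ = 0 := by rw [this, mul_zero]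
    · simp_rw [mul_comm (haar (some (l, k)) _)]
      rw [hlt hw hv hll, if_neg]
      simp only [Option.some.injEq, Prod.mk.injEq]
      omega

/-- The inner product of the data with a column of the full design. -/
noncomputable def haarCoef (n : ℕ) (Y : Fin n → ℝ) (v : Index) : ℝ :=
  ∑ i, haar v (designPoint n i) * Y i

lemma CartTree.int_subset (T : CartTree L) : T.int ⊆ fullIndices L := by
  intro v hv
  rcases v with _ | v
  · simp [fullIndices]
  · exact Finset.some_mem_insertNone.2 (T.subset_full (Finset.some_mem_insertNone.1 hv))

lemma haarCoef_signalVec {Lmax : ℕ} (hL : L ≤ Lmax) {B : Finset Index} (hB : B ⊆ fullIndices L)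
    (β : Index → ℝ) {v : Index} (hv : v ∈ fullIndices L) :
    haarCoef (sampleSize Lmax) (signalVec (sampleSize Lmax) B β) v =
      if v ∈ B then sampleSize Lmax * β v else 0 := by
  simp only [haarCoef, signalVec, regFun, Finset.mul_sum]
  rw [Finset.sum_comm]
  calc _ = ∑ w ∈ B, (if v = w then (sampleSize Lmax : ℝ) else 0) * β w := by
        refine Finset.sum_congr rfl fun w hw => ?_
        rw [← sum_haar_mul_haar hL hv (hB hw), Finset.sum_mul]
        exact Finset.sum_congr rfl fun i _ => by ring
    _ = _ := by simp [ite_mul]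

lemma haarCoef_add {n : ℕ} (Y Z : Fin n → ℝ) (v : Index) :
    haarCoef n (Y + Z) v = haarCoef n Y v + haarCoef n Z v := by
  simp [haarCoef, mul_add, Finset.sum_add_distrib]

lemma design_transpose_mul {Lmax : ℕ} (hL : L ≤ Lmax) (T : CartTree L) :
    (design (sampleSize Lmax) T)ᵀ * design (sampleSize Lmax) T =
      (sampleSize Lmax : ℝ) • (1 : Matrix T.int T.int ℝ) := by
  ext v w
  simp only [Matrix.mul_apply, Matrix.transpose_apply, design, Matrix.smul_apply,
    Matrix.one_apply, smul_eq_mul, mul_ite, mul_one, mul_zero]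
  rw [sum_haar_mul_haar hL (T.int_subset v.2) (T.int_subset w.2)]
  simp only [Subtype.ext_iff]

lemma design_transpose_mulVec {n : ℕ} (Y : Fin n → ℝ) (T : CartTree L) (v : T.int) :
    ((design n T)ᵀ *ᵥ Y) v = haarCoef n Y v := by
  simp [Matrix.mulVec, dotProduct, design, haarCoef]

lemma signalVec_dotProduct_self {Lmax : ℕ} (hL : L ≤ Lmax) {B : Finset Index}
    (hB : B ⊆ fullIndices L) (β : Index → ℝ) :
    signalVec (sampleSize Lmax) B β ⬝ᵥ signalVec (sampleSize Lmax) B β =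
      sampleSize Lmax * ∑ v ∈ B, β v ^ 2 := by
  have h : ∀ Y : Fin (sampleSize Lmax) → ℝ, signalVec (sampleSize Lmax) B β ⬝ᵥ Y =
      ∑ v ∈ B, β v * haarCoef (sampleSize Lmax) Y v := by
    intro Y
    simp only [dotProduct, signalVec, regFun, haarCoef, Finset.mul_sum, Finset.sum_mul]
    rw [Finset.sum_comm]
    exact Finset.sum_congr rfl fun v _ => Finset.sum_congr rfl fun i _ => by ring
  rw [h, Finset.mul_sum]
  refine Finset.sum_congr rfl fun v hv => ?_
  rw [haarCoef_signalVec hL hB β (hB hv), if_pos hv]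
  ring

/-- By orthogonality X_T X_T'/n is a projection, and the residual energy of the signal is n times
the sum of the squared coefficients missing from T. -/
lemma drift₁_eq {Lmax : ℕ} (hL : L ≤ Lmax) {B : Finset Index} (hB : B ⊆ fullIndices L)
    (β : Index → ℝ) (C : ℝ) (T : CartTree L) :
    drift₁ (sampleSize Lmax) C (signalVec (sampleSize Lmax) B β) T =
      Real.exp (1 / (2 ^ L * C ^ 2) * ∑ v ∈ B \ T.int, β v ^ 2) := by
  have hn : (sampleSize Lmax : ℝ) ≠ 0 := by simp [sampleSize]
  set F := signalVec (sampleSize Lmax) B β with hF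
  have hquad : F ⬝ᵥ ((1 - (1 / (sampleSize Lmax : ℝ)) •
      (design (sampleSize Lmax) T * (design (sampleSize Lmax) T)ᵀ)) *ᵥ F) =
        sampleSize Lmax * ∑ v ∈ B \ T.int, β v ^ 2 := by
    rw [Matrix.sub_mulVec, Matrix.one_mulVec, dotProduct_sub, Matrix.smul_mulVec, dotProduct_smul,
      ← Matrix.mulVec_mulVec, Matrix.dotProduct_mulVec, ← Matrix.mulVec_transpose,
      signalVec_dotProduct_self hL hB]
    have h₁ : (design (sampleSize Lmax) T)ᵀ *ᵥ F ⬝ᵥ (design (sampleSize Lmax) T)ᵀ *ᵥ F =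
        ∑ v ∈ T.int, if v ∈ B then (sampleSize Lmax : ℝ) ^ 2 * β v ^ 2 else 0 := by
      rw [← Finset.sum_coe_sort]
      refine Finset.sum_congr rfl fun v _ => ?_
      rw [design_transpose_mulVec, hF, haarCoef_signalVec hL hB β (T.int_subset v.2)]
      split_ifs <;> ring
    rw [h₁, ← Finset.sum_filter, Finset.filter_mem_eq_inter, ← Finset.mul_sum,
      ← Finset.sum_sdiff (s₁ := T.int ∩ B) (s₂ := B) Finset.inter_subset_right]
    rw [show B \ (T.int ∩ B) = B \ T.int by ext; simp]
    simp only [smul_eq_mul]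
    field_simp
    ring
  rw [drift₁, hquad]
  congr 1
  field_simp

/-! ### The posterior -/

/-- Completing the square: the integrand times the standard normal density is a multiple of the
density of N(z/(n+1), 1/(n+1)). -/
lemma integral_exp_quadratic_gaussianReal (n : ℕ) (z : ℝ) :
    ∫ b, Real.exp (b * z - n * b ^ 2 / 2) ∂(gaussianReal 0 1) =
      (√(n + 1))⁻¹ * Real.exp (z ^ 2 / (2 * (n + 1))) := by
  have hn : (0 : ℝ) < n + 1 := by positivity
  let w : NNReal := ⟨1 / (n + 1), by positivity⟩
  have hw : (w : ℝ) = 1 / (n + 1) := rfl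
  have hw0 : w ≠ 0 := by
    rw [← NNReal.coe_ne_zero, hw]
    positivity
  rw [integral_gaussianReal_eq_integral_smul one_ne_zero]
  have hpt : ∀ b : ℝ, gaussianPDFReal 0 1 b • Real.exp (b * z - n * b ^ 2 / 2) =
      ((√(n + 1))⁻¹ * Real.exp (z ^ 2 / (2 * (n + 1)))) * gaussianPDFReal (z / (n + 1)) w b := by
    intro b
    simp only [gaussianPDFReal, smul_eq_mul, hw, NNReal.coe_one, mul_one]
    have h₁ : √(2 * Real.pi * (1 / (n + 1))) = √(2 * Real.pi) * (√(n + 1))⁻¹ := by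
      rw [mul_one_div, Real.sqrt_div (by positivity), div_eq_mul_inv]
    rw [h₁, mul_inv, inv_inv]
    have h₂ : √((n : ℝ) + 1) ≠ 0 := (Real.sqrt_pos.2 hn).ne'
    calc _ = (√(2 * Real.pi))⁻¹ *
          (Real.exp (-(b - 0) ^ 2 / 2) * Real.exp (b * z - n * b ^ 2 / 2)) := by ring
      _ = (√(2 * Real.pi))⁻¹ * (Real.exp (z ^ 2 / (2 * (n + 1))) *
          Real.exp (-(b - z / (n + 1)) ^ 2 / (2 * (1 / (n + 1))))) := by
          rw [← Real.exp_add, ← Real.exp_add]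
          congr 2
          field_simp
          ring
      _ = _ := by field_simp
  simp_rw [hpt]
  rw [integral_const_mul, integral_gaussianPDFReal_eq_one _ hw0, mul_one]

/-- X_T'X_T = nI removes all cross terms of the coefficients, so the Gaussian integral splits into
one-dimensional ones. -/
lemma marginalLikelihood_eq {Lmax n : ℕ} (hL : L ≤ Lmax) (hn : n = sampleSize Lmax)
    (Y : Fin n → ℝ) (T : CartTree L) :
    marginalLikelihood n Y T = ((√(2 * Real.pi))⁻¹ ^ n * Real.exp (-(Y ⬝ᵥ Y) / 2)) *
      ∏ v ∈ T.int, ((√(n + 1))⁻¹ * Real.exp (haarCoef n Y v ^ 2 / (2 * (n + 1)))) := by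
  have hXX : (design n T)ᵀ * design n T = (n : ℝ) • (1 : Matrix T.int T.int ℝ) := by
    subst hn
    exact design_transpose_mul hL T
  set X := design n T with hX
  have hpt : ∀ b : T.int → ℝ, ∏ i, gaussianPDFReal ((X *ᵥ b) i) 1 (Y i) =
      ((√(2 * Real.pi))⁻¹ ^ n * Real.exp (-(Y ⬝ᵥ Y) / 2)) *
        ∏ v : T.int, Real.exp (b v * haarCoef n Y v - n * b v ^ 2 / 2) := by
    intro b
    simp only [gaussianPDFReal, NNReal.coe_one, mul_one]
    rw [Finset.prod_mul_distrib, Finset.prod_const, Finset.card_univ, Fintype.card_fin, mul_assoc,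
      ← Real.exp_sum, ← Real.exp_sum, ← Real.exp_add]
    congr 2
    have h₁ : ∑ i, -(Y i - (X *ᵥ b) i) ^ 2 / 2 =
        -(Y ⬝ᵥ Y) / 2 + Y ⬝ᵥ (X *ᵥ b) - (X *ᵥ b) ⬝ᵥ (X *ᵥ b) / 2 := by
      simp only [dotProduct]
      rw [← Finset.sum_neg_distrib, Finset.sum_div, Finset.sum_div, ← Finset.sum_add_distrib,
        ← Finset.sum_sub_distrib]
      exact Finset.sum_congr rfl fun i _ => by ring
    have h₂ : Y ⬝ᵥ (X *ᵥ b) = ∑ v : T.int, b v * haarCoef n Y v := by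
      rw [Matrix.dotProduct_mulVec, ← Matrix.mulVec_transpose, dotProduct]
      exact Finset.sum_congr rfl fun v _ => by rw [hX, design_transpose_mulVec]; ring
    have h₃ : (X *ᵥ b) ⬝ᵥ (X *ᵥ b) = n * ∑ v : T.int, b v ^ 2 := by
      rw [Matrix.dotProduct_mulVec, ← Matrix.mulVec_transpose, Matrix.mulVec_mulVec, hXX,
        Matrix.smul_mulVec, Matrix.one_mulVec, smul_dotProduct,
        smul_eq_mul, dotProduct]
      simp only [sq]
    rw [h₁, h₂, h₃, Finset.sum_sub_distrib, add_sub_assoc, Finset.mul_sum, Finset.sum_div]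
  rw [marginalLikelihood, integral_congr_ae (.of_forall hpt), integral_const_mul, integral_fintype_prod_eq_prod
    (f := fun (v : T.int) (b : ℝ) => Real.exp (b * haarCoef n Y v - n * b ^ 2 / 2))]
  congr 1
  rw [← Finset.prod_coe_sort T.int]
  exact Finset.prod_congr rfl fun v _ => integral_exp_quadratic_gaussianReal n _

/-- The factor by which the posterior weight of a tree changes when `v` is made internal. -/
noncomputable def nodeWeight (n : ℕ) (c : ℝ) (Y : Fin n → ℝ) (v : Index) : ℝ :=
  (n : ℝ) ^ (-c) * (1 - (n : ℝ) ^ (-c)) * ((√(n + 1))⁻¹ *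
    Real.exp (haarCoef n Y v ^ 2 / (2 * (n + 1))))

lemma CartTree.card_int (T : CartTree L) : T.int.card = T.1.card + 1 := by
  simp [CartTree.int, Finset.card_insertNone]

/-- `card_ext` and `card_int` give equally many internal and external nodes, so each factor of an
internal node can be paired with one 1 - n^(-c); the prior then depends only on the number of
internal nodes. -/
lemma treePrior_mul_marginalLikelihood {Lmax : ℕ} (hL : L ≤ Lmax) (c : ℝ)
    (Y : Fin (sampleSize Lmax) → ℝ) (T : CartTree L) :
    treePrior (sampleSize Lmax) c T * marginalLikelihood (sampleSize Lmax) Y T =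
      ((√(2 * Real.pi))⁻¹ ^ sampleSize Lmax * Real.exp (-(Y ⬝ᵥ Y) / 2)) *
      ∏ v ∈ T.int, nodeWeight (sampleSize Lmax) c Y v := by
  have h : ∏ v ∈ T.int, nodeWeight (sampleSize Lmax) c Y v =
      (((sampleSize Lmax : ℝ) ^ (-c)) * (1 - (sampleSize Lmax : ℝ) ^ (-c))) ^ T.int.card *
      ∏ v ∈ T.int, ((√(sampleSize Lmax + 1))⁻¹ *
        Real.exp (haarCoef (sampleSize Lmax) Y v ^ 2 / (2 * (sampleSize Lmax + 1)))) := by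
    simp only [nodeWeight]
    rw [Finset.prod_mul_distrib, Finset.prod_const]
  rw [marginalLikelihood_eq hL rfl, treePrior, h, Finset.prod_const, Finset.prod_const, T.card_ext,
    T.card_int, mul_pow]
  ring

lemma nodeWeight_pos {n : ℕ} (hn : 1 < n) {c : ℝ} (hc : 0 < c) (Y : Fin n → ℝ) (v : Index) :
    0 < nodeWeight n c Y v := by
  have hn' : (1 : ℝ) < n := by exact_mod_cast hn
  have h₁ : (n : ℝ) ^ (-c) < 1 := Real.rpow_lt_one_of_one_lt_of_neg hn' (by linarith)
  have h₂ : 0 < 1 - (n : ℝ) ^ (-c) := by linarith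
  have h₃ : (0 : ℝ) < n := by linarith
  unfold nodeWeight
  positivity

lemma one_lt_sampleSize (Lmax : ℕ) : 1 < sampleSize Lmax := by
  rw [sampleSize]
  exact Nat.one_lt_two_pow (by omega)

instance : Nonempty (CartTree L) :=
  ⟨⟨∅, mem_treeSets_of_closed (Finset.empty_subset _) (by simp)⟩⟩

section

variable {Lmax : ℕ} {c : ℝ} (Y : Fin (sampleSize Lmax) → ℝ)

lemma treeWeight_pos (hL : L ≤ Lmax) (hc : 0 < c) (T : CartTree L) :
    0 < treePrior (sampleSize Lmax) c T * marginalLikelihood (sampleSize Lmax) Y T := by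
  rw [treePrior_mul_marginalLikelihood hL]
  have := Finset.prod_pos fun v (_ : v ∈ T.int) => nodeWeight_pos (one_lt_sampleSize Lmax) hc Y v
  positivity

lemma sum_treeWeight_pos (hL : L ≤ Lmax) (hc : 0 < c) :
    0 < ∑ T : CartTree L,
      treePrior (sampleSize Lmax) c T * marginalLikelihood (sampleSize Lmax) Y T :=
  Finset.sum_pos (fun T _ => treeWeight_pos Y hL hc T) Finset.univ_nonempty

lemma posterior_pos (hL : L ≤ Lmax) (hc : 0 < c) (T : CartTree L) :
    0 < posterior (sampleSize Lmax) c Y T :=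
  div_pos (treeWeight_pos Y hL hc T) (sum_treeWeight_pos Y hL hc)

lemma sum_posterior (hL : L ≤ Lmax) (hc : 0 < c) :
    ∑ T : CartTree L, posterior (sampleSize Lmax) c Y T = 1 := by
  simp only [posterior]
  rw [← Finset.sum_div, div_self (sum_treeWeight_pos Y hL hc).ne']

lemma posterior_eq_mul_prod (hL : L ≤ Lmax) {T T' : CartTree L} (h : T ≤ T') :
    posterior (sampleSize Lmax) c Y T' = posterior (sampleSize Lmax) c Y T *
      ∏ v ∈ T'.1 \ T.1, nodeWeight (sampleSize Lmax) c Y (some v) := by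
  simp only [posterior, treePrior_mul_marginalLikelihood hL]
  have hsub : T.int ⊆ T'.int := by
    rintro (_ | v) hv
    · simp [CartTree.int]
    · exact Finset.some_mem_insertNone.2 (h (Finset.some_mem_insertNone.1 hv))
  have hd : T'.int \ T.int = (T'.1 \ T.1).image some := by
    ext (_ | v) <;> simp [CartTree.int]
  rw [← Finset.prod_sdiff hsub, hd, Finset.prod_image fun _ _ _ _ h => Option.some_injective _ h]
  ring

end

/-! ### The noise event -/

instance (n : ℕ) : IsProbabilityMeasure (noiseLaw n) := by
  unfold noiseLaw
  infer_instance

lemma hasSubgaussianMGF_mul_gaussianReal (a : ℝ) :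
    HasSubgaussianMGF (fun x => a * x) (a ^ 2).toNNReal (gaussianReal 0 1) where
  integrable_exp_mul t := by
    have := integrable_exp_mul_gaussianReal (μ := 0) (v := 1) (t * a)
    simpa only [mul_assoc] using this
  mgf_le t := by
    have h : mgf (fun x => a * x) (gaussianReal 0 1) t = mgf id (gaussianReal 0 1) (a * t) :=
      mgf_const_mul (X := id) a
    rw [h, mgf_id_gaussianReal, Real.coe_toNNReal _ (sq_nonneg a)]
    simp [mul_pow]

lemma hasSubgaussianMGF_sum_noise {n : ℕ} (a : Fin n → ℝ) :
    HasSubgaussianMGF (fun ω : Fin n → ℝ => ∑ i, a i * ω i)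
      (∑ i, (a i ^ 2).toNNReal) (noiseLaw n) := by
  refine HasSubgaussianMGF.sum_of_iIndepFun (X := fun i (ω : Fin n → ℝ) => a i * ω i) ?_
    fun i _ => ?_
  · exact iIndepFun_pi (X := fun i x => a i * x) fun i => by fun_prop
  · refine HasSubgaussianMGF.of_map (Y := fun ω : Fin n → ℝ => ω i) (X := fun x => a i * x)
      (measurable_pi_apply i).aemeasurable ?_
    rw [noiseLaw, (measurePreserving_eval (fun _ : Fin n => gaussianReal 0 1) i).map_eq]
    exact hasSubgaussianMGF_mul_gaussianReal (a i)

lemma noiseLaw_abs_sum_gt {n : ℕ} (a : Fin n → ℝ) {σ t : ℝ} (hσ : ∑ i, a i ^ 2 = σ)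
    (ht : 0 ≤ t) :
    (noiseLaw n).real {ω | t < |∑ i, a i * ω i|} ≤ 2 * Real.exp (-t ^ 2 / (2 * σ)) := by
  have hc : ((∑ i, (a i ^ 2).toNNReal : NNReal) : ℝ) = σ := by
    rw [← hσ, NNReal.coe_sum]
    exact Finset.sum_congr rfl fun i _ => Real.coe_toNNReal _ (sq_nonneg _)
  have h := hasSubgaussianMGF_sum_noise a
  have h₁ := h.measure_ge_le ht
  have h₂ := h.neg.measure_ge_le ht
  rw [hc] at h₁ h₂
  have hsub : {ω : Fin n → ℝ | t < |∑ i, a i * ω i|} ⊆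
      {ω | t ≤ ∑ i, a i * ω i} ∪ {ω | t ≤ (-fun ω : Fin n → ℝ => ∑ i, a i * ω i) ω} := by
    intro ω hω
    rcases lt_abs.1 (Set.mem_ofPred_eq ▸ hω) with h | h
    · exact Or.inl h.le
    · exact Or.inr h.le
  calc _ ≤ _ := measureReal_mono hsub
    _ ≤ _ := measureReal_union_le _ _
    _ ≤ _ := by linarith

/-- The event that no coefficient of the noise is large. -/
def noiseEvent (n L : ℕ) : Set (Fin n → ℝ) :=
  {ω | ∀ v ∈ fullIndices L, |haarCoef n ω v| ≤ √(2 * n * Real.log (n ^ 2 / 4))}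

lemma measurableSet_noiseEvent (n L : ℕ) : MeasurableSet (noiseEvent n L) := by
  have : noiseEvent n L = ⋂ v ∈ fullIndices L,
      {ω | |haarCoef n ω v| ≤ √(2 * n * Real.log (n ^ 2 / 4))} := by
    ext ω
    simp [noiseEvent]
  rw [this]
  refine Finset.measurableSet_biInter _ fun v _ => ?_
  refine measurableSet_le ?_ measurable_const
  unfold haarCoef
  fun_prop

lemma card_fullIndices (L : ℕ) : (fullIndices L).card = 2 ^ L := by
  rw [fullIndices, Finset.card_insertNone, card_fullNodes]

lemma two_pow_le_sampleSize {Lmax : ℕ} (hL : L ≤ Lmax) : 2 ^ (L + 1) ≤ sampleSize Lmax :=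
  Nat.pow_le_pow_right (by norm_num) (by omega)

lemma noiseLaw_noiseEvent {Lmax n : ℕ} (hL : L ≤ Lmax) (hn : n = sampleSize Lmax) :
    1 - 4 / (n : ℝ) ≤ (noiseLaw n).real (noiseEvent n L) := by
  have hn1 : 2 ≤ n := hn ▸ one_lt_sampleSize Lmax
  have hn2 : (2 : ℝ) ≤ n := by exact_mod_cast hn1
  have hpow : (2 : ℝ) ^ L ≤ n / 2 := by
    have h : (2 : ℝ) ^ (L + 1) ≤ n := by
      rw [hn]
      exact_mod_cast two_pow_le_sampleSize hL
    rw [pow_succ] at h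
    linarith
  set t := √(2 * n * Real.log ((n : ℝ) ^ 2 / 4)) with ht
  have hlog : 0 ≤ Real.log ((n : ℝ) ^ 2 / 4) := Real.log_nonneg (by nlinarith)
  have ht2 : t ^ 2 = 2 * n * Real.log ((n : ℝ) ^ 2 / 4) := Real.sq_sqrt (by positivity)
  have hsub : (noiseEvent n L)ᶜ ⊆ ⋃ v ∈ fullIndices L,
      {ω : Fin n → ℝ | t < |∑ i, haar v (designPoint n i) * ω i|} := by
    intro ω hω
    simp only [noiseEvent, Set.mem_compl_iff, Set.mem_ofPred_eq, not_forall, not_le] at hω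
    obtain ⟨v, hv, h⟩ := hω
    exact Set.mem_biUnion hv h
  have hcompl : (noiseLaw n).real (noiseEvent n L)ᶜ ≤ 4 / n := by
    calc _ ≤ _ := measureReal_mono hsub (measure_ne_top _ _)
      _ ≤ ∑ v ∈ fullIndices L,
          (noiseLaw n).real {ω | t < |∑ i, haar v (designPoint n i) * ω i|} :=
        measureReal_biUnion_finset_le _ _
      _ ≤ ∑ _v ∈ fullIndices L, 2 * Real.exp (-t ^ 2 / (2 * n)) := by
          refine Finset.sum_le_sum fun v hv => noiseLaw_abs_sum_gt _ ?_ (Real.sqrt_nonneg _)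
          subst hn
          have := sum_haar_mul_haar hL hv hv
          rw [if_pos rfl] at this
          simp only [sq, this]
      -- Each noise coefficient has variance n, and the threshold is chosen such that each two-sided
      -- tail is bounded by 2 · 4/n². As there are 2^L ≤ n/2 coefficients, the union bound is 4/n.
      _ = 2 ^ L * (2 * (4 / n ^ 2)) := by
          rw [Finset.sum_const, card_fullIndices, nsmul_eq_mul, ht2,
            show -(2 * (n : ℝ) * Real.log ((n : ℝ) ^ 2 / 4)) / (2 * n) =
              -Real.log ((n : ℝ) ^ 2 / 4) by field_simp,
            Real.exp_neg, Real.exp_log (by positivity), inv_div]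
          push_cast
          rfl
      _ ≤ n / 2 * (2 * (4 / n ^ 2)) := by gcongr
      _ = 4 / n := by field_simp
  rw [probReal_compl_eq_one_sub (measurableSet_noiseEvent n L)] at hcompl
  linarith

/-! ### Node weights on the noise event -/

section Weights

variable {n : ℕ} {c : ℝ}

/-- At the noise threshold the exponential is at most n²/4; the prior contributes n^(-c) and the
determinant n^(-1/2). -/
lemma nodeWeight_le_of_small (hn : 2 ≤ n) {Y : Fin n → ℝ} {v : Index}
    (h : |haarCoef n Y v| ≤ √(2 * n * Real.log (n ^ 2 / 4))) :
    nodeWeight n c Y v ≤ (n : ℝ) ^ (-(c - 3 / 2)) / 4 := by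
  have hn' : (2 : ℝ) ≤ n := by exact_mod_cast hn
  have hn0 : (0 : ℝ) < n := by linarith
  have hlog : 0 ≤ Real.log ((n : ℝ) ^ 2 / 4) := Real.log_nonneg (by nlinarith)
  have hsq : haarCoef n Y v ^ 2 ≤ 2 * n * Real.log ((n : ℝ) ^ 2 / 4) := by
    rw [← sq_abs, ← Real.sq_sqrt (show 0 ≤ 2 * n * Real.log ((n : ℝ) ^ 2 / 4) by positivity)]
    exact pow_le_pow_left₀ (abs_nonneg _) h 2
  have hexp : Real.exp (haarCoef n Y v ^ 2 / (2 * (n + 1))) ≤ (n : ℝ) ^ 2 / 4 := by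
    rw [← Real.le_log_iff_exp_le (by positivity), div_le_iff₀ (by positivity)]
    nlinarith
  have hsqrt : (√((n : ℝ) + 1))⁻¹ ≤ (n : ℝ) ^ (-(1 / 2) : ℝ) := by
    rw [Real.rpow_neg hn0.le, ← Real.sqrt_eq_rpow]
    exact inv_anti₀ (Real.sqrt_pos.2 hn0) (Real.sqrt_le_sqrt (by linarith))
  have hp := Real.rpow_pos_of_pos hn0 (-c)
  calc nodeWeight n c Y v ≤ (n : ℝ) ^ (-c) * ((n : ℝ) ^ (-(1 / 2) : ℝ) * ((n : ℝ) ^ 2 / 4)) := by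
        unfold nodeWeight
        gcongr
        nlinarith
    _ = ((n : ℝ) ^ (-c) * (n : ℝ) ^ (-(1 / 2) : ℝ) * (n : ℝ) ^ (2 : ℝ)) / 4 := by
        rw [Real.rpow_two]
        ring
    _ = _ := by
        rw [← Real.rpow_add hn0, ← Real.rpow_add hn0]
        congr 2
        ring

/-- Bounds the cost of any node on a twig, whatever the data: the factors 1 - n^(-c) ≥ 1/2 and
(n+1)^(-1/2) ≥ 1/n cost at most n^(-2). -/
lemma le_nodeWeight (hn : 2 ≤ n) (hc : 1 ≤ c) (Y : Fin n → ℝ) (v : Index) :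
    (n : ℝ) ^ (-(c + 2)) * Real.exp (haarCoef n Y v ^ 2 / (2 * (n + 1))) ≤ nodeWeight n c Y v := by
  have hn' : (2 : ℝ) ≤ n := by exact_mod_cast hn
  have hn0 : (0 : ℝ) < n := by linarith
  have h₁ : (n : ℝ) ^ (-c) ≤ 1 / 2 := by
    calc (n : ℝ) ^ (-c) ≤ (n : ℝ) ^ (-1 : ℝ) :=
          Real.rpow_le_rpow_of_exponent_le (by linarith) (by linarith)
      _ = 1 / n := by rw [Real.rpow_neg_one, one_div]
      _ ≤ 1 / 2 := by gcongr
  have h₂ : 1 / (n : ℝ) ≤ (√((n : ℝ) + 1))⁻¹ := by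
    rw [one_div]
    refine inv_anti₀ (Real.sqrt_pos.2 (by linarith)) ?_
    rw [Real.sqrt_le_left hn0.le]
    nlinarith
  have h₃ : (n : ℝ) ^ (-(c + 2)) ≤ (n : ℝ) ^ (-c) * (1 / 2) * (1 / n) := by
    have : (n : ℝ) ^ (-(c + 2)) = (n : ℝ) ^ (-c) * (1 / n ^ 2) := by
      rw [neg_add, Real.rpow_add hn0, Real.rpow_neg hn0.le 2, Real.rpow_two, one_div]
    rw [this, mul_assoc]
    refine mul_le_mul_of_nonneg_left ?_ (Real.rpow_pos_of_pos hn0 _).le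
    rw [one_div_mul_one_div]
    exact one_div_le_one_div_of_le (by positivity) (by nlinarith)
  have hp := Real.rpow_pos_of_pos hn0 (-c)
  unfold nodeWeight
  rw [← mul_assoc]
  refine mul_le_mul_of_nonneg_right (h₃.trans ?_) (Real.exp_pos _).le
  refine mul_le_mul (mul_le_mul_of_nonneg_left (by linarith) hp.le) h₂ (by positivity) ?_
  exact mul_nonneg hp.le (by linarith)

/-- The noise is at most 2 log n √n, a quarter of the minimal signal A log n √n when A ≥ 8. The
remaining 3/4 suffices since (9/16) n ≥ (n+1)/2 for n ≥ 8. -/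
lemma sq_le_of_signal (hn : 8 ≤ n) {A b z x : ℝ} (hA : 8 ≤ A) (hlog : 1 ≤ Real.log n)
    (hb : A * Real.log n / √n < |b|) (hx : |x| ≤ √(2 * n * Real.log (n ^ 2 / 4)))
    (hz : z = n * b + x) : A ^ 2 * Real.log n ^ 2 / 4 ≤ z ^ 2 / (2 * (n + 1)) := by
  have hn' : (8 : ℝ) ≤ n := by exact_mod_cast hn
  have hn0 : (0 : ℝ) < n := by linarith
  set l := Real.log (n : ℝ) with hl
  have hsn : √(n : ℝ) ^ 2 = n := Real.sq_sqrt hn0.le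
  have hs0 : 0 < √(n : ℝ) := Real.sqrt_pos.2 hn0
  have h₁ : A * l * √n ≤ n * |b| := by
    rw [div_lt_iff₀ hs0] at hb
    calc A * l * √n ≤ |b| * √n * √n := mul_le_mul_of_nonneg_right hb.le hs0.le
      _ = n * |b| := by rw [mul_assoc, ← sq, hsn, mul_comm]
  have h₂ : |x| ≤ 2 * l * √n := by
    refine hx.trans ?_
    rw [Real.sqrt_le_left (by positivity), mul_pow, hsn]
    have h₃ : Real.log ((n : ℝ) ^ 2 / 4) ≤ 2 * l := by
      calc Real.log ((n : ℝ) ^ 2 / 4) ≤ Real.log ((n : ℝ) ^ 2) :=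
            Real.log_le_log (by positivity) (by nlinarith)
        _ = 2 * l := by rw [Real.log_pow, hl]; norm_num
    nlinarith [mul_le_mul_of_nonneg_left h₃ hn0.le, mul_le_mul_of_nonneg_left hlog hn0.le]
  have h₄ : 3 / 4 * A * l * √n ≤ |z| := by
    have h₅ : n * |b| - |x| ≤ |z| := by
      rw [hz]
      have := abs_sub_abs_le_abs_sub (n * b) (-x)
      rwa [abs_neg, abs_mul, abs_of_pos hn0, sub_neg_eq_add] at this
    have h₆ : 2 * l * √n ≤ A / 4 * l * √n := by gcongr; linarith
    linarith
  have h₇ : (3 / 4 * A * l * √n) ^ 2 ≤ z ^ 2 := by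
    rw [← sq_abs z]
    exact pow_le_pow_left₀ (by positivity) h₄ 2
  rw [mul_pow, hsn] at h₇
  rw [le_div_iff₀ (by positivity)]
  refine le_trans ?_ h₇
  have : 0 ≤ A ^ 2 * l ^ 2 := by positivity
  nlinarith

/-- One signal node outweighs a whole twig. The at most L nodes cost n^(-(c+2)L) with L ≤ 2 log n,
because log 2 > 1/2, and A ≥ 4(c+3) makes this less than half of the gain n^((A²/4) log n), on the
scale of exponents. -/
lemma le_prod_nodeWeight (hn : 8 ≤ n) (hLn : 2 ^ (L + 1) ≤ n) (hc : 1 ≤ c) {A : ℝ}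
    (hA : 4 * (c + 3) ≤ A) (hlog : 1 ≤ Real.log n) {Y : Fin n → ℝ} {R : Finset Node}
    (hR : R.card ≤ L) {v : Node} (hv : v ∈ R)
    (hz : A ^ 2 * Real.log n ^ 2 / 4 ≤ haarCoef n Y (some v) ^ 2 / (2 * (n + 1))) :
    (n : ℝ) ^ (A ^ 2 / 8 * Real.log n + 2) ≤ ∏ w ∈ R, nodeWeight n c Y (some w) := by
  have hn0 : (0 : ℝ) < n := by positivity
  have hn1 : (1 : ℝ) ≤ n := by exact_mod_cast (by omega : 1 ≤ n)
  set l := Real.log (n : ℝ) with hl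
  set q := (n : ℝ) ^ (-(c + 2)) with hq
  have hq0 : 0 < q := Real.rpow_pos_of_pos hn0 _
  have hLl : (L : ℝ) ≤ 2 * l := by
    have h₁ : ((L : ℝ) + 1) * Real.log 2 ≤ l := by
      have : Real.log ((2 : ℝ) ^ (L + 1)) ≤ l :=
        Real.log_le_log (by positivity) (by exact_mod_cast hLn)
      rw [Real.log_pow] at this
      exact_mod_cast this
    have h₂ := Real.log_two_gt_d9
    have h₃ : (0 : ℝ) ≤ L := by positivity
    nlinarith
  have hlow : ∀ w, q ≤ nodeWeight n c Y w := fun w => by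
    refine le_trans ?_ (le_nodeWeight (by omega) hc Y w)
    exact le_mul_of_one_le_right hq0.le (Real.one_le_exp (by positivity))
  have hsig : q * (n : ℝ) ^ (A ^ 2 / 4 * l) ≤ nodeWeight n c Y (some v) := by
    refine le_trans (mul_le_mul_of_nonneg_left ?_ hq0.le) (le_nodeWeight (by omega) hc Y _)
    rw [Real.rpow_def_of_pos hn0]
    refine Real.exp_le_exp.2 (le_trans (le_of_eq ?_) hz)
    rw [← hl]
    ring
  calc (n : ℝ) ^ (A ^ 2 / 8 * l + 2) ≤ (n : ℝ) ^ (-(c + 2) * L + A ^ 2 / 4 * l) := by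
        refine Real.rpow_le_rpow_of_exponent_le hn1 ?_
        have hA2 : 16 * (c + 3) ^ 2 ≤ A ^ 2 := by nlinarith
        have h₁ : (c + 2) * L ≤ (c + 2) * (2 * l) := mul_le_mul_of_nonneg_left hLl (by linarith)
        have h₂ : 2 * (c + 3) * l ≤ A ^ 2 / 8 * l :=
          mul_le_mul_of_nonneg_right (by nlinarith) (by linarith)
        linarith
    _ = q ^ L * (n : ℝ) ^ (A ^ 2 / 4 * l) := by
        rw [Real.rpow_add hn0, Real.rpow_mul hn0.le, Real.rpow_natCast]
    _ ≤ q ^ R.card * (n : ℝ) ^ (A ^ 2 / 4 * l) := by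
        refine mul_le_mul_of_nonneg_right ?_ (Real.rpow_pos_of_pos hn0 _).le
        exact pow_le_pow_of_le_one hq0.le
          (Real.rpow_le_one_of_one_le_of_nonpos hn1 (by linarith)) hR
    _ = q ^ (R.erase v).card * (q * (n : ℝ) ^ (A ^ 2 / 4 * l)) := by
        rw [← Finset.card_erase_add_one hv, pow_succ]
        ring
    _ ≤ (∏ w ∈ R.erase v, nodeWeight n c Y (some w)) * nodeWeight n c Y (some v) := by
        refine mul_le_mul ?_ hsig (by positivity) (Finset.prod_nonneg fun w _ =>
          hq0.le.trans (hlow _))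
        rw [← Finset.prod_const]
        exact Finset.prod_le_prod (fun _ _ => hq0.le) fun w _ => hlow _
    _ = _ := Finset.prod_erase_mul _ _ hv

end Weights

/-! ### Drift conditions -/

lemma half_le_one_sub_exp_neg {x : ℝ} (h₀ : 0 ≤ x) (h₁ : x ≤ 1) :
    x / 2 ≤ 1 - Real.exp (-x) := by
  have h₂ := Real.add_one_le_exp x
  have h₃ : Real.exp (-x) ≤ 1 / (x + 1) := by
    rw [Real.exp_neg, ← one_div]
    exact one_div_le_one_div_of_le (by linarith) h₂
  have h₄ : x / 2 ≤ 1 - 1 / (x + 1) := by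
    rw [le_sub_iff_add_le, ← le_sub_iff_add_le', div_le_iff₀ (by linarith)]
    nlinarith
  linarith

lemma exp_sub_one_le_two_mul {x : ℝ} (h₀ : 0 ≤ x) (h₁ : x ≤ 1) : Real.exp x - 1 ≤ 2 * x := by
  have := Real.abs_exp_sub_one_le (x := x) (by rwa [abs_of_nonneg h₀])
  rw [abs_of_nonneg h₀] at this
  exact (le_abs_self _).trans this

/-- A drift bound: the move to `g` decreases `V`, other moves increase it by a factor that is
controlled by `u`. -/
lemma mulVec_div_le {α : Type*} [Fintype α] [DecidableEq α] {P : Matrix α α ℝ}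
    (hP : P ∈ Matrix.rowStochastic ℝ α) {V u : α → ℝ} {x g : α} (hV : 0 < V x)
    (hu : ∀ y, 0 ≤ u y) (hVu : ∀ y, P x y ≠ 0 → V y - V x ≤ u y * V x) {p η : ℝ} (hη : 0 ≤ η)
    (hg : V g ≤ (1 - η) * V x) (hp : p ≤ P x g) :
    (P *ᵥ V) x / V x ≤ 1 - p * η + ∑ y, P x y * u y := by
  have h0 := (Matrix.mem_rowStochastic.1 hP).1
  have hsum : ∑ y, P x y * (V y - V x) ≤ -(p * η) * V x + (∑ y, P x y * u y) * V x := by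
    have hrest : ∑ y ∈ Finset.univ.erase g, P x y * (V y - V x) ≤ ∑ y, P x y * u y * V x := by
      refine (Finset.sum_le_sum fun y _ => ?_).trans (Finset.sum_le_sum_of_subset_of_nonneg
        (Finset.erase_subset g _) fun y _ _ => mul_nonneg (mul_nonneg (h0 x y) (hu y)) hV.le)
      by_cases hy : P x y = 0
      · simp [hy]
      · rw [mul_assoc]
        exact mul_le_mul_of_nonneg_left (hVu y hy) (h0 x y)
    have hgood : P x g * (V g - V x) ≤ -(p * η) * V x := by
      have h₁ : P x g * (V g - V x) ≤ P x g * (-η * V x) :=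
        mul_le_mul_of_nonneg_left (by linarith) (h0 x g)
      have h₂ : p * (η * V x) ≤ P x g * (η * V x) :=
        mul_le_mul_of_nonneg_right hp (mul_nonneg hη hV.le)
      linarith
    rw [← Finset.add_sum_erase _ _ (Finset.mem_univ g), Finset.sum_mul]
    exact add_le_add hgood hrest
  have := mulVec_sub_eq hP V x
  rw [div_le_iff₀ hV]
  linarith

/-- The largest number of nodes that are added or removed in one step. -/
def Sampler.maxTwig : Sampler → ℕ → ℕ
  | .bayesianCART, _ => 1
  | .twiggy _, L => L

lemma Sampler.Step.lt {s : Sampler} {T T' : CartTree L} (h : s.Step T T') : T < T' := by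
  obtain ⟨e, v, h, -⟩ := h
  exact h.lt

lemma Sampler.Step.card_le {s : Sampler} {T T' : CartTree L} (h : s.Step T T') :
    (T'.1 \ T.1).card ≤ s.maxTwig L := by
  obtain ⟨e, v, h, he⟩ := h
  cases s with
  | bayesianCART =>
    obtain rfl := he rfl
    rw [h.sdiff_eq, twig_self, Finset.card_singleton]
    rfl
  | twiggy D => exact h.card_sdiff_le

lemma Sampler.Step.card_le' {s : Sampler} {T T' : CartTree L} (h : s.Step T T') :
    (T'.1 \ T.1).card ≤ L := by
  obtain ⟨e, v, h, he⟩ := h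
  exact h.card_sdiff_le

/-- A node of the signal is internal in `T` but not in `T'`. -/
def Loses (B : Finset Index) (T T' : CartTree L) : Prop := ∃ v ∈ T.1, v ∉ T'.1 ∧ some v ∈ B

/-- The properties of the posterior on the noise event: `π` is a distribution on trees that changes
by the factor `ρ v` when `v` is made internal; these factors are small outside the signal, and the
product over a twig that meets the signal is huge. -/
structure Concentrated (s : Sampler) (n : ℕ) (c A : ℝ) (B : Finset Index) (Ts : CartTree L)
    (π : CartTree L → ℝ) (ρ : Node → ℝ) : Prop where
  valid : s.Valid
  two_pow_le : 2 ^ (L + 1) ≤ n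
  three_le : 3 ≤ c
  delta_ge : 1 ≤ 4 * (n : ℝ) ^ (c - 3 / 2) * s.delta L
  pos : ∀ T, 0 < π T
  sum_eq : ∑ T, π T = 1
  factor_pos : ∀ v, 0 < ρ v
  factor : ∀ T T', T ≤ T' → π T' = π T * ∏ v ∈ T'.1 \ T.1, ρ v
  factor_le : ∀ v ∈ fullNodes L, some v ∉ B → ρ v ≤ (n : ℝ) ^ (-(c - 3 / 2)) / 4
  le_prod : ∀ R ⊆ fullNodes L, R.card ≤ L → (∃ v ∈ R, some v ∈ B) →
    (n : ℝ) ^ (A ^ 2 / 8 * Real.log n + 2) ≤ ∏ v ∈ R, ρ v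
  subset : B ⊆ fullIndices L
  isLeast : IsLeast {T : CartTree L | B ⊆ T.int} Ts
  connected : s = Sampler.bayesianCART → Ts.int = insert none B

namespace Concentrated

variable {s : Sampler} {n : ℕ} {c A : ℝ} {B : Finset Index} {Ts : CartTree L}
  {π : CartTree L → ℝ} {ρ : Node → ℝ}

/-- Leastness of `Ts` reduces everything to signal nodes; in particular, leaving the set of trees
above `Ts` always means losing one of them. -/
lemma le_iff (h : Concentrated s n c A B Ts π ρ) {T : CartTree L} :
    Ts ≤ T ↔ ∀ v, some v ∈ B → v ∈ T.1 := by
  constructor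
  · intro hT v hv
    have := h.isLeast.1 hv
    exact hT (Finset.some_mem_insertNone.1 this)
  · intro hT
    refine h.isLeast.2 ?_
    rintro (_ | v) hv
    · simp [CartTree.int]
    · exact Finset.some_mem_insertNone.2 (hT v hv)

lemma loses_of_not_le (h : Concentrated s n c A B Ts π ρ) {T T' : CartTree L} (hT : Ts ≤ T)
    (hT' : ¬ Ts ≤ T') : Loses B T T' := by
  rw [h.le_iff] at hT hT'
  push Not at hT'
  obtain ⟨v, hv, hv'⟩ := hT'
  exact ⟨v, hT v hv, hv', hv⟩

lemma one_lt (h : Concentrated s n c A B Ts π ρ) : (1 : ℝ) < n := by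
  have h₁ := h.two_pow_le
  have h₂ : 1 < 2 ^ (L + 1) := Nat.one_lt_two_pow (by omega)
  exact_mod_cast h₂.trans_le h₁

lemma two_pow_le_half (h : Concentrated s n c A B Ts π ρ) : (2 : ℝ) ^ L ≤ n / 2 := by
  have : (2 : ℝ) ^ (L + 1) ≤ n := by exact_mod_cast h.two_pow_le
  rw [pow_succ] at this
  linarith

lemma mem_rowStochastic (h : Concentrated s n c A B Ts π ρ) :
    metropolisHastings s.proposal π ∈ Matrix.rowStochastic ℝ (CartTree L) :=
  metropolisHastings_mem_rowStochastic (s.proposal_nonneg h.valid) (s.sum_proposal_le h.valid)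
    h.pos

lemma step_of_ne_zero (h : Concentrated s n c A B Ts π ρ) {T T' : CartTree L} (hne : T' ≠ T)
    (h0 : metropolisHastings s.proposal π T T' ≠ 0) : s.Step T T' ∨ s.Step T' T := by
  refine Sampler.step_of_proposal_ne_zero fun hS => h0 ?_
  rw [metropolisHastings_of_ne (s.proposal_nonneg h.valid) h.pos hne, hS, min_eq_left]
  exact mul_nonneg (div_nonneg (h.pos _).le (h.pos _).le) (s.proposal_nonneg h.valid _ _)

lemma apply_le_ratio (h : Concentrated s n c A B Ts π ρ) {T T' : CartTree L} (hne : T' ≠ T) :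
    metropolisHastings s.proposal π T T' ≤ π T' / π T := by
  rw [metropolisHastings_of_ne (s.proposal_nonneg h.valid) h.pos hne]
  exact (min_le_right _ _).trans (mul_le_of_le_one_right (div_nonneg (h.pos _).le (h.pos _).le)
    (s.proposal_le_one h.valid _ _))

open Classical in
-- A signal node is lost only by pruning a twig that contains it. The acceptance ratio is then the
-- inverse of a huge product, and at most 2^L trees can be reached by pruning.
lemma sum_loses_le (h : Concentrated s n c A B Ts π ρ) (T : CartTree L) :
    ∑ T', metropolisHastings s.proposal π T T' * (if Loses B T T' then 1 else 0) ≤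
      (n : ℝ) ^ (1 - A ^ 2 * Real.log n / 8) / 2 := by
  have hn0 : (0 : ℝ) < n := by linarith [h.one_lt]
  set q := ((n : ℝ) ^ (A ^ 2 / 8 * Real.log n + 2))⁻¹ with hq
  have hq0 : 0 < q := inv_pos.2 (Real.rpow_pos_of_pos hn0 _)
  calc _ ≤ ∑ T', (if s.Step T' T then q else 0) := by
        refine Finset.sum_le_sum fun T' _ => ?_
        by_cases hl : Loses B T T'
        · rw [if_pos hl, mul_one]
          obtain ⟨v, hv, hv', hvB⟩ := hl
          have hne : T' ≠ T := by
            rintro rfl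
            exact hv' hv
          by_cases h0 : metropolisHastings s.proposal π T T' = 0
          · rw [h0]
            split_ifs
            · exact hq0.le
            · exact le_rfl
          · rcases h.step_of_ne_zero hne h0 with hs | hs
            · exact absurd (hs.lt.le hv) hv'
            · rw [if_pos hs]
              refine (h.apply_le_ratio hne).trans ?_
              have hprod := h.le_prod (T.1 \ T'.1) (Finset.sdiff_subset.trans T.subset_full)
                hs.card_le' ⟨v, Finset.mem_sdiff.2 ⟨hv, hv'⟩, hvB⟩
              rw [h.factor _ _ hs.lt.le, div_mul_cancel_left₀ (h.pos T').ne']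
              exact inv_anti₀ (Real.rpow_pos_of_pos hn0 _) hprod
        · rw [if_neg hl, mul_zero]
          split_ifs
          · exact hq0.le
          · exact le_rfl
    _ = (Finset.univ.filter fun T' => s.Step T' T).card * q := by
        rw [← Finset.sum_filter, Finset.sum_const, nsmul_eq_mul]
    _ ≤ 2 ^ L * q := by
        refine mul_le_mul_of_nonneg_right ?_ hq0.le
        exact_mod_cast card_step_down_le s T
    _ ≤ n / 2 * q := mul_le_mul_of_nonneg_right h.two_pow_le_half hq0.le
    _ = (n : ℝ) ^ (1 + -(A ^ 2 / 8 * Real.log n + 2)) / 2 := by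
        rw [Real.rpow_add hn0, Real.rpow_one, Real.rpow_neg hn0.le, hq]
        ring
    _ ≤ _ := by
        have := Real.rpow_le_rpow_of_exponent_le h.one_lt.le
          (show 1 + -(A ^ 2 / 8 * Real.log n + 2) ≤ 1 - A ^ 2 * Real.log n / 8 by linarith)
        linarith

lemma small_factor_le_one (h : Concentrated s n c A B Ts π ρ) :
    (n : ℝ) ^ (-(c - 3 / 2)) / 4 ≤ 1 := by
  have := Real.rpow_le_one_of_one_le_of_nonpos h.one_lt.le
    (show -(c - 3 / 2) ≤ 0 by linarith [h.three_le])
  linarith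

open Classical in
-- Above `Ts` every added node is outside the signal, so each added factor is at most 1 and a single
-- one already bounds the acceptance ratio by n^(-(c-3/2))/4.
lemma sum_step_le (h : Concentrated s n c A B Ts π ρ) {T : CartTree L} (hT : Ts ≤ T) :
    ∑ T', metropolisHastings s.proposal π T T' * (if s.Step T T' then 1 else 0) ≤
      2 ^ L * ((n : ℝ) ^ (-(c - 3 / 2)) / 4) := by
  have hn0 : (0 : ℝ) < n := by linarith [h.one_lt]
  set q := (n : ℝ) ^ (-(c - 3 / 2)) / 4 with hq
  have hq0 : 0 < q := div_pos (Real.rpow_pos_of_pos hn0 _) (by norm_num)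
  calc _ ≤ ∑ T', (if s.Step T T' then q else 0) := by
        refine Finset.sum_le_sum fun T' _ => ?_
        by_cases hs : s.Step T T'
        · rw [if_pos hs, if_pos hs, mul_one]
          refine (h.apply_le_ratio hs.lt.ne').trans ?_
          rw [h.factor _ _ hs.lt.le, mul_div_cancel_left₀ _ (h.pos T).ne']
          have hle : ∀ v ∈ T'.1 \ T.1, ρ v ≤ q := fun v hv => by
            rw [Finset.mem_sdiff] at hv
            exact h.factor_le v (T'.subset_full hv.1) fun hvB => hv.2 (h.le_iff.1 hT v hvB)
          obtain ⟨v, hv⟩ : (T'.1 \ T.1).Nonempty := by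
            rw [Finset.sdiff_nonempty]
            exact hs.lt.not_ge
          rw [← Finset.mul_prod_erase _ _ hv]
          refine (mul_le_of_le_one_right (h.factor_pos v).le ?_).trans (hle v hv)
          exact Finset.prod_le_one (fun w _ => (h.factor_pos w).le) fun w hw =>
            (hle w (Finset.mem_of_mem_erase hw)).trans h.small_factor_le_one
        · rw [if_neg hs, if_neg hs, mul_zero]
    _ = (Finset.univ.filter (s.Step T)).card * q := by
        rw [← Finset.sum_filter, Finset.sum_const, nsmul_eq_mul]
    _ ≤ 2 ^ L * q := by
        refine mul_le_mul_of_nonneg_right ?_ hq0.le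
        exact_mod_cast card_step_up_le s T

lemma delta_pos (h : Concentrated s n c A B Ts π ρ) : 0 < s.delta L := by
  have hn0 : (0 : ℝ) < n := by linarith [h.one_lt]
  have hp : 0 < 4 * (n : ℝ) ^ (c - 3 / 2) := by
    have := Real.rpow_pos_of_pos hn0 (c - 3 / 2)
    linarith
  exact (mul_pos_iff_of_pos_left hp).1 (by linarith [h.delta_ge])

/-- A tree that misses a part of the signal can grow towards the signal. -/
lemma exists_grow (h : Concentrated s n c A B Ts π ρ) {T : CartTree L} (hT : ¬ Ts ≤ T) :
    ∃ (T' : CartTree L) (v : Node), some v ∈ B ∧ v ∉ T.1 ∧ v ∈ T'.1 ∧ T ≤ T' ∧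
      s.delta L / 2 ^ (L + 1) ≤ metropolisHastings s.proposal π T T' := by
  obtain ⟨T', v, hvB, hvT, hvT', hs⟩ : ∃ (T' : CartTree L) (v : Node),
      some v ∈ B ∧ v ∉ T.1 ∧ v ∈ T'.1 ∧ s.Step T T' := by
    rw [h.le_iff] at hT
    push Not at hT
    obtain ⟨v, hvB, hvT⟩ := hT
    have hfull : v ∈ fullNodes L := Finset.some_mem_insertNone.1 (h.subset hvB)
    obtain ⟨e, he, hev⟩ := T.exists_ext hfull hvT
    -- Bayesian CART can only add the external node `e` above the missing signal node; by
    -- connectedness `e`, being in `Ts`, is itself a signal node. The Twiggy sampler attaches the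
    -- whole path down to `v`.
    by_cases hs : s = .bayesianCART
    · have heB : some e ∈ B := by
        have h₁ : v ∈ Ts.1 := Finset.some_mem_insertNone.1 (h.isLeast.1 hvB)
        have h₂ : some e ∈ Ts.int := Finset.some_mem_insertNone.2 (Ts.closed h₁ hev)
        rw [h.connected hs] at h₂
        simpa using h₂
      obtain ⟨T', hT'⟩ := exists_isGrowth T he (hev.mem_fullNodes hfull) (IsAnc.refl e)
      exact ⟨T', e, heB, hT'.not_mem hT'.anc, hT'.mem_top, e, e, hT', fun _ => rfl⟩
    · obtain ⟨T', hT'⟩ := exists_isGrowth T he hfull hev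
      exact ⟨T', v, hvB, hvT, hT'.mem_top, e, v, hT', fun h => absurd h hs⟩
  refine ⟨T', v, hvB, hvT, hvT', hs.lt.le, ?_⟩
  rw [metropolisHastings_of_ne (s.proposal_nonneg h.valid) h.pos hs.lt.ne']
  -- The posterior ratio is at least n ≥ 2^(L+1), which compensates for the reverse proposal
  -- probability of at least 2^(-(L+1)); so the move is always accepted.
  refine (s.delta_le_proposal h.valid hs).trans (le_min le_rfl ?_)
  refine (s.proposal_le_one h.valid _ _).trans ?_
  have hn0 : (0 : ℝ) < n := by linarith [h.one_lt]
  have hprod := h.le_prod (T'.1 \ T.1) (Finset.sdiff_subset.trans T'.subset_full) hs.card_le'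
    ⟨v, Finset.mem_sdiff.2 ⟨hvT', hvT⟩, hvB⟩
  have hprop := s.inv_le_proposal h.valid hs
  rw [h.factor _ _ hs.lt.le, mul_div_cancel_left₀ _ (h.pos T).ne']
  have h2 : (n : ℝ) ≤ ∏ v ∈ T'.1 \ T.1, ρ v := by
    refine le_trans ?_ hprod
    have hlog := Real.log_pos h.one_lt
    have := Real.rpow_le_rpow_of_exponent_le h.one_lt.le
      (show 1 ≤ A ^ 2 / 8 * Real.log n + 2 by
        have : 0 ≤ A ^ 2 / 8 * Real.log n := by positivity
        linarith)
    rwa [Real.rpow_one] at this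
  calc (1 : ℝ) ≤ n * (1 / 2 ^ (L + 1)) := by
        rw [mul_one_div, le_div_iff₀ (by positivity), one_mul]
        exact_mod_cast h.two_pow_le
    _ ≤ _ := mul_le_mul h2 hprop (by positivity) (by linarith)

/-- A tree that contains superfluous nodes can be pruned. -/
lemma exists_prune (h : Concentrated s n c A B Ts π ρ) {T : CartTree L} (hT : Ts < T) :
    ∃ (T' : CartTree L) (v : Node), v ∉ T'.1 ∧ T.1 = insert v T'.1 ∧ Ts ≤ T' ∧
      1 / 2 ^ (L + 1) ≤ metropolisHastings s.proposal π T T' := by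
  obtain ⟨T', v, hTs, hv, hg⟩ := exists_isGrowth_of_lt hT
  have hs : s.Step T' T := ⟨v, v, hg, fun _ => rfl⟩
  refine ⟨T', v, hg.not_mem (IsAnc.refl v), ?_, hTs, ?_⟩
  · rw [hg.eq, twig_self, Finset.union_comm, Finset.insert_eq]
  rw [metropolisHastings_of_ne (s.proposal_nonneg h.valid) h.pos hs.lt.ne]
  -- The reverse GROW proposal may be as small as `delta` / 2^(L+1). The gain 1/ρ(v) ≥ 4 n^(c-3/2)
  -- makes up for it by `delta_ge`.
  refine le_min (s.inv_le_proposal h.valid hs) ?_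
  have hn0 : (0 : ℝ) < n := by linarith [h.one_lt]
  have hvB : some v ∉ B := fun hvB => hv (h.le_iff.1 le_rfl v hvB)
  have hρ := h.factor_le v hg.full hvB
  have hprop := s.delta_le_proposal h.valid hs
  rw [h.factor _ _ hs.lt.le, div_mul_cancel_left₀ (h.pos T').ne', hg.sdiff_eq, twig_self,
    Finset.prod_singleton]
  have hinv : 4 * (n : ℝ) ^ (c - 3 / 2) ≤ (ρ v)⁻¹ := by
    have := inv_anti₀ (h.factor_pos v) hρ
    rwa [Real.rpow_neg hn0.le, inv_div, div_inv_eq_mul] at this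
  calc (1 : ℝ) / 2 ^ (L + 1) ≤ 4 * (n : ℝ) ^ (c - 3 / 2) * s.delta L / 2 ^ (L + 1) := by
        gcongr
        exact h.delta_ge
    _ = 4 * (n : ℝ) ^ (c - 3 / 2) * (s.delta L / 2 ^ (L + 1)) := by ring
    _ ≤ _ := mul_le_mul hinv hprop (div_nonneg h.delta_pos.le (by positivity))
        (inv_nonneg.2 (h.factor_pos v).le)

/-! #### The drift towards the signal -/

end Concentrated

/-- The first drift function in terms of the coefficients. -/
noncomputable def missingEnergy (κ : ℝ) (B : Finset Index) (β : Index → ℝ) (T : CartTree L) : ℝ :=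
  Real.exp (κ * ∑ v ∈ B \ T.int, β v ^ 2)

section

variable {B : Finset Index} {β : Index → ℝ} {C : ℝ}

/-- The normalization by 2^L C² keeps the exponent of V₁ in [0,1], so that V₁ takes values in [1, e]
and exponentials can be linearized. -/
lemma missing_le_one (hB : B ⊆ fullIndices L) (hC : 0 < C) (hβ : ∀ v ∈ B, |β v| < C)
    {S : Finset Index} (hS : S ⊆ B) :
    1 / (2 ^ L * C ^ 2) * ∑ v ∈ S, β v ^ 2 ≤ 1 := by
  have h₁ : ∑ v ∈ S, β v ^ 2 ≤ 2 ^ L * C ^ 2 := by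
    calc ∑ v ∈ S, β v ^ 2 ≤ ∑ _v ∈ S, C ^ 2 := Finset.sum_le_sum fun v hv => by
          rw [← sq_abs]
          exact pow_le_pow_left₀ (abs_nonneg _) (hβ v (hS hv)).le 2
      _ = S.card * C ^ 2 := by rw [Finset.sum_const, nsmul_eq_mul]
      _ ≤ 2 ^ L * C ^ 2 := by
          refine mul_le_mul_of_nonneg_right ?_ (by positivity)
          have := Finset.card_le_card (hS.trans hB)
          rw [card_fullIndices] at this
          exact_mod_cast this
  rw [one_div_mul_eq_div, div_le_one (by positivity)]
  exact h₁

lemma one_le_missingEnergy (T : CartTree L) : 1 ≤ missingEnergy (1 / (2 ^ L * C ^ 2)) B β T :=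
  Real.one_le_exp (by positivity)

lemma missingEnergy_le (hB : B ⊆ fullIndices L) (hC : 0 < C) (hβ : ∀ v ∈ B, |β v| < C)
    (T : CartTree L) : missingEnergy (1 / (2 ^ L * C ^ 2)) B β T ≤ Real.exp 1 :=
  Real.exp_le_exp.2 (missing_le_one hB hC hβ Finset.sdiff_subset)

lemma missingEnergy_le_of_not_loses {T T' : CartTree L} (h : ¬ Loses B T T') :
    missingEnergy (1 / (2 ^ L * C ^ 2)) B β T' ≤ missingEnergy (1 / (2 ^ L * C ^ 2)) B β T := by
  refine Real.exp_le_exp.2 (mul_le_mul_of_nonneg_left ?_ (by positivity))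
  refine Finset.sum_le_sum_of_subset_of_nonneg ?_ fun _ _ _ => sq_nonneg _
  rintro (_ | v) hv
  · simp [CartTree.int] at hv
  · rw [Finset.mem_sdiff] at hv ⊢
    refine ⟨hv.1, fun hvT => hv.2 (Finset.some_mem_insertNone.2 ?_)⟩
    by_contra hvT'
    exact h ⟨v, Finset.some_mem_insertNone.1 hvT, hvT', hv.1⟩

end

namespace Concentrated

variable {s : Sampler} {n : ℕ} {c A : ℝ} {B : Finset Index} {Ts : CartTree L}
  {π : CartTree L → ℝ} {ρ : Node → ℝ}

lemma mulVec_missingEnergy_le (h : Concentrated s n c A B Ts π ρ) {β : Index → ℝ} {C : ℝ}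
    (hC : 0 < C) (hA : 0 < A) (hβ : ∀ v ∈ B, A * Real.log n / √n < |β v| ∧ |β v| < C)
    {T : CartTree L} (hT : ¬ Ts ≤ T) :
    (metropolisHastings s.proposal π *ᵥ missingEnergy (1 / (2 ^ L * C ^ 2)) B β) T /
        missingEnergy (1 / (2 ^ L * C ^ 2)) B β T ≤
      1 - s.delta L * A ^ 2 * Real.log n ^ 2 / (2 ^ (2 * L + 2) * C ^ 2 * n) +
        (Real.exp 1 - 1) * ((n : ℝ) ^ (1 - A ^ 2 * Real.log n / 8) / 2) := by
  classical
  have hn0 : (0 : ℝ) < n := by linarith [h.one_lt]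
  have hlog := Real.log_pos h.one_lt
  set V := missingEnergy (1 / (2 ^ L * C ^ 2)) B β with hV
  have hV1 : ∀ T : CartTree L, 1 ≤ V T := one_le_missingEnergy
  have hVe : ∀ T : CartTree L, V T ≤ Real.exp 1 :=
    missingEnergy_le h.subset hC fun v hv => (hβ v hv).2
  have he : 0 ≤ Real.exp 1 - 1 := by linarith [Real.add_one_le_exp 1]
  obtain ⟨g, v, hvB, hvT, hvg, hTg, hp⟩ := h.exists_grow hT
  obtain ⟨hβ₁, hβ₂⟩ := hβ _ hvB
  -- A lower bound for the drop of the exponent when the signal node `v` is picked up. Since x ≤ 1,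
  -- V₁ decreases by a fraction of at least x/2. A loss of signal costs at most the factor e, whence
  -- the e - 1 in the error term.
  set x := A ^ 2 * Real.log n ^ 2 / (2 ^ L * C ^ 2 * n) with hx
  have hx0 : 0 ≤ x := by positivity
  have hβsq : A ^ 2 * Real.log n ^ 2 / n ≤ β (some v) ^ 2 := by
    rw [← sq_abs (β (some v))]
    calc A ^ 2 * Real.log n ^ 2 / n = (A * Real.log n / √n) ^ 2 := by
          rw [div_pow, mul_pow, Real.sq_sqrt hn0.le]
      _ ≤ _ := pow_le_pow_left₀ (by positivity) hβ₁.le 2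
  have hxβ : x ≤ 1 / (2 ^ L * C ^ 2) * β (some v) ^ 2 := by
    calc x = 1 / (2 ^ L * C ^ 2) * (A ^ 2 * Real.log n ^ 2 / n) := by rw [hx]; field_simp
      _ ≤ _ := mul_le_mul_of_nonneg_left hβsq (by positivity)
  have hx1 : x ≤ 1 := by
    have := missing_le_one h.subset hC (fun v hv => (hβ v hv).2)
      (Finset.singleton_subset_iff.2 hvB)
    rw [Finset.sum_singleton] at this
    exact hxβ.trans this
  have hgood : V g ≤ (1 - x / 2) * V T := by
    have h₁ : V g ≤ Real.exp (-x) * V T := by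
      rw [hV, missingEnergy, missingEnergy, ← Real.exp_add]
      refine Real.exp_le_exp.2 ?_
      have hsub : insert (some v) (B \ g.int) ⊆ B \ T.int := by
        refine Finset.insert_subset ?_ (Finset.sdiff_subset_sdiff le_rfl ?_)
        · exact Finset.mem_sdiff.2 ⟨hvB, fun hc => hvT (Finset.some_mem_insertNone.1 hc)⟩
        · rintro (_ | w) hw
          · simp [CartTree.int]
          · exact Finset.some_mem_insertNone.2 (hTg (Finset.some_mem_insertNone.1 hw))
      have hnot : some v ∉ B \ g.int := fun hc =>
        (Finset.mem_sdiff.1 hc).2 (Finset.some_mem_insertNone.2 hvg)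
      have h₂ := Finset.sum_le_sum_of_subset_of_nonneg hsub
        (f := fun v => β v ^ 2) fun _ _ _ => sq_nonneg _
      rw [Finset.sum_insert hnot] at h₂
      have h₃ := mul_le_mul_of_nonneg_left h₂ (show 0 ≤ 1 / (2 ^ L * C ^ 2) by positivity)
      rw [mul_add] at h₃
      linarith
    have h₂ := half_le_one_sub_exp_neg hx0 hx1
    exact h₁.trans (mul_le_mul_of_nonneg_right (by linarith) (by linarith [hV1 T]))
  have := mulVec_div_le h.mem_rowStochastic (V := V)
    (u := fun T' => (if Loses B T T' then 1 else 0) * (Real.exp 1 - 1)) (x := T) (g := g)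
    (by linarith [hV1 T]) (fun T' => mul_nonneg (by split_ifs <;> norm_num) he)
    (fun T' _ => by
      by_cases hl : Loses B T T'
      · rw [if_pos hl]
        nlinarith [hV1 T, hVe T']
      · rw [if_neg hl]
        have := missingEnergy_le_of_not_loses (β := β) (C := C) hl
        linarith) (by positivity) hgood hp
  refine this.trans ?_
  have hloss : ∑ T', metropolisHastings s.proposal π T T' *
      ((if Loses B T T' then 1 else 0) * (Real.exp 1 - 1)) ≤
        (Real.exp 1 - 1) * ((n : ℝ) ^ (1 - A ^ 2 * Real.log n / 8) / 2) := by
    simp_rw [← mul_assoc]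
    rw [← Finset.sum_mul, mul_comm]
    exact mul_le_mul_of_nonneg_left (h.sum_loses_le T) he
  have hgain : s.delta L / 2 ^ (L + 1) * (x / 2) =
      s.delta L * A ^ 2 * Real.log n ^ 2 / (2 ^ (2 * L + 2) * C ^ 2 * n) := by
    rw [hx, show 2 * L + 2 = (L + 1) + L + 1 by ring, pow_succ _ (L + 1 + L), pow_add _ (L + 1)]
    field_simp
  rw [hgain]
  linarith

/-! #### The drift towards the smallest tree that contains the signal -/

lemma card_int_sdiff (T T' : CartTree L) : (T.int \ T'.int).card = (T.1 \ T'.1).card := by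
  have : T.int \ T'.int = (T.1 \ T'.1).map Function.Embedding.some := by
    ext (_ | v) <;> simp [CartTree.int]
  rw [this, Finset.card_map]

lemma card_int_union_le (T T' : CartTree L) : ((T.int ∪ T'.int).card : ℝ) ≤ 2 ^ L := by
  have := Finset.card_le_card (Finset.union_subset T.int_subset T'.int_subset)
  rw [card_fullIndices] at this
  exact_mod_cast this

lemma drift₂_of_le {T : CartTree L} (hT : Ts ≤ T) :
    drift₂ Ts T = Real.exp (1 / 2 ^ L * ((T.1 \ Ts.1).card : ℝ)) := by
  have h : (Ts.1 \ T.1).card = 0 := by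
    rw [Finset.card_eq_zero, Finset.sdiff_eq_empty_iff_subset]
    exact hT
  rw [drift₂, card_int_sdiff, card_int_sdiff, h]
  simp

lemma one_le_drift₂ (T : CartTree L) : 1 ≤ drift₂ Ts T := by
  have := sub_nonneg.2 (card_int_union_le T Ts)
  exact Real.one_le_exp (by positivity)

lemma drift₂_le (T : CartTree L) : drift₂ Ts T ≤ Real.exp 1 := by
  refine Real.exp_le_exp.2 ?_
  have h₁ : ((T.int \ Ts.int).card : ℝ) ≤ (T.int ∪ Ts.int).card := by
    exact_mod_cast Finset.card_le_card (Finset.sdiff_subset.trans Finset.subset_union_left)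
  have h₂ := card_int_union_le T Ts
  have h₃ : ((min (Ts.int \ T.int).card 1 : ℕ) : ℝ) ≤ 1 := by exact_mod_cast min_le_right _ _
  have h₄ := mul_le_mul_of_nonneg_right h₃ (sub_nonneg.2 h₂)
  rw [one_div_mul_eq_div, div_le_one (by positivity)]
  linarith

lemma mulVec_drift₂_le (h : Concentrated s n c A B Ts π ρ) {T : CartTree L} (hT : Ts < T) :
    (metropolisHastings s.proposal π *ᵥ drift₂ Ts) T / drift₂ Ts T ≤
      1 - 1 / 2 ^ (2 * L + 2) + s.bigM L / (n : ℝ) ^ (c - 3 / 2) +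
        (n : ℝ) ^ (1 - A ^ 2 * Real.log n / 8) := by
  classical
  have hn0 : (0 : ℝ) < n := by linarith [h.one_lt]
  have h2L : (0 : ℝ) < 2 ^ L := by positivity
  set V := drift₂ Ts with hV
  have hV1 : ∀ T : CartTree L, 1 ≤ V T := one_le_drift₂
  have hVe : ∀ T : CartTree L, V T ≤ Real.exp 1 := drift₂_le
  have he : 0 ≤ Real.exp 1 - 1 := by linarith [Real.add_one_le_exp 1]
  have he' : Real.exp 1 - 1 ≤ 2 := by linarith [Real.exp_one_lt_d9]
  obtain ⟨g, v, hvg, hTg, hTsg, hp⟩ := h.exists_prune hT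
  have hgood : V g ≤ (1 - (1 / 2 ^ L) / 2) * V T := by
    have h₁ : V g = Real.exp (-(1 / 2 ^ L)) * V T := by
      have hcard : (T.1 \ Ts.1).card = (g.1 \ Ts.1).card + 1 := by
        have hvTs : v ∉ Ts.1 := fun hc => hvg (hTsg hc)
        rw [hTg, Finset.insert_sdiff_of_notMem _ hvTs, Finset.card_insert_of_notMem]
        exact fun hc => hvg (Finset.mem_sdiff.1 hc).1
      rw [hV, drift₂_of_le hTsg, drift₂_of_le hT.le, ← Real.exp_add, hcard]
      congr 1
      push_cast
      ring
    have h₂ := half_le_one_sub_exp_neg (x := 1 / 2 ^ L) (by positivity)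
      (by rw [div_le_one h2L]; exact one_le_pow₀ (by norm_num))
    rw [h₁]
    exact mul_le_mul_of_nonneg_right (by linarith) (by linarith [hV1 T])
  have hmono : ∀ {T₁ T₂ : CartTree L}, Ts ≤ T₁ → T₁ ≤ T₂ →
      V T₂ = Real.exp (1 / 2 ^ L * ((T₂.1 \ T₁.1).card : ℝ)) * V T₁ := by
    intro T₁ T₂ h₁ h₂
    rw [hV, drift₂_of_le h₁, drift₂_of_le (h₁.trans h₂), ← Real.exp_add]
    have : (T₂.1 \ Ts.1).card = (T₂.1 \ T₁.1).card + (T₁.1 \ Ts.1).card := by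
      have h₁' : Ts.1 ⊆ T₁.1 := h₁
      have h₂' : T₁.1 ⊆ T₂.1 := h₂
      rw [Finset.card_sdiff_of_subset h₁', Finset.card_sdiff_of_subset h₂',
        Finset.card_sdiff_of_subset (h₁'.trans h₂')]
      have := Finset.card_le_card h₁'
      have := Finset.card_le_card h₂'
      omega
    rw [this]
    congr 1
    push_cast
    ring
  -- Adding j nodes multiplies V₂ by exp(j/2^L), and exp(y) - 1 ≤ 2y on [0,1]. The 2^L in the
  -- denominator will cancel the number of possible GROW targets in `sum_step_le`.
  set m : ℝ := 2 * (1 / 2 ^ L * (s.maxTwig L : ℝ)) with hm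
  have hm0 : 0 ≤ m := by positivity
  have hu0 : ∀ T', 0 ≤ (if Loses B T T' then (1 : ℝ) else 0) * (Real.exp 1 - 1) +
      (if s.Step T T' then (1 : ℝ) else 0) * m := fun T' =>
    add_nonneg (mul_nonneg (by split_ifs <;> norm_num) he)
      (mul_nonneg (by split_ifs <;> norm_num) hm0)
  have := mulVec_div_le h.mem_rowStochastic (V := V)
    (u := fun T' => (if Loses B T T' then 1 else 0) * (Real.exp 1 - 1) +
      (if s.Step T T' then 1 else 0) * m) (x := T) (g := g)
    (by linarith [hV1 T]) hu0
    (fun T' h0 => by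
      by_cases hl : Loses B T T'
      · rw [if_pos hl]
        have h₁ : 0 ≤ (if s.Step T T' then (1 : ℝ) else 0) * m :=
          mul_nonneg (by split_ifs <;> norm_num) hm0
        nlinarith [hV1 T, hVe T']
      · have hT' : Ts ≤ T' := by
          by_contra hc
          exact hl (h.loses_of_not_le hT.le hc)
        by_cases hne : T' = T
        · rw [hne]
          have := mul_nonneg (hu0 T) (by linarith [hV1 T] : 0 ≤ V T)
          linarith
        rcases h.step_of_ne_zero hne h0 with hs | hs
        · rw [if_neg hl, if_pos hs, hmono hT.le hs.lt.le]
          have hcard : ((T'.1 \ T.1).card : ℝ) ≤ s.maxTwig L := by exact_mod_cast hs.card_le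
          have hcard' : ((T'.1 \ T.1).card : ℝ) ≤ 2 ^ L := card_real_le Finset.sdiff_subset
          have h₁ := exp_sub_one_le_two_mul (x := 1 / 2 ^ L * ((T'.1 \ T.1).card : ℝ))
            (by positivity) (by rw [one_div_mul_eq_div, div_le_one h2L]; exact hcard')
          have h₂ : 2 * (1 / 2 ^ L * ((T'.1 \ T.1).card : ℝ)) ≤ m := by
            rw [hm]
            gcongr
          have h₃ := mul_le_mul_of_nonneg_right (h₁.trans h₂) (by linarith [hV1 T] : 0 ≤ V T)
          linarith
        · have h₁ : V T' ≤ V T := by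
            rw [hmono hT' hs.lt.le]
            exact le_mul_of_one_le_left (by linarith [hV1 T']) (Real.one_le_exp (by positivity))
          have := mul_nonneg (hu0 T') (by linarith [hV1 T] : 0 ≤ V T)
          linarith) (by positivity) hgood hp
  refine this.trans ?_
  have hsum : ∑ T', metropolisHastings s.proposal π T T' *
      ((if Loses B T T' then 1 else 0) * (Real.exp 1 - 1) + (if s.Step T T' then 1 else 0) * m) =
      (∑ T', metropolisHastings s.proposal π T T' * (if Loses B T T' then 1 else 0)) *
        (Real.exp 1 - 1) +
      (∑ T', metropolisHastings s.proposal π T T' * (if s.Step T T' then 1 else 0)) * m := by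
    rw [Finset.sum_mul, Finset.sum_mul, ← Finset.sum_add_distrib]
    exact Finset.sum_congr rfl fun _ _ => by ring
  rw [hsum]
  have hloss := mul_le_mul (h.sum_loses_le T) he' he (by positivity)
  have hgrow := mul_le_mul_of_nonneg_right (h.sum_step_le hT.le) hm0
  have hM : 2 ^ L * ((n : ℝ) ^ (-(c - 3 / 2)) / 4) * m ≤ s.bigM L / (n : ℝ) ^ (c - 3 / 2) := by
    have hq := Real.rpow_pos_of_pos hn0 (c - 3 / 2)
    have hMle : (s.maxTwig L : ℝ) ≤ 2 * s.bigM L := by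
      cases s with
      | bayesianCART => simp [Sampler.maxTwig, Sampler.bigM]
      | twiggy D =>
        have : (0 : ℝ) ≤ L := by positivity
        simp only [Sampler.maxTwig, Sampler.bigM]
        linarith
    rw [hm, Real.rpow_neg hn0.le]
    calc _ = ((s.maxTwig L : ℝ) / 2) / (n : ℝ) ^ (c - 3 / 2) := by field_simp; norm_num
      _ ≤ _ := by gcongr; linarith
  have hgain : (1 : ℝ) / 2 ^ (L + 1) * (1 / 2 ^ L / 2) = 1 / 2 ^ (2 * L + 2) := by
    rw [show 2 * L + 2 = (L + 1) + L + 1 by ring, pow_succ _ (L + 1 + L), pow_add _ (L + 1)]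
    field_simp
  rw [hgain]
  linarith

end Concentrated

/-! ### The mixing time -/

namespace Concentrated

variable {s : Sampler} {n : ℕ} {c A : ℝ} {B : Finset Index} {Ts : CartTree L}
  {π : CartTree L → ℝ} {ρ : Node → ℝ}

lemma missingEnergy_eq_one (h : Concentrated s n c A B Ts π ρ) {β : Index → ℝ} {κ : ℝ}
    {T : CartTree L} (hT : Ts ≤ T) : missingEnergy κ B β T = 1 := by
  have : B \ T.int = ∅ := by
    rw [Finset.sdiff_eq_empty_iff_subset]
    rintro (_ | v) hv
    · simp [CartTree.int]
    · exact Finset.some_mem_insertNone.2 (h.le_iff.1 hT v hv)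
  simp [missingEnergy, this]

open Classical in
/-- Most of the mass of the trees that contain the signal is on the smallest one. -/
lemma sum_superset_le (h : Concentrated s n c A B Ts π ρ) (hc : 4 ≤ c) :
    ∑ T, (if Ts ≤ T then π T else 0) ≤ 2 * π Ts := by
  have hn0 : (0 : ℝ) < n := by linarith [h.one_lt]
  set q := (n : ℝ) ^ (-(c - 3 / 2)) / 4 with hq
  have hq0 : 0 < q := div_pos (Real.rpow_pos_of_pos hn0 _) (by norm_num)
  have hqn : 2 ^ L * q ≤ 1 / 2 := by
    have h₁ : (n : ℝ) ^ (-(c - 3 / 2)) ≤ (n : ℝ) ^ (-1 : ℝ) :=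
      Real.rpow_le_rpow_of_exponent_le h.one_lt.le (by linarith)
    rw [Real.rpow_neg_one] at h₁
    calc 2 ^ L * q ≤ n / 2 * ((n : ℝ)⁻¹ / 4) :=
          mul_le_mul h.two_pow_le_half (by rw [hq]; linarith) hq0.le (by positivity)
      _ ≤ 1 / 2 := by field_simp; norm_num
  have hle : ∀ v ∈ fullNodes L \ Ts.1, ρ v ≤ q := fun v hv => by
    rw [Finset.mem_sdiff] at hv
    exact h.factor_le v hv.1 fun hvB => hv.2 (h.le_iff.1 le_rfl v hvB)
  calc ∑ T, (if Ts ≤ T then π T else 0)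
      = ∑ T ∈ Finset.univ.filter (Ts ≤ ·), π Ts * ∏ v ∈ T.1 \ Ts.1, ρ v := by
        rw [Finset.sum_filter]
        refine Finset.sum_congr rfl fun T _ => ?_
        split_ifs with hT
        · exact h.factor _ _ hT
        · rfl
    -- A tree above `Ts` is identified with its set of superfluous nodes. Forgetting that these sets
    -- must form trees leaves a sum over all subsets, which factorizes as ∏ (1 + ρ v) ≤ exp(2^L q) ≤
    -- exp(1/2).
    _ = π Ts * ∑ S ∈ (Finset.univ.filter (Ts ≤ ·)).image (fun T : CartTree L => T.1 \ Ts.1),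
          ∏ v ∈ S, ρ v := by
        rw [← Finset.mul_sum, Finset.sum_image]
        intro T hT T' hT' heq
        have h₁ : Ts.1 ⊆ T.1 := (Finset.mem_filter.1 hT).2
        have h₂ : Ts.1 ⊆ T'.1 := (Finset.mem_filter.1 hT').2
        have h₃ : T.1 \ Ts.1 = T'.1 \ Ts.1 := heq
        exact Subtype.ext (by
          rw [← Finset.sdiff_union_of_subset h₁, h₃, Finset.sdiff_union_of_subset h₂])
    _ ≤ π Ts * ∑ S ∈ (fullNodes L \ Ts.1).powerset, ∏ v ∈ S, ρ v := by
        refine mul_le_mul_of_nonneg_left ?_ (h.pos Ts).le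
        refine Finset.sum_le_sum_of_subset_of_nonneg ?_ fun S _ _ =>
          Finset.prod_nonneg fun v _ => (h.factor_pos v).le
        intro S hS
        obtain ⟨T, -, rfl⟩ := Finset.mem_image.1 hS
        exact Finset.mem_powerset.2 (Finset.sdiff_subset_sdiff T.subset_full le_rfl)
    _ = π Ts * ∏ v ∈ fullNodes L \ Ts.1, (1 + ρ v) := by rw [Finset.prod_one_add]
    _ ≤ π Ts * Real.exp (1 / 2) := by
        refine mul_le_mul_of_nonneg_left ?_ (h.pos Ts).le
        calc ∏ v ∈ fullNodes L \ Ts.1, (1 + ρ v) ≤ ∏ _v ∈ fullNodes L \ Ts.1, Real.exp q := by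
              refine Finset.prod_le_prod (fun v _ => by linarith [h.factor_pos v]) fun v hv => ?_
              linarith [hle v hv, Real.add_one_le_exp q]
          _ = Real.exp ((fullNodes L \ Ts.1).card * q) := by
              rw [Finset.prod_const, ← Real.exp_nat_mul]
          _ ≤ _ := by
              refine Real.exp_le_exp.2 (le_trans ?_ hqn)
              refine mul_le_mul_of_nonneg_right ?_ hq0.le
              have h₁ := Finset.card_le_card (Finset.sdiff_subset (s := fullNodes L) (t := Ts.1))
              have h₂ := card_fullNodes L
              exact_mod_cast (by omega : (fullNodes L \ Ts.1).card ≤ 2 ^ L)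
    _ ≤ 2 * π Ts := by
        have : Real.exp (1 / 2) ≤ 2 := by
          linarith [exp_sub_one_le_two_mul (x := 1 / 2) (by norm_num) (by norm_num)]
        nlinarith [h.pos Ts]

variable {β : Index → ℝ} {C a b : ℝ}

open Classical in
/-- The stationary probability of the smallest tree that contains the signal. -/
lemma quarter_le (h : Concentrated s n c A B Ts π ρ) (hc : 4 ≤ c) (hC : 0 < C) (hA : 0 < A)
    (hβ : ∀ v ∈ B, A * Real.log n / √n < |β v| ∧ |β v| < C) (ha : 0 < a)
    (ha' : a = s.delta L * A ^ 2 * Real.log n ^ 2 / (2 ^ (2 * L + 2) * C ^ 2 * n))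
    (hτ : (Real.exp 1 - 1) * (n : ℝ) ^ (1 - A ^ 2 * Real.log n / 8) ≤ a / 2) :
    1 / 4 ≤ π Ts := by
  set P := metropolisHastings s.proposal π with hP
  set V := missingEnergy (L := L) (1 / (2 ^ L * C ^ 2)) B β with hV
  set τ := (n : ℝ) ^ (1 - A ^ 2 * Real.log n / 8) with hτdef
  have he : 0 ≤ Real.exp 1 - 1 := by linarith [Real.add_one_le_exp 1]
  have hV1 : ∀ T : CartTree L, 1 ≤ V T := one_le_missingEnergy
  have hVe : ∀ T : CartTree L, V T ≤ Real.exp 1 :=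
    missingEnergy_le h.subset hC fun v hv => (hβ v hv).2
  -- A drift inequality valid on all trees: above `Ts`, where V = 1, V can increase only by losing
  -- signal. Integrating against π makes the left side vanish.
  have hpt : ∀ T, (P *ᵥ V) T - V T ≤
      (Real.exp 1 - 1) * (τ / 2) - (if Ts ≤ T then 0 else a) := by
    intro T
    split_ifs with hT
    · rw [sub_zero, mulVec_sub_eq h.mem_rowStochastic]
      refine le_trans ?_ (mul_le_mul_of_nonneg_left (h.sum_loses_le T) he)
      rw [Finset.mul_sum]
      refine Finset.sum_le_sum fun T' _ => ?_
      have h0 := (Matrix.mem_rowStochastic.1 h.mem_rowStochastic).1 T T'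
      have hT1 : V T = 1 := h.missingEnergy_eq_one hT
      by_cases hT' : Ts ≤ T'
      · have hT1' : V T' = 1 := h.missingEnergy_eq_one hT'
        rw [hT1, hT1', sub_self, mul_zero]
        exact mul_nonneg he (mul_nonneg h0 (by split_ifs <;> norm_num))
      · rw [if_pos (h.loses_of_not_le hT hT'), mul_one, mul_comm, hT1]
        exact mul_le_mul_of_nonneg_right (by linarith [hVe T']) h0
    · have h₁ := h.mulVec_missingEnergy_le hC hA hβ hT
      rw [← ha', div_le_iff₀ (by linarith [hV1 T])] at h₁
      have h₂ : (a - (Real.exp 1 - 1) * (τ / 2)) * 1 ≤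
          (a - (Real.exp 1 - 1) * (τ / 2)) * V T :=
        mul_le_mul_of_nonneg_left (hV1 T) (by linarith)
      linarith
  have hstat := stationary_dotProduct h.mem_rowStochastic
    (metropolisHastings_reversible (s.proposal_nonneg h.valid) h.pos) V
  have hsum : ∑ T, π T * ((P *ᵥ V) T - V T) ≤
      ∑ T, π T * ((Real.exp 1 - 1) * (τ / 2) - (if Ts ≤ T then 0 else a)) :=
    Finset.sum_le_sum fun T _ => mul_le_mul_of_nonneg_left (hpt T) (h.pos T).le
  simp only [mul_sub] at hsum
  rw [Finset.sum_sub_distrib, Finset.sum_sub_distrib, hstat, sub_self, ← Finset.sum_mul, h.sum_eq,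
    one_mul] at hsum
  have hcompl : ∑ T, π T * (if Ts ≤ T then 0 else a) =
      (1 - ∑ T, (if Ts ≤ T then π T else 0)) * a := by
    rw [← h.sum_eq, ← Finset.sum_sub_distrib, Finset.sum_mul]
    refine Finset.sum_congr rfl fun T _ => ?_
    split_ifs <;> ring
  rw [hcompl] at hsum
  -- So the trees above `Ts` have mass at least 3/4, and by `sum_superset_le` the tree `Ts` has at
  -- least half of it.
  have h₁ : (1 - ∑ T, (if Ts ≤ T then π T else 0)) * a ≤ 1 / 4 * a := by linarith
  have h₂ := le_of_mul_le_mul_right h₁ ha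
  linarith [h.sum_superset_le hc]

open Classical in
theorem mixingTime_le (h : Concentrated s n c A B Ts π ρ) (hc : 4 ≤ c) (hC : 0 < C) (hA : 0 < A)
    (hβ : ∀ v ∈ B, A * Real.log n / √n < |β v| ∧ |β v| < C) (ha : 0 < a)
    (ha' : a = s.delta L * A ^ 2 * Real.log n ^ 2 / (2 ^ (2 * L + 2) * C ^ 2 * n))
    (hτ : (Real.exp 1 - 1) * (n : ℝ) ^ (1 - A ^ 2 * Real.log n / 8) ≤ a / 2)
    (hb : b = 1 / 2 ^ (2 * L + 2))
    (hτ' : s.bigM L / (n : ℝ) ^ (c - 3 / 2) + 5 * (n : ℝ) ^ (1 - A ^ 2 * Real.log n / 8) ≤ b / 2)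
    {ε : ℝ} (hε : 0 < ε) (hε' : ε < 1) :
    (mixingTime (lazyChain (metropolisHastings s.proposal π)) π ε : ℝ≥0∞) ≤
      ENNReal.ofReal (238 * max (1 / a) (1 / b) * Real.log (6 / ε)) := by
  set P := metropolisHastings s.proposal π with hP
  set V := missingEnergy (L := L) (1 / (2 ^ L * C ^ 2)) B β with hV
  set τ := (n : ℝ) ^ (1 - A ^ 2 * Real.log n / 8) with hτdef
  have hn0 : (0 : ℝ) < n := by linarith [h.one_lt]
  have hτ0 : 0 < τ := Real.rpow_pos_of_pos hn0 _
  have hb0 : 0 < b := by rw [hb]; positivity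
  have hb1 : b ≤ 1 := by
    rw [hb, div_le_one (by positivity)]
    exact one_le_pow₀ (by norm_num)
  have he : 0 ≤ Real.exp 1 - 1 := by linarith [Real.add_one_le_exp 1]
  have he2 : Real.exp 1 * Real.exp 1 ≤ 8 := by
    nlinarith [Real.exp_one_lt_d9, Real.exp_pos 1]
  have hV1 : ∀ T : CartTree L, 1 ≤ V T := one_le_missingEnergy
  have hVe : ∀ T : CartTree L, V T ≤ Real.exp 1 :=
    missingEnergy_le h.subset hC fun v hv => (hβ v hv).2
  have h0 := (Matrix.mem_rowStochastic.1 h.mem_rowStochastic).1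
  -- The factor e lifts the outer piece above V₂ ≤ e, so W ≤ e V₁ everywhere, with equality off the
  -- trees above `Ts`. Hence the V₁ drift passes to W there, and crossing the border inwards does no
  -- harm.
  let W : CartTree L → ℝ := fun T =>
    if T = Ts then 0 else if Ts ≤ T then drift₂ Ts T else Real.exp 1 * V T
  have hWV : ∀ T, W T ≤ Real.exp 1 * V T := by
    intro T
    have h₁ : Real.exp 1 ≤ Real.exp 1 * V T :=
      le_mul_of_one_le_right (Real.exp_pos 1).le (hV1 T)
    simp only [W]
    split_ifs
    · exact mul_nonneg (Real.exp_pos 1).le (by linarith [hV1 T])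
    · exact (drift₂_le T).trans h₁
    · exact le_rfl
  have hW1 : ∀ T, T ≠ Ts → 1 ≤ W T := by
    intro T hT
    simp only [W, if_neg hT]
    split_ifs
    · exact one_le_drift₂ T
    · nlinarith [hV1 T]
  have hW8 : ∀ T, W T ≤ 8 := fun T =>
    (hWV T).trans ((mul_le_mul_of_nonneg_left (hVe T) (Real.exp_pos 1).le).trans he2)
  have hdrift : ∀ T, T ≠ Ts → (P *ᵥ W) T ≤ (1 - min a b / 2) * W T := by
    intro T hT
    by_cases hle : Ts ≤ T
    · have hW : W T = drift₂ Ts T := by simp only [W, if_neg hT, if_pos hle]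
      have h₁ := h.mulVec_drift₂_le (lt_of_le_of_ne hle (Ne.symm hT))
      rw [← hb, div_le_iff₀ (by linarith [one_le_drift₂ (Ts := Ts) T])] at h₁
      -- Crossing the border outwards loses signal and leads to W ≤ 8. This adds 8 · τ/2 = 4τ to the
      -- τ in the V₂ drift, which is the 5τ in `hτ'`; half of the rate `b` absorbs it together with
      -- the M term.
      have h₂ : (P *ᵥ W) T ≤ (P *ᵥ drift₂ Ts) T + 8 * (τ / 2) := by
        have h₃ := mul_le_mul_of_nonneg_left (h.sum_loses_le T) (by norm_num : (0 : ℝ) ≤ 8)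
        refine le_trans ?_ (add_le_add_right h₃ _)
        simp only [Matrix.mulVec, dotProduct]
        rw [Finset.mul_sum, ← Finset.sum_add_distrib]
        refine Finset.sum_le_sum fun T' _ => ?_
        have h₄ := one_le_drift₂ (Ts := Ts) T'
        have h₅ : W T' ≤ drift₂ Ts T' + 8 * (if Loses B T T' then 1 else 0) := by
          by_cases hT' : Ts ≤ T'
          · have h₆ : W T' ≤ drift₂ Ts T' := by
              simp only [W, if_pos hT']
              split_ifs
              · linarith
              · exact le_rfl
            have h₇ : (0 : ℝ) ≤ 8 * (if Loses B T T' then 1 else 0) := by split_ifs <;> norm_num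
            linarith
          · rw [if_pos (h.loses_of_not_le hle hT')]
            linarith [hW8 T']
        have := mul_le_mul_of_nonneg_left h₅ (h0 T T')
        linarith
      rw [hW]
      have h₃ := one_le_drift₂ (Ts := Ts) T
      have h₄ : min a b ≤ b := min_le_right _ _
      nlinarith
    · have hW : W T = Real.exp 1 * V T := by simp only [W, if_neg hT, if_neg hle]
      have h₁ := h.mulVec_missingEnergy_le hC hA hβ hle
      rw [← ha', div_le_iff₀ (by linarith [hV1 T])] at h₁
      have h₂ : (P *ᵥ W) T ≤ Real.exp 1 * (P *ᵥ V) T := by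
        simp only [Matrix.mulVec, dotProduct]
        rw [Finset.mul_sum]
        refine Finset.sum_le_sum fun T' _ => ?_
        have := mul_le_mul_of_nonneg_left (hWV T') (h0 T T')
        linarith
      rw [hW]
      refine h₂.trans ?_
      rw [mul_left_comm]
      refine mul_le_mul_of_nonneg_left (h₁.trans ?_) (Real.exp_pos 1).le
      refine mul_le_mul_of_nonneg_right ?_ (by linarith [hV1 T])
      have h₃ : min a b ≤ a := min_le_left _ _
      linarith
  have hmin : 0 < min a b := lt_min ha hb0
  have hmix := mixingTime_lazyChain_le h.mem_rowStochastic h.pos h.sum_eq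
    (metropolisHastings_reversible (s.proposal_nonneg h.valid) h.pos)
    (h.quarter_le hc hC hA hβ ha ha' hτ) (W := W) (by simp [W]) hW1 hW8
    (γ := min a b / 2) (by linarith) (by linarith [min_le_right a b]) hdrift hε hε'
  convert hmix using 3
  rcases le_total a b with hab | hab
  · rw [min_eq_left hab, max_eq_left (one_div_le_one_div_of_le ha hab)]
    field_simp
    norm_num
  · rw [min_eq_right hab, max_eq_right (one_div_le_one_div_of_le hb0 hab)]
    field_simp
    norm_num

end Concentrated

/-! ### Sample sizes that are large enough -/

lemma sixteen_mul_sq_le_two_pow {L : ℕ} (hL : 14 ≤ L) : 16 * (2 * L + 1) ^ 2 ≤ 2 ^ L := by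
  induction L, hL using Nat.le_induction with
  | base => norm_num
  | succ L hL ih =>
    rw [pow_succ 2 L]
    nlinarith

/-- With n ≥ 2^L this puts n^(3/2) above 2.8^L, which outgrows D^L because D ≤ e < 2.8. So n^(3/2)
dominates 1/`delta`, up to the constant depending on D. -/
lemma two_point_eight_le : (2.8 : ℝ) ≤ 2 ^ (3 / 2 : ℝ) := by
  have h : (2 : ℝ) ^ (3 / 2 : ℝ) = 2 * √2 := by
    rw [show (3 / 2 : ℝ) = 1 + 1 / 2 by norm_num, Real.rpow_add (by norm_num), Real.rpow_one,
      Real.sqrt_eq_rpow]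
  rw [h]
  have : (1.4 : ℝ) ≤ √2 := Real.le_sqrt_of_sq_le (by norm_num)
  linarith

/-- The probabilities of the GROW moves dominate a power of the sample size. -/
lemma exists_forall_one_le_delta {s : Sampler} (hs : s.Valid) : ∃ L₀ : ℕ, ∀ L n : ℕ, L₀ ≤ L →
    2 ^ (L + 1) ≤ n → 1 ≤ 4 * (n : ℝ) ^ (3 / 2 : ℝ) * s.delta L := by
  cases s with
  | bayesianCART =>
    refine ⟨0, fun L n _ hn => ?_⟩
    have h1 : (1 : ℝ) ≤ n := by exact_mod_cast (Nat.one_le_two_pow).trans hn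
    have := Real.one_le_rpow h1 (by norm_num : (0 : ℝ) ≤ 3 / 2)
    simp only [Sampler.delta]
    linarith
  | twiggy D =>
    obtain ⟨hD, hDe⟩ := hs
    have hD1 : 0 < D - 1 := by linarith
    have hr : 1 < 2.8 / Real.exp 1 := by
      rw [one_lt_div (Real.exp_pos 1)]
      linarith [Real.exp_one_lt_d9]
    obtain ⟨L₀, hL₀⟩ := Filter.eventually_atTop.1
      ((tendsto_pow_atTop_atTop_of_one_lt hr).eventually_ge_atTop (1 / (8 * (D - 1))))
    refine ⟨max L₀ 1, fun L n hL hn => ?_⟩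
    have h₁ := hL₀ L ((le_max_left _ _).trans hL)
    have hL1 : 1 ≤ L := (le_max_right _ _).trans hL
    have hn' : (2 : ℝ) ^ L ≤ n := by
      have : 2 ^ L ≤ n := (Nat.pow_le_pow_right (by norm_num) (Nat.le_succ L)).trans hn
      exact_mod_cast this
    have h₂ : (2.8 : ℝ) ^ L ≤ (n : ℝ) ^ (3 / 2 : ℝ) := by
      calc (2.8 : ℝ) ^ L ≤ (2 ^ (3 / 2 : ℝ)) ^ L :=
            pow_le_pow_left₀ (by norm_num) two_point_eight_le L
        _ = ((2 : ℝ) ^ L) ^ (3 / 2 : ℝ) := by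
            rw [← Real.rpow_natCast, ← Real.rpow_natCast, ← Real.rpow_mul (by norm_num),
              ← Real.rpow_mul (by norm_num), mul_comm]
        _ ≤ _ := Real.rpow_le_rpow (by positivity) hn' (by norm_num)
    have h₃ : D ^ L - 1 ≤ Real.exp 1 ^ L := by
      have := pow_le_pow_left₀ (by linarith) hDe L
      linarith
    have h₄ : 0 < D ^ L - 1 := sub_pos.2 (one_lt_pow₀ hD (by omega))
    simp only [Sampler.delta]
    rw [mul_div_assoc', le_div_iff₀ h₄, one_mul]
    rw [div_le_iff₀ (by positivity), div_pow, div_mul_eq_mul_div,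
      le_div_iff₀ (by positivity), one_mul] at h₁
    calc D ^ L - 1 ≤ Real.exp 1 ^ L := h₃
      _ ≤ 2.8 ^ L * (8 * (D - 1)) := h₁
      _ ≤ (n : ℝ) ^ (3 / 2 : ℝ) * (8 * (D - 1)) := by gcongr
      _ = _ := by ring

/-- The sample size dominates the constants of the problem. -/
structure LargeSample (s : Sampler) (n L : ℕ) (C : ℝ) : Prop where
  eight_le : 8 ≤ n
  one_le_log : 1 ≤ Real.log n
  one_le_delta : 1 ≤ 4 * (n : ℝ) ^ (3 / 2 : ℝ) * s.delta L
  le_sqrt : 4 * (2 * L + 1) ≤ √(n : ℝ)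
  sq_le : 4 * C ^ 2 ≤ n

lemma exists_forall_largeSample {s : Sampler} (hs : s.Valid) (C : ℝ) : ∃ L₀ : ℕ, ∀ L n : ℕ,
    L₀ ≤ L → 2 ^ (L + 1) ≤ n → LargeSample s n L C := by
  obtain ⟨L₁, hL₁⟩ := exists_forall_one_le_delta hs
  refine ⟨max (max L₁ 14) ⌈4 * C ^ 2⌉₊, fun L n hL hn => ?_⟩
  simp only [max_le_iff] at hL
  obtain ⟨⟨h₁, h₂⟩, h₃⟩ := hL
  have hLn : 2 ^ L ≤ n := (Nat.pow_le_pow_right (by norm_num) (Nat.le_succ L)).trans hn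
  have h8 : 8 ≤ n := by
    have : 2 ^ 3 ≤ 2 ^ L := Nat.pow_le_pow_right (by norm_num) (by omega)
    omega
  refine ⟨h8, ?_, hL₁ L n h₁ hn, ?_, ?_⟩
  · have h8' : (8 : ℝ) ≤ n := by exact_mod_cast h8
    rw [Real.le_log_iff_exp_le (by linarith)]
    linarith [Real.exp_one_lt_d9]
  · refine Real.le_sqrt_of_sq_le ?_
    have := (sixteen_mul_sq_le_two_pow h₂).trans hLn
    have h' : (16 : ℝ) * (2 * L + 1) ^ 2 ≤ n := by exact_mod_cast this
    linarith
  · have h4 : (L : ℝ) ≤ n := by exact_mod_cast (Nat.lt_two_pow_self.le).trans hLn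
    exact (Nat.le_ceil _).trans ((Nat.cast_le.2 h₃).trans h4)

namespace LargeSample

variable {s : Sampler} {n : ℕ} {C A c : ℝ}

lemma delta_pos (h : LargeSample s n L C) : 0 < s.delta L := by
  have hn0 : (0 : ℝ) < n := by have := h.eight_le; positivity
  have hp : 0 < 4 * (n : ℝ) ^ (3 / 2 : ℝ) := by positivity
  exact (mul_pos_iff_of_pos_left hp).1 (by linarith [h.one_le_delta])

/-- A ≥ 24 gives A²/8 ≥ 72, and log n ≥ 1. Ten powers of n are all that is used of the
superpolynomial decay. -/
lemma tail_le (h : LargeSample s n L C) (hA : 24 ≤ A) :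
    (n : ℝ) ^ (1 - A ^ 2 * Real.log n / 8) ≤ ((n : ℝ) ^ 10)⁻¹ := by
  have h8 : (8 : ℝ) ≤ n := by exact_mod_cast h.eight_le
  have hlog := h.one_le_log
  calc _ ≤ (n : ℝ) ^ (-(10 : ℕ) : ℝ) := by
        refine Real.rpow_le_rpow_of_exponent_le (by linarith) ?_
        push_cast
        nlinarith [mul_le_mul_of_nonneg_left hlog (sq_nonneg A)]
    _ = _ := by rw [Real.rpow_neg (by linarith), Real.rpow_natCast]

/-- The drift rate is only polynomially small: `delta` ≥ 1/(4n²), 2^(2L+2) ≤ n² and C² ≤ n/4 bound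
the right side from below by 1/(2n⁶). -/
lemma tail_le_rate (h : LargeSample s n L C) (hLn : 2 ^ (L + 1) ≤ n) (hC : 0 < C) (hA : 24 ≤ A) :
    (Real.exp 1 - 1) * (n : ℝ) ^ (1 - A ^ 2 * Real.log n / 8) ≤
      s.delta L * A ^ 2 * Real.log n ^ 2 / (2 ^ (2 * L + 2) * C ^ 2 * n) / 2 := by
  have h8 : (8 : ℝ) ≤ n := by exact_mod_cast h.eight_le
  have hn0 : (0 : ℝ) < n := by linarith
  have hlog := h.one_le_log
  have hδ := h.delta_pos
  have hpow : (2 : ℝ) ^ (2 * L + 2) ≤ n ^ 2 := by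
    have : (2 : ℝ) ^ (L + 1) ≤ n := by exact_mod_cast hLn
    calc (2 : ℝ) ^ (2 * L + 2) = (2 ^ (L + 1)) ^ 2 := by rw [← pow_mul]; congr 1; ring
      _ ≤ _ := pow_le_pow_left₀ (by positivity) this 2
  have hδ' : 1 ≤ 4 * (n : ℝ) ^ 2 * s.delta L := by
    have h₁ : (n : ℝ) ^ (3 / 2 : ℝ) ≤ (n : ℝ) ^ (2 : ℝ) :=
      Real.rpow_le_rpow_of_exponent_le (by linarith) (by norm_num)
    rw [Real.rpow_two] at h₁
    exact h.one_le_delta.trans (by gcongr)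
  have hden : (2 : ℝ) ^ (2 * L + 2) * C ^ 2 * n ≤ (n : ℝ) ^ 4 / 4 := by
    calc (2 : ℝ) ^ (2 * L + 2) * C ^ 2 * n ≤ (n : ℝ) ^ 2 * ((n : ℝ) / 4) * n := by
          gcongr
          linarith [h.sq_le]
      _ = (n : ℝ) ^ 4 / 4 := by ring
  have hnum : 1 / (4 * (n : ℝ) ^ 2) ≤ s.delta L * A ^ 2 * Real.log n ^ 2 := by
    have h₁ : 1 / (4 * (n : ℝ) ^ 2) ≤ s.delta L := by
      rw [div_le_iff₀ (by positivity)]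
      linarith
    have h₂ : 1 ≤ A ^ 2 * Real.log n ^ 2 := by
      rw [← mul_pow]
      exact one_le_pow₀ (by nlinarith)
    rw [mul_assoc]
    exact h₁.trans (le_mul_of_one_le_right hδ.le h₂)
  calc (Real.exp 1 - 1) * (n : ℝ) ^ (1 - A ^ 2 * Real.log n / 8) ≤ 2 * ((n : ℝ) ^ 10)⁻¹ := by
        refine mul_le_mul ?_ (h.tail_le hA) (by positivity) (by norm_num)
        linarith [Real.exp_one_lt_d9]
    _ ≤ 1 / (4 * (n : ℝ) ^ 2) / (n ^ 4 / 4) / 2 := by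
        rw [← one_div, mul_one_div, div_div, div_div, div_le_div_iff₀ (by positivity)
          (by positivity)]
        have : (8 : ℝ) ^ 4 ≤ n ^ 4 := pow_le_pow_left₀ (by norm_num) h8 4
        have h6 : (0 : ℝ) ≤ n ^ 6 := by positivity
        nlinarith [mul_le_mul_of_nonneg_left this h6]
    _ ≤ _ := by gcongr

lemma bigM_le (s : Sampler) (L : ℕ) : s.bigM L ≤ 2 * L + 1 := by
  cases s with
  | bayesianCART => simp [Sampler.bigM]
  | twiggy D => simp [Sampler.bigM]

lemma bigM_nonneg (s : Sampler) (L : ℕ) : 0 ≤ s.bigM L := by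
  cases s with
  | bayesianCART => simp [Sampler.bigM]
  | twiggy D => simp [Sampler.bigM]

/-- For c ≥ 4 the power n^(c-3/2) is at least n² √n. The n² matches the drift rate 2^(-(2L+2)), and
√n beats M ≤ 2L + 1. -/
lemma perturbation_le (h : LargeSample s n L C) (hLn : 2 ^ (L + 1) ≤ n) (hA : 24 ≤ A)
    (hc : 4 ≤ c) :
    s.bigM L / (n : ℝ) ^ (c - 3 / 2) + 5 * (n : ℝ) ^ (1 - A ^ 2 * Real.log n / 8) ≤
      1 / 2 ^ (2 * L + 2) / 2 := by
  have h8 : (8 : ℝ) ≤ n := by exact_mod_cast h.eight_le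
  have hn0 : (0 : ℝ) < n := by linarith
  have hpow : (2 : ℝ) ^ (2 * L + 2) ≤ n ^ 2 := by
    have : (2 : ℝ) ^ (L + 1) ≤ n := by exact_mod_cast hLn
    calc (2 : ℝ) ^ (2 * L + 2) = (2 ^ (L + 1)) ^ 2 := by rw [← pow_mul]; congr 1; ring
      _ ≤ _ := pow_le_pow_left₀ (by positivity) this 2
  have h₁ : s.bigM L / (n : ℝ) ^ (c - 3 / 2) ≤ 1 / n ^ 2 / 4 := by
    have hq : (n : ℝ) ^ 2 * √n ≤ (n : ℝ) ^ (c - 3 / 2) := by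
      have : (n : ℝ) ^ 2 * √n = (n : ℝ) ^ (5 / 2 : ℝ) := by
        rw [Real.sqrt_eq_rpow, ← Real.rpow_two, ← Real.rpow_add hn0]
        norm_num
      rw [this]
      exact Real.rpow_le_rpow_of_exponent_le (by linarith) (by linarith)
    have hs : 0 < √(n : ℝ) := Real.sqrt_pos.2 hn0
    have hM := bigM_le s L
    have hM0 := bigM_nonneg s L
    calc s.bigM L / (n : ℝ) ^ (c - 3 / 2) ≤ (√n / 4) / (n ^ 2 * √n) := by
          gcongr
          linarith [h.le_sqrt]
      _ = 1 / n ^ 2 / 4 := by field_simp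
  have h₂ : 5 * (n : ℝ) ^ (1 - A ^ 2 * Real.log n / 8) ≤ 1 / n ^ 2 / 4 := by
    calc _ ≤ 5 * ((n : ℝ) ^ 10)⁻¹ := by linarith [h.tail_le hA]
      _ ≤ 1 / n ^ 2 / 4 := by
          rw [← one_div, mul_one_div, div_div, div_le_div_iff₀ (by positivity) (by positivity)]
          have : (8 : ℝ) ^ 8 ≤ n ^ 8 := pow_le_pow_left₀ (by norm_num) h8 8
          nlinarith [mul_le_mul_of_nonneg_left this (sq_nonneg (n : ℝ))]
  have h₃ : 1 / (n : ℝ) ^ 2 ≤ 1 / 2 ^ (2 * L + 2) := one_div_le_one_div_of_le (by positivity) hpow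
  linarith

end LargeSample

/-! ### The posterior on the noise event -/

/-- The only place where the data enter: on the noise event, z_v is the noise coefficient off the
signal and nβ_v plus noise on it. -/
lemma concentrated_posterior {s : Sampler} (hs : s.Valid) {Lmax : ℕ} (hL : L ≤ Lmax) {c A C : ℝ}
    (hc : 3 < c) (hA : 4 * (c + 3) ≤ A) {B : Finset Index} {β : Index → ℝ} {Ts : CartTree L}
    (hlarge : LargeSample s (sampleSize Lmax) L C)
    (hsig : SignalAssumption (sampleSize Lmax) L A C B β)
    (hleast : IsLeast {T : CartTree L | B ⊆ T.int} Ts)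
    (hconn : s = Sampler.bayesianCART → Ts.int = insert none B)
    {noise : Fin (sampleSize Lmax) → ℝ} (hnoise : noise ∈ noiseEvent (sampleSize Lmax) L) :
    Concentrated s (sampleSize Lmax) c A B Ts
      (posterior (sampleSize Lmax) c (signalVec (sampleSize Lmax) B β + noise))
      fun v => nodeWeight (sampleSize Lmax) c (signalVec (sampleSize Lmax) B β + noise)
        (some v) := by
  have h8 := hlarge.eight_le
  have hn : (1 : ℝ) ≤ sampleSize Lmax := by exact_mod_cast (by omega : 1 ≤ sampleSize Lmax)
  have hcoef : ∀ v ∈ fullIndices L, haarCoef (sampleSize Lmax)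
      (signalVec (sampleSize Lmax) B β + noise) v =
      (if v ∈ B then sampleSize Lmax * β v else 0) + haarCoef (sampleSize Lmax) noise v :=
    fun v hv => by rw [haarCoef_add, haarCoef_signalVec hL hsig.1 β hv]
  have hc0 : 0 < c := by linarith
  refine
    { valid := hs
      two_pow_le := two_pow_le_sampleSize hL
      three_le := hc.le
      delta_ge := ?_
      pos := posterior_pos _ hL hc0
      sum_eq := sum_posterior _ hL hc0
      factor_pos := fun v => nodeWeight_pos (one_lt_sampleSize Lmax) hc0 _ _
      factor := fun T T' h => posterior_eq_mul_prod _ hL h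
      factor_le := fun v hv hvB => ?_
      le_prod := ?_
      subset := hsig.1
      isLeast := hleast
      connected := hconn }
  · have h₁ : (sampleSize Lmax : ℝ) ^ (3 / 2 : ℝ) ≤ (sampleSize Lmax : ℝ) ^ (c - 3 / 2) :=
      Real.rpow_le_rpow_of_exponent_le hn (by linarith)
    have h₂ := hlarge.delta_pos
    exact hlarge.one_le_delta.trans (by gcongr)
  · have hv' : some v ∈ fullIndices L := Finset.some_mem_insertNone.2 hv
    refine nodeWeight_le_of_small (by omega) ?_
    rw [hcoef _ hv', if_neg hvB, zero_add]
    exact hnoise _ hv'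
  · rintro R hR hcard ⟨v, hv, hvB⟩
    have hv' : some v ∈ fullIndices L := hsig.1 hvB
    refine le_prod_nodeWeight h8 (two_pow_le_sampleSize hL) (by linarith) hA hlarge.one_le_log
      hcard hv ?_
    refine sq_le_of_signal h8 (b := β (some v)) (x := haarCoef _ noise (some v)) (by linarith)
      hlarge.one_le_log (hsig.2 _ hvB).1 (hnoise _ hv') ?_
    rw [hcoef _ hv', if_pos hvB]

/-! ### Comparison of the rates -/

/-- The factor κ of the canonical-path bound dominates 1/`delta`, as D^L ≥ D for L ≥ 1 ensures for
the Twiggy sampler, and the bracket contains n(c + 1/2) log(1+n) ≥ n log n. The logarithm gained is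
the one in this bracket. -/
lemma twoDriftRate_le_canonicalPathRate {s : Sampler} (hs : s.Valid) {c A C ε : ℝ} (hc : 4 ≤ c)
    (hA : 0 < A) (hε : 0 < ε) (hε' : ε < 1) {Lmax n m : ℕ} (hL : 1 ≤ L)
    (hLmax : L ≤ Lmax) (hn : n = sampleSize Lmax) :
    twoDriftRate s n L A C ε ≤ Real.log (6 / ε) * (C ^ 2 / A ^ 2 + 2) / Real.log n *
      canonicalPathRate s n L m c C ε := by
  have hn4 : (4 : ℝ) ≤ n := by
    have : 2 ^ 2 ≤ n := hn ▸ Nat.pow_le_pow_right (by norm_num) (by omega)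
    exact_mod_cast this
  have hlog1 : 1 ≤ Real.log n := by
    rw [Real.le_log_iff_exp_le (by linarith)]
    linarith [Real.exp_one_lt_d9]
  have hlog6 : 0 < Real.log (6 / ε) := Real.log_pos (by rw [lt_div_iff₀ hε]; linarith)
  have hlog2 : 0 < Real.log (2 / ε) := Real.log_pos (by rw [lt_div_iff₀ hε]; linarith)
  obtain ⟨κ, hκ1, hκ, hδ⟩ : ∃ κ : ℝ, 1 ≤ κ ∧ canonicalPathRate s n L m c C ε =
      κ * 2 ^ (2 * L + 3) * (n * ((c + 1 / 2) * Real.log (1 + n) + m * C ^ 2 + 1)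
        + 4 * m * Real.log n + Real.log (2 / ε)) ∧ C ^ 2 / (s.delta L * A ^ 2) ≤
          κ * (C ^ 2 / A ^ 2) := by
    cases s with
    | bayesianCART => exact ⟨1, le_rfl, rfl, by simp [Sampler.delta]⟩
    | twiggy D =>
      have hD : 0 < D - 1 := by linarith [hs.1]
      have hDL : D ≤ D ^ L := le_self_pow₀ hs.1.le (by omega)
      have hDL' : 0 < D ^ L - 1 := by linarith
      refine ⟨(D ^ L - 1) / (D - 1), ?_, rfl, ?_⟩
      · rw [one_le_div hD]
        linarith
      · simp only [Sampler.delta]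
        have h₁ : C ^ 2 / (2 * (D - 1) / (D ^ L - 1) * A ^ 2) =
            1 / 2 * ((D ^ L - 1) / (D - 1) * (C ^ 2 / A ^ 2)) := by field_simp
        rw [h₁]
        have : 0 ≤ (D ^ L - 1) / (D - 1) * (C ^ 2 / A ^ 2) := by positivity
        linarith
  have hX : n * Real.log n ≤ n * ((c + 1 / 2) * Real.log (1 + n) + m * C ^ 2 + 1)
      + 4 * m * Real.log n + Real.log (2 / ε) := by
    have h₁ : Real.log n ≤ Real.log (1 + n) := Real.log_le_log (by linarith) (by linarith)
    have h₂ : Real.log n ≤ (c + 1 / 2) * Real.log (1 + n) + m * C ^ 2 + 1 := by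
      have : (0 : ℝ) ≤ m * C ^ 2 := by positivity
      nlinarith
    have h₃ := mul_le_mul_of_nonneg_left h₂ (by linarith : (0 : ℝ) ≤ n)
    have h₄ : 0 ≤ 4 * m * Real.log n := by positivity
    linarith
  have hmax : max (C ^ 2 / (s.delta L * A ^ 2) * (2 ^ (2 * L) * n / Real.log n ^ 2))
      (2 ^ (2 * L + 1)) ≤ (C ^ 2 / A ^ 2 + 2) * (κ * 2 ^ (2 * L) * n) := by
    have hCA : 0 ≤ C ^ 2 / A ^ 2 := by positivity
    refine max_le ?_ ?_
    · calc C ^ 2 / (s.delta L * A ^ 2) * (2 ^ (2 * L) * n / Real.log n ^ 2)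
          ≤ κ * (C ^ 2 / A ^ 2) * (2 ^ (2 * L) * n) := by
            gcongr
            exact div_le_self (by positivity) (one_le_pow₀ hlog1)
        _ = C ^ 2 / A ^ 2 * (κ * 2 ^ (2 * L) * n) := by ring
        _ ≤ _ := by gcongr; linarith
    · calc (2 : ℝ) ^ (2 * L + 1) = 2 * (1 * 2 ^ (2 * L) * 1) := by rw [pow_succ]; ring
        _ ≤ (C ^ 2 / A ^ 2 + 2) * (κ * 2 ^ (2 * L) * n) := by
            gcongr <;> linarith
  rw [twoDriftRate, hκ]
  calc _ ≤ Real.log (6 / ε) * ((C ^ 2 / A ^ 2 + 2) * (κ * 2 ^ (2 * L) * n)) := by gcongr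
    _ = Real.log (6 / ε) * (C ^ 2 / A ^ 2 + 2) / Real.log n *
        (κ * 2 ^ (2 * L) * (n * Real.log n)) := by field_simp
    _ ≤ _ := by
        gcongr <;> norm_num

/-- The drift bounds in terms of the parameters of the mixing rate. -/
lemma max_inv_drift_le {δ A C l x : ℝ} (hδ : 0 < δ) (hA : 0 < A) (hC : 0 < C) (hl : 0 < l)
    (hx : 0 < x) (L : ℕ) :
    max (1 / (δ * A ^ 2 * l ^ 2 / (2 ^ (2 * L + 2) * C ^ 2 * x))) (1 / (1 / 2 ^ (2 * L + 2))) ≤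
      4 * max (C ^ 2 / (δ * A ^ 2) * (2 ^ (2 * L) * x / l ^ 2)) (2 ^ (2 * L + 1)) := by
  have hp : (2 : ℝ) ^ (2 * L + 2) = 4 * 2 ^ (2 * L) := by rw [pow_add]; ring
  have hp' : (2 : ℝ) ^ (2 * L + 1) = 2 * 2 ^ (2 * L) := by rw [pow_add]; ring
  rw [hp, hp', mul_max_of_nonneg _ _ (by norm_num : (0 : ℝ) ≤ 4)]
  refine max_le_max (le_of_eq ?_) ?_
  · field_simp
  · rw [one_div_one_div]
    have : (0 : ℝ) < 2 ^ (2 * L) := by positivity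
    linarith

end BCART

/-! ### Assembly of the theorem. -/

open BCART in
theorem mainTheorem7 :
    (∃ K : ℝ, 0 < K ∧
      ∀ c : ℝ, 3 < c → ∃ A₀ : ℝ, 0 < A₀ ∧ ∀ A : ℝ, A₀ ≤ A → ∀ C : ℝ, 0 < C →
      ∀ s : Sampler, s.Valid → ∃ L₀ : ℕ, ∀ L Lmax n : ℕ, L₀ ≤ L → L ≤ Lmax → n = sampleSize Lmax →
      ∀ (B : Finset Index) (β : Index → ℝ) (Ts : CartTree L),
        SignalAssumption n L A C B β →
        IsLeast {T : CartTree L | B ⊆ T.int} Ts →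
        (s = Sampler.bayesianCART → Ts.int = insert none B) →
        ∃ E : Set (Fin n → ℝ), MeasurableSet E ∧ 1 - 4 / (n : ℝ) ≤ (noiseLaw n).real E ∧
          ∀ noise ∈ E, ∀ Y : Fin n → ℝ, Y = signalVec n B β + noise →
            (∀ T : CartTree L, ¬ Ts ≤ T →
              (transition s n c Y *ᵥ drift₁ n C (signalVec n B β)) T /
                  drift₁ n C (signalVec n B β) T ≤
                1 - s.delta L * A ^ 2 * Real.log n ^ 2 / (2 ^ (2 * L + 2) * C ^ 2 * n)
                  + (Real.exp 1 - 1) / (2 * (n : ℝ) ^ (A ^ 2 / 8 * Real.log n - 1))) ∧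
            (∀ T : CartTree L, Ts < T →
              (transition s n c Y *ᵥ drift₂ Ts) T / drift₂ Ts T ≤
                1 - 1 / 2 ^ (2 * L + 2) + s.bigM L / (n : ℝ) ^ (c - 3 / 2)
                  + (n : ℝ) ^ (1 - A ^ 2 * Real.log n / 8)) ∧
            (4 ≤ c → ∀ ε : ℝ, 0 < ε → ε < 1 →
              (mixingTime (lazyChain (transition (L := L) s n c Y)) (posterior n c Y) ε : ℝ≥0∞) ≤
                ENNReal.ofReal (K * twoDriftRate s n L A C ε))) ∧
    (∀ c A C : ℝ, 4 ≤ c → 0 < A → 0 < C → ∀ s : Sampler, s.Valid →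
      ∀ ε : ℝ, 0 < ε → ε < 1 → ∃ K : ℝ, 0 < K ∧
        ∀ L Lmax n m : ℕ, 1 ≤ L → L ≤ Lmax → n = sampleSize Lmax →
          twoDriftRate s n L A C ε ≤ K / Real.log n * canonicalPathRate s n L m c C ε) := by
  -- 952 = 4 · 238, where 4 comes from `max_inv_drift_le` and 238 from `mixingTime_le`. The
  -- threshold 4(c+3) exceeds 24 for c > 3, as the tail bounds require.
  refine ⟨⟨952, by norm_num, fun c hc => ⟨4 * (c + 3), by linarith, fun A hA C hC s hs => ?_⟩⟩, ?_⟩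
  · obtain ⟨L₀, hL₀⟩ := exists_forall_largeSample hs C
    refine ⟨L₀, ?_⟩
    rintro L Lmax n hL₀L hL rfl B β Ts hsig hleast hconn
    have hlarge := hL₀ L _ hL₀L (two_pow_le_sampleSize hL)
    have hA0 : 0 < A := by linarith
    have hA24 : 24 ≤ A := by linarith
    refine ⟨noiseEvent (sampleSize Lmax) L, measurableSet_noiseEvent _ _,
      noiseLaw_noiseEvent hL rfl, ?_⟩
    rintro noise hnoise Y rfl
    have h := concentrated_posterior hs hL hc hA hlarge hsig hleast hconn hnoise
    have hn0 : (0 : ℝ) < sampleSize Lmax := by linarith [h.one_lt]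
    have hlog := hlarge.one_le_log
    refine ⟨fun T hT => ?_, fun T hT => h.mulVec_drift₂_le hT, fun hc4 ε hε hε' => ?_⟩
    · have hdrift : drift₁ (L := L) (sampleSize Lmax) C (signalVec (sampleSize Lmax) B β) =
          missingEnergy (1 / (2 ^ L * C ^ 2)) B β :=
        funext fun T => drift₁_eq hL hsig.1 β C T
      rw [hdrift]
      refine (h.mulVec_missingEnergy_le hC hA0 hsig.2 hT).trans (le_of_eq ?_)
      rw [show (1 : ℝ) - A ^ 2 * Real.log (sampleSize Lmax) / 8 =
        -(A ^ 2 / 8 * Real.log (sampleSize Lmax) - 1) by ring, Real.rpow_neg hn0.le]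
      have := Real.rpow_pos_of_pos hn0 (A ^ 2 / 8 * Real.log (sampleSize Lmax) - 1)
      field_simp
    · have hδ := hlarge.delta_pos
      have hlog0 : 0 < Real.log (sampleSize Lmax) := by linarith
      refine (h.mixingTime_le hc4 hC hA0 hsig.2 (by positivity) rfl
        (hlarge.tail_le_rate (two_pow_le_sampleSize hL) hC hA24) rfl
        (hlarge.perturbation_le (two_pow_le_sampleSize hL) hA24 hc4) hε hε').trans
        (ENNReal.ofReal_le_ofReal ?_)
      have hlog6 : 0 < Real.log (6 / ε) := Real.log_pos (by rw [lt_div_iff₀ hε]; linarith)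
      have hmax := max_inv_drift_le hδ hA0 hC hlog0 hn0 L
      have := mul_le_mul_of_nonneg_right hmax hlog6.le
      rw [twoDriftRate]
      linarith
  · intro c A C hc hA hC s hs ε hε hε'
    have hlog6 : 0 < Real.log (6 / ε) := Real.log_pos (by rw [lt_div_iff₀ hε]; linarith)
    exact ⟨Real.log (6 / ε) * (C ^ 2 / A ^ 2 + 2), by positivity,
      fun L Lmax n m hL hLmax hn => twoDriftRate_le_canonicalPathRate hs hc hA hε hε' hL hLmax hn⟩
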